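/- Let $V$ and $W$ be finite-dimensional real vector spaces, let $G\subset \operatorname{GL}(V)$ and $H\subset\operatorname{GL}(W)$ be finite subgroups, acting also on the complexifications $V_{\mathbb C}=V\otimes_{\mathbb R}\mathbb C$ and $W_{\mathbb C}=W\otimes_{\mathbb R}\mathbb C$. Let $p_1,\dots,p_m$ be homogeneous generators of $\mathbb R[V]^G$ of degrees $d_1,\dots,d_m$, and $q_1,\dots,q_n$ homogeneous generators of $\mathbb R[W]^H$ of degrees $e_1,\dots,e_n$. Put $p=(p_1,\dots,p_m)\colon V_{\mathbb C}\to\mathbb C^m$, $q=(q_1,\dots,q_n)\colon W_{\mathbb C}\to\mathbb C^n$, and let $Y_{\mathbb C}=p(V_{\mathbb C})$ and $Z_{\mathbb C}=q(W_{\mathbb C})$ be the corresponding complex quotient varieties. The real number $t\neq 0$ acts on $Y_{\mathbb C}$ by $t\cdot(y_1,\dots,y_m)=(t^{d_1}y_1,\dots,t^{d_m}y_m)$ and on $Z_{\mathbb C}$ by $t\cdot(z_1,\dots,z_n)=(t^{e_1}z_1,\dots,t^{e_n}z_n)$. The strata of $Y_{\mathbb C}$ are the sets of points whose preimages in $V_{\mathbb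 C}$ have isotropy groups in a fixed conjugacy class of subgroups of $G$; a stratum has codimension one if its dimension is $\dim Y_{\mathbb C}-1$. Strata of $Z_{\mathbb C}$ are defined in the same way. Let $f_0\colon Y_{\mathbb C}\to Z_{\mathbb C}$ be an isomorphism of algebraic varieties which is quasilinear, i.e. $t^{-1}\cdot f_0(t\cdot y)=f_0(y)$ for all $t\in(0,1]$ and $y\in Y_{\mathbb C}$, and which maps the union of the closures of the codimension one strata of $Y_{\mathbb C}$ onto the union of the closures of the codimension one strata of $Z_{\mathbb C}$. Then there is a complex linear isomorphism $F\colon V_{\mathbb C}\to W_{\mathbb C}$ which is a quasi-isomorphism, i.e. $F$ sends $G$-orbits to $H$-orbits and $F^{-1}$ sends $H$-orbits to $G$-orbits, and which induces $f_0$, i.e. $q(F(v))=f_0(p(v))$ for all $v\in V_{\mathbb C}$. -/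

import Mathlib

open scoped TensorProduct

noncomputable section

namespace QuotientLift

/-- The complexification `V_ℂ = ℂ ⊗ V` of a real vector space. -/
abbrev Cplx (V : Type*) [AddCommGroup V] [Module ℝ V] : Type _ := ℂ ⊗[ℝ] V

/-- The algebra `ℝ[V]` of polynomial functions on a finite dimensional real vector space,
written in linear coordinates with respect to a basis of `V`. -/
abbrev PolyRing (V : Type*) [AddCommGroup V] [Module ℝ V] : Type :=
  MvPolynomial (Fin (Module.finrank ℝ V)) ℝ

section Poly

variable {V : Type*} [AddCommGroup V] [Module ℝ V] [FiniteDimensional ℝ V]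

/-- The value of a polynomial function at a point of `V`. -/
def evalReal (v : V) (P : PolyRing V) : ℝ :=
  MvPolynomial.eval (fun i => (Module.finBasis ℝ V).repr v i) P

/-- The value of a polynomial function at a point of `V_ℂ`. -/
def evalCplx (v : Cplx V) (P : PolyRing V) : ℂ :=
  MvPolynomial.aeval (fun i => ((Module.finBasis ℝ V).baseChange ℂ).repr v i) P

/-- The algebra `ℝ[V]^G` of `G`-invariant polynomial functions. -/
def invariants (G : Subgroup (V ≃ₗ[ℝ] V)) : Subalgebra ℝ (PolyRing V) where
  carrier := {P | ∀ g ∈ G, ∀ v : V, evalReal (g v) P = evalReal v P}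
  mul_mem' := by
    intro P Q hP hQ g hg v
    have h1 := hP g hg v
    have h2 := hQ g hg v
    simp only [evalReal, map_mul] at h1 h2 ⊢
    rw [h1, h2]
  add_mem' := by
    intro P Q hP hQ g hg v
    have h1 := hP g hg v
    have h2 := hQ g hg v
    simp only [evalReal, map_add] at h1 h2 ⊢
    rw [h1, h2]
  algebraMap_mem' := by
    intro r g hg v
    simp [evalReal, MvPolynomial.algebraMap_eq]

end Poly

section Action

variable {V : Type*} [AddCommGroup V] [Module ℝ V]

/-- The `G`-orbit of a point of `V_ℂ`. -/
def orbit (G : Subgroup (V ≃ₗ[ℝ] V)) (v : Cplx V) : Set (Cplx V) :=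
  {w | ∃ g ∈ G, w = LinearMap.baseChange ℂ (g : V →ₗ[ℝ] V) v}

/-- The isotropy group in `G` of a point of `V_ℂ`, as a set of elements of `GL(V)`. -/
def isotropy (G : Subgroup (V ≃ₗ[ℝ] V)) (v : Cplx V) : Set (V ≃ₗ[ℝ] V) :=
  {g | g ∈ G ∧ LinearMap.baseChange ℂ (g : V →ₗ[ℝ] V) v = v}

/-- Two points of `V_ℂ` have the same isotropy type: their isotropy groups are conjugate
in `G`. -/
def SameIsotropyType (G : Subgroup (V ≃ₗ[ℝ] V)) (v w : Cplx V) : Prop :=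
  ∃ g ∈ G, isotropy G w = (fun k => g * k * g⁻¹) '' isotropy G v

/-- A complex linear isomorphism `V_ℂ → W_ℂ` is a quasi-isomorphism if it sends `G`-orbits to
`H`-orbits and its inverse sends `H`-orbits to `G`-orbits. -/
def IsQuasiIsomorphism {W : Type*} [AddCommGroup W] [Module ℝ W]
    (G : Subgroup (V ≃ₗ[ℝ] V)) (H : Subgroup (W ≃ₗ[ℝ] W)) (F : Cplx V ≃ₗ[ℂ] Cplx W) : Prop :=
  (∀ v : Cplx V, F '' orbit G v = orbit H (F v)) ∧
    ∀ w : Cplx W, F.symm '' orbit H w = orbit G (F.symm w)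

end Action

section Zariski

variable {m : ℕ}

/-- The Zariski closure of a subset of `ℂ^m`. -/
def zariskiClosure (S : Set (Fin m → ℂ)) : Set (Fin m → ℂ) :=
  MvPolynomial.zeroLocus ℂ (MvPolynomial.vanishingIdeal ℂ S)

/-- The dimension of (the Zariski closure of) a subset of `ℂ^m`: the Krull dimension of the
ring of regular functions `ℂ[y_1, …, y_m] / I(S)`. -/
def zariskiDim (S : Set (Fin m → ℂ)) : WithBot ℕ∞ :=
  ringKrullDim (MvPolynomial (Fin m) ℂ ⧸ MvPolynomial.vanishingIdeal ℂ S)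

/-- A map between subsets of affine spaces is regular if it is given by polynomials. -/
def IsRegularMap {n : ℕ} {Y : Set (Fin m → ℂ)} {Z : Set (Fin n → ℂ)} (f : Y → Z) : Prop :=
  ∃ P : Fin n → MvPolynomial (Fin m) ℂ,
    ∀ (y : Y) (j : Fin n), (f y : Fin n → ℂ) j = MvPolynomial.eval (y : Fin m → ℂ) (P j)

/-- The weighted scaling `t · (y_1, …, y_m) = (t^{d_1} y_1, …, t^{d_m} y_m)`. -/
def scale (d : Fin m → ℕ) (t : ℝ) (y : Fin m → ℂ) : Fin m → ℂ :=
  fun i => (t : ℂ) ^ d i * y i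

end Zariski

/-- A finite system `p_1, …, p_m` of homogeneous generators of `ℝ[V]^G`, with their degrees. -/
structure HomogeneousGenerators {V : Type*} [AddCommGroup V] [Module ℝ V]
    [FiniteDimensional ℝ V] (G : Subgroup (V ≃ₗ[ℝ] V)) (m : ℕ) where
  poly : Fin m → PolyRing V
  deg : Fin m → ℕ
  isHomogeneous : ∀ i, (poly i).IsHomogeneous (deg i)
  adjoin_eq : Algebra.adjoin ℝ (Set.range poly) = invariants G

namespace HomogeneousGenerators

variable {V : Type*} [AddCommGroup V] [Module ℝ V] [FiniteDimensional ℝ V]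
  {G : Subgroup (V ≃ₗ[ℝ] V)} {m : ℕ} (p : HomogeneousGenerators G m)

/-- The map `p = (p_1, …, p_m) : V_ℂ → ℂ^m`. -/
def map (v : Cplx V) : Fin m → ℂ := fun i => evalCplx v (p.poly i)

/-- The complex quotient variety `Y_ℂ`, realized as `p(V_ℂ) ⊆ ℂ^m`. -/
def quotientVariety : Set (Fin m → ℂ) := Set.range p.map

/-- The image in `Y_ℂ` of a point of `V_ℂ`. -/
def proj (v : Cplx V) : p.quotientVariety := ⟨p.map v, v, rfl⟩

/-- A stratum of `Y_ℂ`: the set of points whose preimages in `V_ℂ` have isotropy groups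
in one fixed conjugacy class. -/
def IsStratum (S : Set (Fin m → ℂ)) : Prop :=
  ∃ v : Cplx V, S = p.map '' {w | SameIsotropyType G v w}

/-- A codimension one stratum of `Y_ℂ`. -/
def IsCodimOneStratum (S : Set (Fin m → ℂ)) : Prop :=
  p.IsStratum S ∧ zariskiDim S + 1 = zariskiDim p.quotientVariety

/-- The union of the closures of the codimension one strata of `Y_ℂ`. -/
def codimOneLocus : Set (Fin m → ℂ) :=
  {y | ∃ S, p.IsCodimOneStratum S ∧ y ∈ zariskiClosure S}

theorem map_scale (t : ℝ) (v : Cplx V) : p.map ((t : ℂ) • v) = scale p.deg t (p.map v) := by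
  funext i
  simp only [map, scale, evalCplx, map_smul, Finsupp.smul_apply, smul_eq_mul]
  rw [MvPolynomial.aeval_def, MvPolynomial.aeval_def, MvPolynomial.eval₂_eq',
    MvPolynomial.eval₂_eq', Finset.mul_sum]
  refine Finset.sum_congr rfl fun a ha => ?_
  have hd := p.isHomogeneous i (MvPolynomial.mem_support_iff.1 ha)
  have hd' : ∑ j, a j = p.deg i := by
    rw [← hd, Finsupp.weight_apply, Finsupp.sum_fintype] <;> simp
  simp only [mul_pow, Finset.prod_mul_distrib, Finset.prod_pow_eq_pow_sum, hd']
  ring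

/-- `Y_ℂ` is stable under the weighted scaling. -/
theorem scale_mem (t : ℝ) {y : Fin m → ℂ} (hy : y ∈ p.quotientVariety) :
    scale p.deg t y ∈ p.quotientVariety := by
  obtain ⟨v, rfl⟩ := hy
  exact ⟨(t : ℂ) • v, p.map_scale t v⟩

/-- The weighted scaling as a map `Y_ℂ → Y_ℂ`. -/
def act (t : ℝ) (y : p.quotientVariety) : p.quotientVariety :=
  ⟨scale p.deg t y, p.scale_mem t y.2⟩

end HomogeneousGenerators

section Maps

variable {V W : Type*} [AddCommGroup V] [Module ℝ V] [FiniteDimensional ℝ V]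
  [AddCommGroup W] [Module ℝ W] [FiniteDimensional ℝ W]
  {G : Subgroup (V ≃ₗ[ℝ] V)} {H : Subgroup (W ≃ₗ[ℝ] W)} {m n : ℕ}

/-- `f : Y_ℂ → Z_ℂ` is quasilinear if `f_t(y) := t⁻¹ · f(t · y)` equals `f(y)` for all
`t ∈ (0, 1]` and all `y`. -/
def IsQuasilinear (p : HomogeneousGenerators G m) (q : HomogeneousGenerators H n)
    (f : p.quotientVariety → q.quotientVariety) : Prop :=
  ∀ t ∈ Set.Ioc (0 : ℝ) 1, ∀ y, q.act t⁻¹ (f (p.act t y)) = f y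

end Maps

end QuotientLift

end

/-! After passing to coordinates, `f₀` becomes a relation `R` between points of `ℂ^ι` and `ℂ^κ`
(`OrbitCorrespondence`): it matches orbits with orbits, transports invariant polynomials both ways,
commutes with complex scaling and matches reflection hyperplanes. The last property encodes the
hypothesis on strata, because the images of the reflection hyperplanes are exactly the closures of
the codimension one strata (`exists_stratum_iff_onHyperplane`). The task is to find a linear `F`
with `R v (F v)`.

Fix a point `u` off the reflection hyperplanes, related to a point `B` with trivial isotropy. For
generic `v` every point of the line `s ↦ v + s u` has a local holomorphic lift to `ℂ^κ`
(`exists_generic_line`). Such a line meets only points whose related points have isotropy trivial or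
generated by one reflection. In the first case all coordinates continue analytically. In the second,
the linear form of the reflection has to be found from its square. The discriminants on the two
sides agree up to a nowhere vanishing factor (`exists_disc_eq`), so this square is `(s - s₀)²` times
a holomorphic unit and has a holomorphic root. Since the groups are real, reflections have order
two, and the discriminant is a product of squares of linear forms.

Two local lifts differ by a group element, so an invariant `f` evaluated on the velocity of a lift
is a well defined entire function of `s`; no global lift is needed. By homogeneity a lift `ω` of `ε
↦ u + ε v` near `ε = 0` yields the lift `s ω(1/s)` near `s = ∞`, with velocity `ω(ε) - ε ω'(ε)` at
`ε = 1/s`, which tends to `B`. By Liouville the entire function is constantly `f(B)`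
(`eval_sub_smul_velocity_eq`). Hence `ω - ε ω'` stays in the finite orbit of `B`, equals `B` by
continuity, and so `ω(ε) = B + ε A` (`exists_affine_lift`).

The pairs `(v, A)` satisfy linear equations given by the differentials of the invariants, and these
equations define the graph of a linear map `F` (`exists_linearMap`). Density gives `R (u + v) (B + F
v)` for all `v`; scaling then gives `R (v + ε u) (F v + ε B)`, and `ε = 0` finishes. Applying the
argument to the inverse relation shows that the dimensions agree. -/

noncomputable section

namespace QuotientLift

open MvPolynomial Matrix Topology Filter

set_option linter.unusedSectionVars false

/-! ### Polynomial functions, lines and generic points. -/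

section PolynomialFunctions

variable {ι κ μ : Type*} [Fintype ι] [Fintype κ] [Fintype μ]

/-- The linear form with coefficient vector `c`, as a polynomial. -/
def linForm (c : ι → ℂ) : MvPolynomial ι ℂ := ∑ i, C (c i) * X i

@[simp]
theorem eval_linForm (c v : ι → ℂ) : eval v (linForm c) = c ⬝ᵥ v := by
  simp [linForm, dotProduct]

/-- Precomposition of polynomial functions with a linear map. -/
def pullback [DecidableEq ι] (L : (ι → ℂ) →ₗ[ℂ] (κ → ℂ)) :
    MvPolynomial κ ℂ →ₐ[ℂ] MvPolynomial ι ℂ :=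
  aeval fun k => linForm fun i => L (Pi.single i 1) k

@[simp]
theorem eval_pullback [DecidableEq ι] (L : (ι → ℂ) →ₗ[ℂ] (κ → ℂ)) (v : ι → ℂ)
    (f : MvPolynomial κ ℂ) : eval v (pullback L f) = eval (L v) f := by
  have h : ∀ k, (fun i => L (Pi.single i 1) k) ⬝ᵥ v = L v k := by
    intro k
    have hv : v = ∑ i, v i • (Pi.single i 1 : ι → ℂ) := by
      ext j; simp [Finset.sum_apply, Pi.single_apply]
    conv_rhs => rw [hv, map_sum]
    simp [dotProduct, mul_comm]
  induction f using MvPolynomial.induction_on with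
  | C a => simp [pullback]
  | add p q hp hq => simp [hp, hq]
  | mul_X p k hp => rw [map_mul, map_mul, hp, map_mul]; simp [pullback, h]

/-- The derivative at `x` of a polynomial function in the direction `ξ`. -/
def dirDeriv (f : MvPolynomial ι ℂ) (x : ι → ℂ) : (ι → ℂ) →ₗ[ℂ] ℂ where
  toFun ξ := ∑ i, eval x (pderiv i f) * ξ i
  map_add' ξ η := by simp [mul_add, Finset.sum_add_distrib]
  map_smul' c ξ := by
    simp only [Pi.smul_apply, smul_eq_mul, RingHom.id_apply, Finset.mul_sum]
    exact Finset.sum_congr rfl fun i _ => by ring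

theorem hasDerivAt_eval_comp (f : MvPolynomial ι ℂ) {γ : ℂ → ι → ℂ} {γ' : ι → ℂ} {s : ℂ}
    (hγ : ∀ i, HasDerivAt (fun t => γ t i) (γ' i) s) :
    HasDerivAt (fun t => eval (γ t) f) (dirDeriv f (γ s) γ') s := by
  classical
  induction f using MvPolynomial.induction_on with
  | C a => simpa [dirDeriv] using hasDerivAt_const s a
  | add p q hp hq =>
    have := hp.add hq
    simp only [dirDeriv, LinearMap.coe_mk, AddHom.coe_mk, map_add, add_mul,
      Finset.sum_add_distrib] at this ⊢
    exact this
  | mul_X p k hp =>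
    have := hp.mul (hγ k)
    have he : (fun t => eval (γ t) (p * X k)) = fun t => eval (γ t) p * γ t k := by
      ext t; simp
    rw [he]
    refine this.congr_deriv ?_
    simp only [dirDeriv, LinearMap.coe_mk, AddHom.coe_mk, Derivation.leibniz, map_add, smul_eq_mul,
      map_mul, eval_X, pderiv_X, add_mul, Finset.sum_add_distrib, Finset.sum_mul]
    rw [add_comm]
    congr 1
    swap
    · exact Finset.sum_congr rfl fun i _ => by ring
    · rw [Finset.sum_eq_single k]
      · simp
      · intro b _ hb; simp [hb.symm]
      · simp

theorem analyticAt_eval_comp {E : Type*} [NormedAddCommGroup E] [NormedSpace ℂ E]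
    (f : MvPolynomial ι ℂ) {γ : E → ι → ℂ} {s : E}
    (hγ : ∀ i, AnalyticAt ℂ (fun t => γ t i) s) : AnalyticAt ℂ (fun t => eval (γ t) f) s := by
  induction f using MvPolynomial.induction_on with
  | C a => simpa using analyticAt_const
  | add p q hp hq => simpa using hp.fun_add hq
  | mul_X p k hp => simpa using hp.fun_mul (hγ k)

/-- The restriction of a polynomial function to a parametrized line. -/
def restrictLine (f : MvPolynomial ι ℂ) (x y : ι → ℂ) : Polynomial ℂ :=
  aeval (fun i => Polynomial.C (x i) + Polynomial.X * Polynomial.C (y i)) f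

@[simp]
theorem eval_restrictLine (f : MvPolynomial ι ℂ) (x y : ι → ℂ) (s : ℂ) :
    (restrictLine f x y).eval s = eval (x + s • y) f := by
  induction f using MvPolynomial.induction_on with
  | C a => simp [restrictLine]
  | add p q hp hq => simpa [restrictLine] using congrArg₂ (· + ·) hp hq
  | mul_X p k hp =>
    simp only [restrictLine, map_mul, aeval_X, Polynomial.eval_mul, eval_X] at hp ⊢
    rw [hp]
    simp only [Polynomial.eval_add, Polynomial.eval_mul, Polynomial.eval_C, Polynomial.eval_X,
      Pi.add_apply, Pi.smul_apply, smul_eq_mul]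

theorem exists_eval_ne_zero {f : MvPolynomial ι ℂ} (hf : f ≠ 0) : ∃ v, eval v f ≠ 0 := by
  by_contra! h
  exact hf (MvPolynomial.funext fun v => by simp [h v])

theorem linForm_ne_zero {c : ι → ℂ} (hc : c ≠ 0) : linForm c ≠ 0 := by
  classical
  intro h
  obtain ⟨i, hi⟩ := Function.ne_iff.1 hc
  apply hi
  have := eval_linForm c (Pi.single i 1)
  simpa [h] using this.symm

theorem prod_eval_ne_zero_iff {τ : Type*} (s : Finset τ) (f : τ → MvPolynomial ι ℂ) (v : ι → ℂ) :
    eval v (∏ i ∈ s, f i) ≠ 0 ↔ ∀ i ∈ s, eval v (f i) ≠ 0 := by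
  rw [map_prod, Finset.prod_ne_zero_iff]

/-- A line through a point where a nonzero polynomial does not vanish meets its zero locus in
finitely many points. -/
theorem finite_zeros_line {f : MvPolynomial ι ℂ} {x : ι → ℂ} (hx : eval x f ≠ 0) (y : ι → ℂ) :
    {s : ℂ | eval (x + s • y) f = 0}.Finite := by
  have h0 : restrictLine f x y ≠ 0 := by
    intro h
    apply hx
    have := eval_restrictLine f x y 0
    simpa [h] using this.symm
  refine (restrictLine f x y).roots.toFinset.finite_toSet.subset fun s hs => ?_
  simpa [h0] using hs

theorem span_eval_ne_zero {f : MvPolynomial ι ℂ} (hf : f ≠ 0) :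
    Submodule.span ℂ {v : ι → ℂ | eval v f ≠ 0} = ⊤ := by
  obtain ⟨x, hx⟩ := exists_eval_ne_zero hf
  refine eq_top_iff.2 fun y _ => ?_
  -- Any `y` is a difference quotient of two points off the zero locus, namely `x` and `x + t y` for
  -- a suitable `t ≠ 0`.
  have hfin := finite_zeros_line hx y
  obtain ⟨t, ht⟩ := (hfin.union (Set.finite_singleton 0)).infinite_compl.nonempty
  simp only [Set.mem_compl_iff, Set.mem_union, Set.mem_ofPred_eq, Set.mem_singleton_iff,
    not_or] at ht
  have h1 : x + t • y ∈ Submodule.span ℂ {v : ι → ℂ | eval v f ≠ 0} := Submodule.subset_span ht.1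
  have h2 : x ∈ Submodule.span ℂ {v : ι → ℂ | eval v f ≠ 0} := Submodule.subset_span hx
  have h3 := Submodule.smul_mem _ t⁻¹ (Submodule.sub_mem _ h1 h2)
  rwa [add_sub_cancel_left, smul_smul, inv_mul_cancel₀ ht.2, one_smul] at h3

/-- Polynomial functions agreeing off the zero locus of a nonzero polynomial are equal. -/
theorem eq_of_eval_eq_of_ne_zero {f g d : MvPolynomial ι ℂ} (hd : d ≠ 0)
    (h : ∀ v, eval v d ≠ 0 → eval v f = eval v g) : f = g := by
  have : d * (f - g) = 0 := MvPolynomial.funext fun v => by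
    by_cases hv : eval v d = 0
    · simp [hv]
    · simp [h v hv]
  exact sub_eq_zero.1 ((mul_eq_zero.1 this).resolve_left hd)

/-- Two vectors are non-proportional. -/
def Indep (c c' : ι → ℂ) : Prop := ∃ i j, c i * c' j ≠ c j * c' i

theorem Indep.ne_zero_left {c c' : ι → ℂ} (h : Indep c c') : c ≠ 0 := by
  rintro rfl
  simp [Indep] at h

theorem exists_smul_of_not_indep {c c' : ι → ℂ} (hc : c ≠ 0) (h : ¬ Indep c c') :
    ∃ t : ℂ, c' = t • c := by
  obtain ⟨i, hi⟩ := Function.ne_iff.1 hc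
  simp only [Indep, not_exists, not_not] at h
  refine ⟨c' i / c i, _root_.funext fun j => ?_⟩
  have := h i j
  simp only [Pi.zero_apply] at hi
  simp only [Pi.smul_apply, smul_eq_mul]
  field_simp
  linear_combination this

/-- If a point off both hyperplanes is used as the direction, a generic line avoids the
intersection of two distinct hyperplanes. -/
theorem exists_line_avoid_indep {c c' : ι → ℂ} (h : Indep c c') {u : ι → ℂ}
    (hu : c ⬝ᵥ u ≠ 0) : ∃ f : MvPolynomial ι ℂ, f ≠ 0 ∧ ∀ v, eval v f ≠ 0 →
      ∀ s : ℂ, ¬ (c ⬝ᵥ (v + s • u) = 0 ∧ c' ⬝ᵥ (v + s • u) = 0) := by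
  -- This combination of the two forms kills `u`, so it is constant along the line; it vanishes
  -- wherever both forms do.
  refine ⟨linForm ((c ⬝ᵥ u) • c' - (c' ⬝ᵥ u) • c), linForm_ne_zero fun h0 => ?_, ?_⟩
  · obtain ⟨i, j, hij⟩ := h
    apply hij
    have hi := congrFun h0 i
    have hj := congrFun h0 j
    simp only [Pi.sub_apply, Pi.smul_apply, smul_eq_mul, Pi.zero_apply] at hi hj
    apply mul_left_cancel₀ hu
    linear_combination c i * hj - c j * hi
  · rintro v hv s ⟨h1, h2⟩
    apply hv
    simp only [dotProduct_add, dotProduct_smul, smul_eq_mul] at h1 h2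
    simp only [eval_linForm, sub_dotProduct, smul_dotProduct, smul_eq_mul]
    linear_combination (c ⬝ᵥ u) * h2 - (c' ⬝ᵥ u) * h1

end PolynomialFunctions

end QuotientLift
end

noncomputable section

namespace QuotientLift

open MvPolynomial Matrix Topology Filter

set_option linter.unusedSectionVars false

/-! ### Real matrices of finite order: identity, reflections, and the rest. -/

section RealReflections

variable {ι : Type*} [Fintype ι] [DecidableEq ι]

/-- `M` is the reflection `x ↦ x - ⟨ℓ, x⟩ e`. -/
def IsRefl (M : Matrix ι ι ℝ) (l e : ι → ℝ) : Prop := M = 1 - vecMulVec e l ∧ l ⬝ᵥ e = 2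

/-- A nontrivial transvection has infinite order in characteristic zero: the rank one part `N`
squares to zero, so the `k`-th power is `1 - k N`. -/
theorem vecMulVec_eq_zero_of_pow_eq_one {l e : ι → ℝ} (h : l ⬝ᵥ e = 0) {k : ℕ} (hk : 0 < k)
    (hM : (1 - vecMulVec e l) ^ k = 1) : vecMulVec e l = 0 := by
  have h0 : vecMulVec e l * vecMulVec e l = 0 := by
    rw [vecMulVec_mul_vecMulVec, h]; simp
  have hp : ∀ j : ℕ, (1 - vecMulVec e l) ^ j = 1 - (j : ℝ) • vecMulVec e l := by
    intro j
    induction j with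
    | zero => simp
    | succ j ih =>
      rw [pow_succ, ih, sub_mul, mul_sub, mul_sub, smul_mul_assoc, smul_mul_assoc, h0]
      push_cast
      simp only [one_mul, mul_one, smul_zero, sub_zero, add_smul, one_smul]
      abel
  rw [hp k, sub_eq_self, smul_eq_zero] at hM
  exact hM.resolve_left (by exact_mod_cast hk.ne')

/-- The vector `e` is an eigenvector with eigenvalue `1 - l ⬝ᵥ e`, a real root of unity and hence
`±1`. The value `1` would give a transvection of finite order. -/
theorem isRefl_of_rank_one {l e : ι → ℝ} {k : ℕ} (hk : 0 < k)
    (hM : (1 - vecMulVec e l) ^ k = 1) (hne : vecMulVec e l ≠ 0) : l ⬝ᵥ e = 2 := by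
  have he : e ≠ 0 := by rintro rfl; simp at hne
  have hp : ∀ j : ℕ, (1 - vecMulVec e l) ^ j *ᵥ e = (1 - l ⬝ᵥ e) ^ j • e := by
    intro j
    induction j with
    | zero => simp
    | succ j ih =>
      rw [pow_succ', ← mulVec_mulVec, ih, mulVec_smul, sub_mulVec, one_mulVec, vecMulVec_mulVec,
        pow_succ, mul_smul, sub_smul, one_smul, op_smul_eq_smul]
  have h1 := hp k
  rw [hM, one_mulVec] at h1
  have h2 : (1 - l ⬝ᵥ e) ^ k = 1 := by
    obtain ⟨i, hi⟩ := Function.ne_iff.1 he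
    have := congrFun h1 i
    simp only [Pi.smul_apply, smul_eq_mul] at this
    exact mul_right_cancel₀ hi (by rw [one_mul]; exact this.symm)
  have h3 : |1 - l ⬝ᵥ e| = 1 := by
    have := congrArg abs h2
    rw [abs_pow, abs_one] at this
    exact (pow_eq_one_iff_of_nonneg (abs_nonneg _) hk.ne').1 this
  rcases (abs_eq zero_le_one).1 h3 with h | h
  · exact absurd (vecMulVec_eq_zero_of_pow_eq_one (by linarith) hk hM) hne
  · linarith

/-- The complexification of a real vector. -/
def toC (l : ι → ℝ) : ι → ℂ := fun i => (l i : ℂ)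

/-- A real matrix of finite order is the identity, a reflection, or has fixed space of
codimension at least two. -/
theorem trichotomy_of_pow_eq_one {M : Matrix ι ι ℝ} {k : ℕ} (hk : 0 < k) (hM : M ^ k = 1) :
    M = 1 ∨ (∃ l e, IsRefl M l e) ∨
      ∃ i j, Indep (toC ((1 - M) i)) (toC ((1 - M) j)) := by
  by_cases h1 : M = 1
  · exact Or.inl h1
  refine Or.inr ?_
  by_cases h2 : ∃ i j, Indep (toC ((1 - M) i)) (toC ((1 - M) j))
  · exact Or.inr h2
  refine Or.inl ?_
  set N := 1 - M with hN
  have hN0 : N ≠ 0 := fun h => h1 (by rw [hN, sub_eq_zero] at h; exact h.symm)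
  obtain ⟨i, hi⟩ := Function.ne_iff.1 hN0
  obtain ⟨j, hij⟩ := Function.ne_iff.1 hi
  have hij' : N i j ≠ 0 := hij
  -- All rows are proportional to row `i`; the entries in column `j`, where row `i` is nonzero, give
  -- the factors.
  have hrank : N = vecMulVec (fun a => N a j / N i j) (N i) := by
    ext a b
    have : ¬ Indep (toC (N i)) (toC (N a)) := fun h => h2 ⟨i, a, h⟩
    simp only [Indep, not_exists, not_not, toC] at this
    have h := this j b
    norm_cast at h
    rw [vecMulVec_apply]
    field_simp
    linarith
  have hM' : M = 1 - vecMulVec (fun a => N a j / N i j) (N i) := by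
    rw [← hrank, hN]; abel
  refine ⟨N i, fun a => N a j / N i j, hM', isRefl_of_rank_one hk (by rw [← hM', hM]) ?_⟩
  rw [← hrank]; exact hN0

theorem IsRefl.ne_zero_left {M : Matrix ι ι ℝ} {l e : ι → ℝ} (h : IsRefl M l e) : l ≠ 0 := by
  rintro rfl
  simpa using h.2

theorem IsRefl.ne_zero_right {M : Matrix ι ι ℝ} {l e : ι → ℝ} (h : IsRefl M l e) : e ≠ 0 := by
  rintro rfl
  simpa using h.2

theorem IsRefl.ne_one {M : Matrix ι ι ℝ} {l e : ι → ℝ} (h : IsRefl M l e) : M ≠ 1 := by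
  intro h1
  have h2 : vecMulVec e l *ᵥ e = 0 := by
    have := h.1
    rw [h1, eq_comm, sub_eq_self] at this
    rw [this, zero_mulVec]
  rw [vecMulVec_mulVec, h.2, op_smul_eq_smul, smul_eq_zero] at h2
  exact h.ne_zero_right (h2.resolve_left two_ne_zero)

theorem toC_ne_zero {l : ι → ℝ} (h : l ≠ 0) : toC l ≠ 0 := by
  obtain ⟨i, hi⟩ := Function.ne_iff.1 h
  exact fun h0 => hi (by simpa [toC] using congrFun h0 i)

/-- Two reflections with the same hyperplane whose product has finite order agree. -/
theorem IsRefl.eq_of_not_indep {M M' : Matrix ι ι ℝ} {l e l' e' : ι → ℝ} (h : IsRefl M l e)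
    (h' : IsRefl M' l' e') (hi : ¬ Indep (toC l) (toC l')) {k : ℕ} (hk : 0 < k)
    (hM : (M * M') ^ k = 1) : M = M' := by
  obtain ⟨t, ht⟩ : ∃ t : ℝ, l' = t • l := by
    obtain ⟨i, hi0⟩ := Function.ne_iff.1 h.ne_zero_left
    refine ⟨l' i / l i, _root_.funext fun j => ?_⟩
    simp only [Indep, not_exists, not_not, toC] at hi
    have := hi i j
    norm_cast at this
    simp only [Pi.zero_apply] at hi0
    simp only [Pi.smul_apply, smul_eq_mul]
    field_simp
    linarith
  have hl' : l ⬝ᵥ (t • e') = 2 := by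
    rw [dotProduct_smul, ← smul_dotProduct, ← ht]; exact h'.2
  have hM' : M' = 1 - vecMulVec (t • e') l := by
    rw [h'.1, ht, vecMulVec_smul, smul_vecMulVec]
  set x := t • e'
  -- With a common form `l` the product of the reflections is a transvection, which finite order
  -- forces to be trivial.
  have hprod : M * M' = 1 - vecMulVec (x - e) l := by
    rw [h.1, hM', sub_mul, mul_sub, mul_sub, vecMulVec_mul_vecMulVec, hl', sub_vecMulVec]
    ext i j
    simp [vecMulVec_apply]
    ring
  have h0 : vecMulVec (x - e) l = 0 := by
    refine vecMulVec_eq_zero_of_pow_eq_one ?_ hk (by rw [← hprod, hM])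
    rw [dotProduct_sub, hl', h.2, sub_self]
  rw [sub_vecMulVec, sub_eq_zero] at h0
  rw [h.1, hM', h0]

end RealReflections

/-! ### Actions on complex points, isotropy groups, invariants and norms. -/

section Representations

variable {ι : Type*} [Fintype ι] [DecidableEq ι] {G : Type*} [Group G]

/-- The linear action on `ℂ^ι` of a group represented by real matrices. -/
def act (ρ : G →* Matrix ι ι ℝ) (g : G) : (ι → ℂ) →ₗ[ℂ] (ι → ℂ) :=
  ((ρ g).map (algebraMap ℝ ℂ)).mulVecLin

variable (ρ : G →* Matrix ι ι ℝ)

@[simp]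
theorem act_one (v : ι → ℂ) : act ρ 1 v = v := by
  simp [act, Matrix.map_one]

theorem act_mul (g h : G) (v : ι → ℂ) : act ρ (g * h) v = act ρ g (act ρ h v) := by
  simp only [act, map_mul, Matrix.map_mul, mulVecLin_apply, mulVec_mulVec]

@[simp]
theorem act_inv_act (g : G) (v : ι → ℂ) : act ρ g⁻¹ (act ρ g v) = v := by
  rw [← act_mul]; simp

@[simp]
theorem act_act_inv (g : G) (v : ι → ℂ) : act ρ g (act ρ g⁻¹ v) = v := by
  rw [← act_mul]; simp

/-- The isotropy group of a point. -/
def stab (v : ι → ℂ) : Subgroup G where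
  carrier := {g | act ρ g v = v}
  one_mem' := act_one ρ v
  mul_mem' {g h} hg hh := by
    simp only [Set.mem_ofPred_eq] at hg hh ⊢
    rw [act_mul, hh, hg]
  inv_mem' {g} hg := by
    simp only [Set.mem_ofPred_eq] at hg ⊢
    conv_lhs => rw [← hg]
    simp

@[simp]
theorem mem_stab {v : ι → ℂ} {g : G} : g ∈ stab ρ v ↔ act ρ g v = v := Iff.rfl

/-- Invariance of a polynomial function. -/
def IsInv (f : MvPolynomial ι ℂ) : Prop := ∀ g v, eval (act ρ g v) f = eval v f

variable {ρ}

theorem IsInv.of_mul {f f' : MvPolynomial ι ℂ} (h : IsInv ρ (f * f')) (h' : IsInv ρ f)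
    (h0 : f ≠ 0) : IsInv ρ f' := by
  intro g
  have : pullback (act ρ g) f' = f' := by
    refine eq_of_eval_eq_of_ne_zero h0 fun v hv => ?_
    have h1 := h g v
    rw [map_mul, map_mul, h' g v] at h1
    rw [eval_pullback]
    exact mul_left_cancel₀ hv h1
  intro v
  rw [← eval_pullback, this]

variable (ρ)

section Finite

variable [Finite G]

theorem exists_pow_card_eq_one : ∃ k, 0 < k ∧ ∀ g : G, ρ g ^ k = 1 :=
  ⟨Nat.card G, Nat.card_pos, fun g => by rw [← map_pow, pow_card_eq_one', map_one]⟩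

/-- The product of the translates of a polynomial function. -/
def norm (f : MvPolynomial ι ℂ) : MvPolynomial ι ℂ :=
  letI := Fintype.ofFinite G
  ∏ g, pullback (act ρ g) f

theorem eval_norm [Fintype G] (f : MvPolynomial ι ℂ) (v : ι → ℂ) :
    eval v (norm ρ f) = ∏ g, eval (act ρ g v) f := by
  rw [norm, map_prod]
  simp only [eval_pullback]
  congr!

theorem eval_norm_eq_zero_iff (f : MvPolynomial ι ℂ) (v : ι → ℂ) :
    eval v (norm ρ f) = 0 ↔ ∃ g, eval (act ρ g v) f = 0 := by
  let := Fintype.ofFinite G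
  rw [eval_norm, Finset.prod_eq_zero_iff]
  simp

theorem isInv_norm (f : MvPolynomial ι ℂ) : IsInv ρ (norm ρ f) := by
  let := Fintype.ofFinite G
  intro g v
  rw [eval_norm, eval_norm]
  simp only [← act_mul]
  exact Fintype.prod_equiv (Equiv.mulRight g) _ _ fun _ => rfl

theorem dvd_norm (f : MvPolynomial ι ℂ) : f ∣ norm ρ f := by
  let := Fintype.ofFinite G
  have h1 : pullback (act ρ 1) f = f := MvPolynomial.funext fun v => by simp
  have h2 : pullback (act ρ 1) f ∣ ∏ g, pullback (act ρ g) f :=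
    Finset.dvd_prod_of_mem _ (Finset.mem_univ _)
  rw [h1] at h2
  exact h2

theorem norm_ne_zero {f : MvPolynomial ι ℂ} (hf : f ≠ 0) : norm ρ f ≠ 0 := by
  let := Fintype.ofFinite G
  rw [norm, Finset.prod_ne_zero_iff]
  intro g _ h
  apply hf
  refine MvPolynomial.funext fun v => ?_
  have := congrArg (eval (act ρ g⁻¹ v)) h
  simpa using this

end Finite

/-- A point lies on the hyperplane of a reflection of the group. -/
def OnHyperplane (v : ι → ℂ) : Prop := ∃ g l e, IsRefl (ρ g) l e ∧ toC l ⬝ᵥ v = 0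

theorem act_eq_sub_smul {ρ : G →* Matrix ι ι ℝ} {g : G} {l e : ι → ℝ} (h : IsRefl (ρ g) l e)
    (v : ι → ℂ) : act ρ g v = v - (toC l ⬝ᵥ v) • toC e := by
  ext i
  simp only [act, h.1, mulVecLin_apply, mulVec, dotProduct, Matrix.map_apply, Matrix.sub_apply,
    vecMulVec_apply, Matrix.one_apply, toC, Pi.sub_apply, Pi.smul_apply, smul_eq_mul, map_sub,
    map_mul, sub_mul, Finset.sum_sub_distrib, Finset.sum_mul]
  congr 1
  · simp
  · exact Finset.sum_congr rfl fun j _ => by simp; ring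

theorem act_eq_self_iff_of_isRefl {ρ : G →* Matrix ι ι ℝ} {g : G} {l e : ι → ℝ}
    (h : IsRefl (ρ g) l e) (v : ι → ℂ) : act ρ g v = v ↔ toC l ⬝ᵥ v = 0 := by
  rw [act_eq_sub_smul h, sub_eq_self, smul_eq_zero]
  exact or_iff_left (toC_ne_zero h.ne_zero_right)

theorem row_dotProduct_of_act_eq {g : G} {v : ι → ℂ} (h : act ρ g v = v) (i : ι) :
    toC ((1 - ρ g) i) ⬝ᵥ v = 0 := by
  have := congrFun h i
  simp only [act, mulVecLin_apply, mulVec, dotProduct, Matrix.map_apply] at this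
  simp only [dotProduct, toC, Matrix.sub_apply, Complex.ofReal_sub, sub_mul,
    Finset.sum_sub_distrib]
  rw [sub_eq_zero]
  refine Eq.trans ?_ this.symm
  simp [Matrix.one_apply, apply_ite Complex.ofReal]

end Representations

end QuotientLift
end

/-! ### Analytic roots and the axioms of an orbit correspondence. -/

noncomputable section

namespace QuotientLift

open MvPolynomial Matrix Topology Filter

set_option linter.unusedSectionVars false

/-- Holomorphic dependence of a simple root on a parameter. -/
theorem exists_analytic_root {g : ℂ × ℂ → ℂ} {s₀ x₀ d : ℂ} (hg : AnalyticAt ℂ g (s₀, x₀))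
    (h0 : g (s₀, x₀) = 0) (hd : HasDerivAt (fun x => g (s₀, x)) d x₀) (hd0 : d ≠ 0) :
    ∃ x : ℂ → ℂ, AnalyticAt ℂ x s₀ ∧ x s₀ = x₀ ∧ ∀ᶠ s in 𝓝 s₀, g (s, x s) = 0 := by
  have hc : ContDiffAt ℂ ⊤ g (s₀, x₀) := hg.contDiffAt
  have hinv : (fderiv ℂ g (s₀, x₀) ∘L .inr ℂ ℂ ℂ).IsInvertible := by
    refine ⟨ContinuousLinearEquiv.unitsEquivAut ℂ (Units.mk0 d hd0), ?_⟩
    ext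
    have h1 : HasDerivAt (fun x => g (s₀, x)) (fderiv ℂ g (s₀, x₀) (0, 1)) x₀ := by
      have h2 : HasDerivAt (fun x : ℂ => (s₀, x)) ((0 : ℂ), (1 : ℂ)) x₀ :=
        (hasDerivAt_const x₀ s₀).prodMk (hasDerivAt_id x₀)
      exact hg.differentiableAt.hasFDerivAt.comp_hasDerivAt x₀ h2
    simp [hd.unique h1]
  refine ⟨hc.implicitFunction (by simp) hinv, ?_, ?_, ?_⟩
  · exact (hc.contDiffAt_implicitFunction (by simp) hinv).analyticAt
  · exact hc.implicitFunction_apply_self (by simp) hinv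
  · filter_upwards [hc.eventually_apply_implicitFunction (by simp) hinv] with s hs
    rw [hs, h0]

variable {ι κ : Type*} [Fintype ι] [DecidableEq ι] [Fintype κ] [DecidableEq κ]
  {G H : Type*} [Group G] [Group H]

/-- A correspondence between points of two representations which is induced by a scaling
equivariant isomorphism of the orbit varieties preserving reflection hyperplanes. -/
structure OrbitCorrespondence (ρ : G →* Matrix ι ι ℝ) (σ : H →* Matrix κ κ ℝ)
    (R : (ι → ℂ) → (κ → ℂ) → Prop) : Prop where
  injective_left : Function.Injective ρ
  injective_right : Function.Injective σ
  exists_right : ∀ v, ∃ w, R v w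
  exists_left : ∀ w, ∃ v, R v w
  right_iff : ∀ {v w}, R v w → ∀ {w'}, R v w' ↔ ∃ h, w' = act σ h w
  left_iff : ∀ {v w}, R v w → ∀ {v'}, R v' w ↔ ∃ g, v' = act ρ g v
  pull : ∀ {b}, IsInv σ b → ∃ a, ∀ v w, R v w → eval v a = eval w b
  push : ∀ {a}, IsInv ρ a → ∃ b, ∀ v w, R v w → eval w b = eval v a
  smul : ∀ {v w}, R v w → ∀ t : ℂ, R (t • v) (t • w)
  onHyperplane_iff : ∀ {v w}, R v w → (OnHyperplane ρ v ↔ OnHyperplane σ w)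

namespace OrbitCorrespondence

variable {ρ : G →* Matrix ι ι ℝ} {σ : H →* Matrix κ κ ℝ} {R : (ι → ℂ) → (κ → ℂ) → Prop}

theorem symm (hR : OrbitCorrespondence ρ σ R) : OrbitCorrespondence σ ρ fun w v => R v w where
  injective_left := hR.injective_right
  injective_right := hR.injective_left
  exists_right := hR.exists_left
  exists_left := hR.exists_right
  right_iff := hR.left_iff
  left_iff := hR.right_iff
  pull := fun h => let ⟨b, hb⟩ := hR.push h; ⟨b, fun v w => hb w v⟩
  push := fun h => let ⟨b, hb⟩ := hR.pull h; ⟨b, fun v w => hb w v⟩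
  smul := hR.smul
  onHyperplane_iff := fun h => (hR.onHyperplane_iff h).symm

theorem act_right (hR : OrbitCorrespondence ρ σ R) {v : ι → ℂ} {w : κ → ℂ} (h : R v w) (g : H) :
    R v (act σ g w) := (hR.right_iff h).2 ⟨g, rfl⟩

theorem act_left (hR : OrbitCorrespondence ρ σ R) {v : ι → ℂ} {w : κ → ℂ} (h : R v w) (g : G) :
    R (act ρ g v) w := (hR.left_iff h).2 ⟨g, rfl⟩

theorem isInv_pull (hR : OrbitCorrespondence ρ σ R) {a : MvPolynomial ι ℂ} {b : MvPolynomial κ ℂ}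
    (h : ∀ v w, R v w → eval v a = eval w b) : IsInv ρ a := by
  intro g v
  obtain ⟨w, hw⟩ := hR.exists_right v
  rw [h _ _ hw, h _ _ (hR.act_left hw g)]

theorem pull_ne_zero (hR : OrbitCorrespondence ρ σ R) {a : MvPolynomial ι ℂ}
    {b : MvPolynomial κ ℂ} (h : ∀ v w, R v w → eval v a = eval w b) (hb : b ≠ 0) : a ≠ 0 := by
  obtain ⟨w, hw⟩ := exists_eval_ne_zero hb
  obtain ⟨v, hv⟩ := hR.exists_left w
  rintro rfl
  exact hw (by rw [← h _ _ hv, map_zero])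

/-- Polynomials with invariant coefficients can be transported. -/
theorem pull_polynomial (hR : OrbitCorrespondence ρ σ R) {P : Polynomial (MvPolynomial κ ℂ)}
    (hP : ∀ h w, P.map (eval (act σ h w)) = P.map (eval w)) :
    ∃ Q : Polynomial (MvPolynomial ι ℂ), ∀ v w, R v w → Q.map (eval v) = P.map (eval w) := by
  have hc : ∀ i, ∃ a, ∀ v w, R v w → eval v a = eval w (P.coeff i) := by
    intro i
    refine hR.pull fun h w => ?_
    have := congrArg (fun q => q.coeff i) (hP h w)
    simpa [Polynomial.coeff_map] using this
  choose a ha using hc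
  refine ⟨∑ i ∈ P.support, Polynomial.monomial i (a i), fun v w h => ?_⟩
  conv_rhs => rw [P.as_sum_support]
  simp only [Polynomial.map_sum, Polynomial.map_monomial, ha _ v w h]

end OrbitCorrespondence

/-! ### Lagrange interpolation over the cosets of an isotropy group. -/

section Cosets

variable (σ : H →* Matrix κ κ ℝ) (K : Subgroup H)

/-- Invariance of a polynomial function under a subgroup. -/
def IsInvOn (f : MvPolynomial κ ℂ) : Prop := ∀ k ∈ K, ∀ w, eval (act σ k w) f = eval w f

variable {K}

/-- The translate of a `K`-invariant polynomial function by a coset of `K`. -/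
def translate (c : H ⧸ K) (f : MvPolynomial κ ℂ) : MvPolynomial κ ℂ :=
  pullback (act σ c.out⁻¹) f

variable {σ}

/-- The chosen representative of a coset differs from `h` by an element of `K`, which `f` does not
see. -/
theorem eval_translate_mk {f : MvPolynomial κ ℂ} (hf : IsInvOn σ K f) (h : H) (w : κ → ℂ) :
    eval w (translate σ (h : H ⧸ K) f) = eval (act σ h⁻¹ w) f := by
  obtain ⟨k, hk⟩ := QuotientGroup.mk_out_eq_mul K h
  rw [translate, eval_pullback, hk, _root_.mul_inv_rev, act_mul]
  exact hf _ (K.inv_mem k.2) _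

theorem eval_act_translate {f : MvPolynomial κ ℂ} (hf : IsInvOn σ K f) (h : H) (c : H ⧸ K)
    (w : κ → ℂ) : eval (act σ h w) (translate σ c f) = eval w (translate σ (h⁻¹ • c) f) := by
  induction c using QuotientGroup.induction_on with
  | H x =>
    rw [eval_translate_mk hf, MulAction.Quotient.smul_mk, eval_translate_mk hf, smul_eq_mul,
      _root_.mul_inv_rev, inv_inv, act_mul]

variable (σ K) [Finite H]

/-- The polynomial whose roots are the translates of `α`. -/
def cosetPoly (α : MvPolynomial κ ℂ) : Polynomial (MvPolynomial κ ℂ) :=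
  letI := Fintype.ofFinite (H ⧸ K)
  ∏ c : H ⧸ K, (Polynomial.X - Polynomial.C (translate σ c α))

open Classical in
/-- Lagrange interpolation of the translates of `f` at the translates of `α`, up to the
denominator `cosetInterp σ K α 1`. -/
def cosetInterp (α f : MvPolynomial κ ℂ) : Polynomial (MvPolynomial κ ℂ) :=
  letI := Fintype.ofFinite (H ⧸ K)
  ∑ c : H ⧸ K, Polynomial.C (translate σ c f) *
    ∏ c' ∈ Finset.univ.erase c, (Polynomial.X - Polynomial.C (translate σ c' α))

variable {σ K}

theorem map_cosetPoly [Fintype (H ⧸ K)] (α : MvPolynomial κ ℂ) (w : κ → ℂ) :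
    (cosetPoly σ K α).map (eval w) =
      ∏ c : H ⧸ K, (Polynomial.X - Polynomial.C (eval w (translate σ c α))) := by
  rw [cosetPoly, Polynomial.map_prod]
  simp only [Polynomial.map_sub, Polynomial.map_X, Polynomial.map_C]
  congr!

theorem map_cosetInterp [Fintype (H ⧸ K)] [DecidableEq (H ⧸ K)] (α f : MvPolynomial κ ℂ)
    (w : κ → ℂ) : (cosetInterp σ K α f).map (eval w) =
      ∑ c : H ⧸ K, Polynomial.C (eval w (translate σ c f)) *
        ∏ c' ∈ Finset.univ.erase c,
          (Polynomial.X - Polynomial.C (eval w (translate σ c' α))) := by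
  rw [cosetInterp, Polynomial.map_sum]
  simp only [Polynomial.map_mul, Polynomial.map_prod, Polynomial.map_sub, Polynomial.map_X,
    Polynomial.map_C]
  congr!

theorem cosetPoly_inv {α : MvPolynomial κ ℂ} (hα : IsInvOn σ K α) (h : H) (w : κ → ℂ) :
    (cosetPoly σ K α).map (eval (act σ h w)) = (cosetPoly σ K α).map (eval w) := by
  let := Fintype.ofFinite (H ⧸ K)
  rw [map_cosetPoly, map_cosetPoly]
  exact Fintype.prod_equiv (MulAction.toPerm h⁻¹) _ _ fun c => by
    rw [eval_act_translate hα, MulAction.toPerm_apply]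

theorem cosetInterp_inv {α f : MvPolynomial κ ℂ} (hα : IsInvOn σ K α) (hf : IsInvOn σ K f)
    (h : H) (w : κ → ℂ) :
    (cosetInterp σ K α f).map (eval (act σ h w)) = (cosetInterp σ K α f).map (eval w) := by
  classical
  let := Fintype.ofFinite (H ⧸ K)
  rw [map_cosetInterp, map_cosetInterp]
  refine Fintype.sum_equiv (MulAction.toPerm h⁻¹) _ _ fun c => ?_
  rw [eval_act_translate hf, MulAction.toPerm_apply]
  congr 1
  refine Finset.prod_equiv (MulAction.toPerm h⁻¹) (fun c' => ?_) fun c' _ => ?_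
  · simp
  · rw [eval_act_translate hα, MulAction.toPerm_apply]

/-- At the node belonging to `c` every other summand contains a zero factor. Dividing by the same
value for `f = 1` recovers the translate of `f` whenever the node is simple. -/
theorem eval_cosetInterp [Fintype (H ⧸ K)] [DecidableEq (H ⧸ K)] (α f : MvPolynomial κ ℂ)
    (w : κ → ℂ) (c : H ⧸ K) :
    ((cosetInterp σ K α f).map (eval w)).eval (eval w (translate σ c α)) =
      eval w (translate σ c f) * ∏ c' ∈ Finset.univ.erase c,
        (eval w (translate σ c α) - eval w (translate σ c' α)) := by
  rw [map_cosetInterp, Polynomial.eval_finsetSum, Finset.sum_eq_single c]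
  · simp [Polynomial.eval_prod]
  · intro b _ hb
    rw [Polynomial.eval_mul, Polynomial.eval_prod, Finset.prod_eq_zero (i := c)]
    · simp
    · simp [hb.symm]
    · simp
  · simp

end Cosets

end QuotientLift
end

/-! ### Analytic continuation of functions invariant under an isotropy group. -/

noncomputable section

namespace QuotientLift

open MvPolynomial Matrix Topology Filter

set_option linter.unusedSectionVars false

variable {ι κ : Type*} [Fintype ι] [DecidableEq ι] [Fintype κ] [DecidableEq κ]
  {G H : Type*} [Group G] [Group H]

theorem analyticAt_eval_map {E : Type*} [NormedAddCommGroup E] [NormedSpace ℂ E]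
    (Q : Polynomial (MvPolynomial ι ℂ)) {γ : E → ι → ℂ} {x : E → ℂ} {s : E}
    (hγ : ∀ i, AnalyticAt ℂ (fun t => γ t i) s) (hx : AnalyticAt ℂ x s) :
    AnalyticAt ℂ (fun t => (Q.map (eval (γ t))).eval (x t)) s := by
  simp only [Polynomial.eval_map, Polynomial.eval₂_eq_sum_range]
  exact Finset.analyticAt_fun_sum _ fun i _ => (analyticAt_eval_comp _ hγ).fun_mul (hx.fun_pow i)

theorem exists_dotProduct_ne_zero (S : Finset (κ → ℂ)) (hS : ∀ x ∈ S, x ≠ 0) :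
    ∃ c : κ → ℂ, ∀ x ∈ S, c ⬝ᵥ x ≠ 0 := by
  have h : ∏ x ∈ S, linForm x ≠ 0 := Finset.prod_ne_zero_iff.2 fun x hx => linForm_ne_zero (hS x hx)
  obtain ⟨c, hc⟩ := exists_eval_ne_zero h
  refine ⟨c, fun x hx => ?_⟩
  have := (prod_eval_ne_zero_iff _ _ _).1 hc x hx
  rwa [eval_linForm, dotProduct_comm] at this

/-- A generic linear form takes at `w` a value different from its values at the other points of the
finite orbit. Subtracting that value and multiplying over the isotropy group makes the function
invariant under that group. -/
theorem exists_isInvOn_stab_separating (σ : H →* Matrix κ κ ℝ) [Finite H] (w : κ → ℂ) :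
    ∃ α, IsInvOn σ (stab σ w) α ∧ eval w α = 0 ∧
      ∀ h, h ∉ stab σ w → eval (act σ h w) α ≠ 0 := by
  classical
  let := Fintype.ofFinite H
  obtain ⟨c, hc⟩ := exists_dotProduct_ne_zero
    ((Finset.univ.filter fun h => h ∉ stab σ w).image fun h => act σ h w - w) (by
      intro x hx
      simp only [Finset.mem_image, Finset.mem_filter, Finset.mem_univ, true_and] at hx
      obtain ⟨h, hh, rfl⟩ := hx
      exact sub_ne_zero.2 hh)
  have hc' : ∀ h, h ∉ stab σ w → c ⬝ᵥ act σ h w ≠ c ⬝ᵥ w := by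
    intro h hh h1
    refine hc (act σ h w - w) (Finset.mem_image.2 ⟨h, by simpa using hh, rfl⟩) ?_
    rw [dotProduct_sub, h1, sub_self]
  let α : MvPolynomial κ ℂ :=
    ∏ k : stab σ w, (pullback (act σ (k : H)) (linForm c) - C (c ⬝ᵥ w))
  have hα : ∀ x, eval x α = ∏ k : stab σ w, (c ⬝ᵥ act σ (k : H) x - c ⬝ᵥ w) := by
    intro x
    simp [α, map_prod]
  refine ⟨α, fun k hk x => ?_, ?_, fun h hh => ?_⟩
  · rw [hα, hα]
    refine Fintype.prod_equiv (Equiv.mulRight ⟨k, hk⟩) _ _ fun j => ?_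
    simp [act_mul]
  · rw [hα]
    exact Finset.prod_eq_zero (Finset.mem_univ 1) (by simp)
  · rw [hα, Finset.prod_ne_zero_iff]
    intro k _
    rw [← act_mul]
    refine sub_ne_zero.2 (hc' _ fun h1 => hh ?_)
    exact ((stab σ w).mul_mem_cancel_left k.2).1 h1

variable {ρ : G →* Matrix ι ι ℝ} {σ : H →* Matrix κ κ ℝ} {R : (ι → ℂ) → (κ → ℂ) → Prop}

/-- Near a point of a line, the functions invariant under the isotropy group of a corresponding
point become holomorphic functions of the parameter. -/
theorem OrbitCorrespondence.exists_local_values (hR : OrbitCorrespondence ρ σ R) [Finite H]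
    {a b : ι → ℂ} {s₀ : ℂ} {w₀ : κ → ℂ} (h₀ : R (a + s₀ • b) w₀) :
    ∃ E : MvPolynomial κ ℂ → ℂ → ℂ,
      (∀ f, IsInvOn σ (stab σ w₀) f → AnalyticAt ℂ (E f) s₀ ∧ E f s₀ = eval w₀ f) ∧
      ∀ᶠ s in 𝓝 s₀, ∃ w, R (a + s • b) w ∧
        ∀ f, IsInvOn σ (stab σ w₀) f → E f s = eval w f := by
  classical
  let := Fintype.ofFinite (H ⧸ stab σ w₀)
  set K := stab σ w₀ with hK
  obtain ⟨α, hα, hα0, hα1⟩ := exists_isInvOn_stab_separating σ w₀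
  obtain ⟨P, hP⟩ := hR.pull_polynomial (P := cosetPoly σ K α) (cosetPoly_inv hα)
  have hQ : ∀ f, ∃ Q : Polynomial (MvPolynomial ι ℂ), IsInvOn σ K f → ∀ v w, R v w →
      Q.map (eval v) = (cosetInterp σ K α f).map (eval w) := by
    intro f
    by_cases hf : IsInvOn σ K f
    · obtain ⟨Q, hQ⟩ := hR.pull_polynomial (cosetInterp_inv hα hf)
      exact ⟨Q, fun _ => hQ⟩
    · exact ⟨0, fun h => absurd h hf⟩
  choose Q hQ using hQ
  have h1 : IsInvOn σ K 1 := fun _ _ _ => by simp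
  have htr1 : ∀ c : H ⧸ K, ∀ w, eval w (translate σ c 1) = 1 := fun c w => by simp [translate]
  have hone : ∀ (f : MvPolynomial κ ℂ) (w : κ → ℂ), IsInvOn σ K f →
      eval w (translate σ ((1 : H) : H ⧸ K) f) = eval w f := fun f w hf => by
    rw [eval_translate_mk hf]; simp
  -- a simple root at the base point
  have hprod : ∏ c' ∈ Finset.univ.erase ((1 : H) : H ⧸ K),
      (0 - eval w₀ (translate σ c' α)) ≠ 0 := by
    rw [Finset.prod_ne_zero_iff]
    intro c hc
    induction c using QuotientGroup.induction_on with
    | H x =>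
      rw [eval_translate_mk hα, zero_sub, neg_ne_zero]
      refine hα1 _ fun hx => Finset.ne_of_mem_erase hc ?_
      exact (QuotientGroup.eq.2 (by simpa using K.inv_mem hx)).symm
  have hQ1 : ((Q 1).map (eval (a + s₀ • b))).eval 0 ≠ 0 := by
    have := eval_cosetInterp (σ := σ) α 1 w₀ ((1 : H) : H ⧸ K)
    rw [hone _ _ hα, hα0, htr1, one_mul] at this
    rw [hQ 1 h1 _ _ h₀, this]
    exact hprod
  have hline : ∀ (s : ℂ) (i : ι), AnalyticAt ℂ (fun t : ℂ => (a + t • b) i) s := by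
    intro s i
    simp only [Pi.add_apply, Pi.smul_apply, smul_eq_mul]
    fun_prop
  have hline2 : ∀ i : ι, AnalyticAt ℂ (fun t : ℂ × ℂ => (a + t.1 • b) i) (s₀, 0) := by
    intro i
    simp only [Pi.add_apply, Pi.smul_apply, smul_eq_mul]
    exact analyticAt_const.fun_add (analyticAt_fst.fun_mul analyticAt_const)
  -- At `s₀` the value `0` of `α` at `w₀` is a simple root of the coset polynomial, since `α` is
  -- nonzero at the other points of the orbit. It therefore continues to an analytic root `x s`.
  obtain ⟨x, hx, hx0, hxs⟩ := exists_analytic_root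
    (g := fun t => (P.map (eval (a + t.1 • b))).eval t.2) (s₀ := s₀) (x₀ := 0)
    (d := ((P.map (eval (a + s₀ • b))).derivative).eval 0)
    (analyticAt_eval_map P hline2 analyticAt_snd) (by
      simp only [hP _ _ h₀, map_cosetPoly, Polynomial.eval_prod]
      refine Finset.prod_eq_zero (Finset.mem_univ ((1 : H) : H ⧸ K)) ?_
      rw [hone _ _ hα, hα0]; simp)
    (by exact (P.map (eval (a + s₀ • b))).hasDerivAt 0) (by
      rw [hP _ _ h₀, map_cosetPoly, Polynomial.derivative_prod_finset, Polynomial.eval_finsetSum,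
        Finset.sum_eq_single ((1 : H) : H ⧸ K)]
      · simpa [Polynomial.eval_prod] using hprod
      · intro c _ hc
        rw [Polynomial.eval_mul, Polynomial.eval_prod,
          Finset.prod_eq_zero (i := ((1 : H) : H ⧸ K)), zero_mul]
        · simp [hc.symm]
        · rw [hone _ _ hα, hα0]; simp
      · simp)
  have hden : AnalyticAt ℂ (fun t => ((Q 1).map (eval (a + t • b))).eval (x t)) s₀ :=
    analyticAt_eval_map _ (hline s₀) hx
  have hden0 : ((Q 1).map (eval (a + s₀ • b))).eval (x s₀) ≠ 0 := by rwa [hx0]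
  -- A root of the coset polynomial is the value of some translate of `α` at a related point. Moving
  -- that point by the group makes the root the value of `α` itself, and interpolation then gives
  -- every `f` at the moved point.
  have hkey : ∀ s, (P.map (eval (a + s • b))).eval (x s) = 0 →
      ((Q 1).map (eval (a + s • b))).eval (x s) ≠ 0 →
      ∃ w, R (a + s • b) w ∧ eval w α = x s ∧ ∀ f, IsInvOn σ K f →
      ((Q f).map (eval (a + s • b))).eval (x s) / ((Q 1).map (eval (a + s • b))).eval (x s)
        = eval w f := by
    intro s hs hd
    obtain ⟨w, hw⟩ := hR.exists_right (a + s • b)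
    rw [hP _ _ hw, map_cosetPoly, Polynomial.eval_prod, Finset.prod_eq_zero_iff] at hs
    obtain ⟨c, -, hc⟩ := hs
    simp only [Polynomial.eval_sub, Polynomial.eval_X, Polynomial.eval_C, sub_eq_zero] at hc
    rw [hQ 1 h1 _ _ hw, hc, eval_cosetInterp, htr1, one_mul] at hd
    induction c using QuotientGroup.induction_on with
    | H y =>
      refine ⟨act σ y⁻¹ w, hR.act_right hw _, by rw [hc, eval_translate_mk hα], fun f hf => ?_⟩
      rw [hQ 1 h1 _ _ hw, hQ f hf _ _ hw, hc, eval_cosetInterp, eval_cosetInterp, htr1, one_mul,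
        mul_div_assoc, div_self hd, mul_one, eval_translate_mk hf]
  refine ⟨fun f s => ((Q f).map (eval (a + s • b))).eval (x s) /
    ((Q 1).map (eval (a + s • b))).eval (x s), fun f hf => ⟨?_, ?_⟩, ?_⟩
  · exact (analyticAt_eval_map _ (hline s₀) hx).fun_div hden hden0
  · have h2 := eval_cosetInterp (σ := σ) α f w₀ ((1 : H) : H ⧸ K)
    have h3 := eval_cosetInterp (σ := σ) α 1 w₀ ((1 : H) : H ⧸ K)
    rw [hone _ _ hα, hα0, htr1, one_mul] at h3
    rw [hone _ _ hα, hα0, hone _ _ hf] at h2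
    simp only [hx0]
    rw [hQ 1 h1 _ _ h₀, hQ f hf _ _ h₀, h2, h3, mul_div_assoc, div_self hprod, mul_one]
  · filter_upwards [hxs, hden.continuousAt.eventually_ne hden0] with s hs hd
    obtain ⟨w, hw, -, hf⟩ := hkey s hs hd
    exact ⟨w, hw, hf⟩

end QuotientLift
end

noncomputable section

namespace QuotientLift

open MvPolynomial Matrix Topology Filter

set_option linter.unusedSectionVars false

/-! ### Divisibility by linear forms. -/

section LinearForms

variable {ι : Type*} [Fintype ι] [DecidableEq ι]

/-- The projection onto the kernel of the linear form `c` along `e`. -/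
def projKer (c e : ι → ℂ) : (ι → ℂ) →ₗ[ℂ] (ι → ℂ) :=
  LinearMap.id - (dotProductBilin ℂ ℂ c).smulRight e

theorem projKer_apply (c e v : ι → ℂ) : projKer c e v = v - (c ⬝ᵥ v) • e := rfl

/-- Each coordinate changes under `projKer c e` by a multiple of the form `c`, and this property
passes to sums and products. -/
theorem linForm_dvd_sub_pullback (c e : ι → ℂ) (f : MvPolynomial ι ℂ) :
    linForm c ∣ f - pullback (projKer c e) f := by
  induction f using MvPolynomial.induction_on with
  | C a => simp [pullback]
  | add p q hp hq =>
    rw [map_add, add_sub_add_comm]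
    exact dvd_add hp hq
  | mul_X p k hp =>
    have h1 : X k - pullback (projKer c e) (X k) = C (e k) * linForm c :=
      MvPolynomial.funext fun v => by simp [projKer_apply, mul_comm]
    have h2 : p * X k - pullback (projKer c e) (p * X k) =
        (p - pullback (projKer c e) p) * X k +
          pullback (projKer c e) p * (C (e k) * linForm c) := by
      rw [← h1, map_mul]; ring
    rw [h2]
    exact dvd_add (hp.mul_right _) ((dvd_mul_left _ _).mul_left _)

theorem exists_dotProduct_eq_one {c : ι → ℂ} (hc : c ≠ 0) : ∃ e, c ⬝ᵥ e = 1 := by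
  obtain ⟨i, hi⟩ := Function.ne_iff.1 hc
  exact ⟨Pi.single i (c i)⁻¹, by simpa using mul_inv_cancel₀ hi⟩

theorem linForm_dvd_iff {c : ι → ℂ} (hc : c ≠ 0) {f : MvPolynomial ι ℂ} :
    linForm c ∣ f ↔ ∀ v, c ⬝ᵥ v = 0 → eval v f = 0 := by
  constructor
  · rintro ⟨q, rfl⟩ v hv
    simp [hv]
  · intro h
    obtain ⟨e, he⟩ := exists_dotProduct_eq_one hc
    have h0 : pullback (projKer c e) f = 0 := MvPolynomial.funext fun v => by
      rw [eval_pullback, h, map_zero]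
      rw [projKer_apply, dotProduct_sub, dotProduct_smul, he, smul_eq_mul, mul_one, sub_self]
    simpa [h0] using linForm_dvd_sub_pullback c e f

/-- With `c ⬝ᵥ e = 1`, pulling back along the projection to the hyperplane is a ring homomorphism
into a domain whose kernel consists of the multiples of the form. -/
theorem prime_linForm {c : ι → ℂ} (hc : c ≠ 0) : Prime (linForm c) := by
  refine ⟨linForm_ne_zero hc, fun h => ?_, fun f g h => ?_⟩
  · exact (isUnit_iff_ne_zero.1 (h.map (eval (0 : ι → ℂ)))) (by rw [eval_linForm, dotProduct_zero])
  · obtain ⟨e, he⟩ := exists_dotProduct_eq_one hc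
    have hker : ∀ v, c ⬝ᵥ projKer c e v = 0 := fun v => by
      rw [projKer_apply, dotProduct_sub, dotProduct_smul, he, smul_eq_mul, mul_one, sub_self]
    have h0 : pullback (projKer c e) f * pullback (projKer c e) g = 0 := by
      refine MvPolynomial.funext fun v => ?_
      rw [← map_mul, eval_pullback, map_zero]
      exact (linForm_dvd_iff hc).1 h _ (hker v)
    refine (mul_eq_zero.1 h0).imp (fun h1 => ?_) fun h1 => ?_
    · simpa [h1] using linForm_dvd_sub_pullback c e f
    · simpa [h1] using linForm_dvd_sub_pullback c e g

theorem Indep.isRelPrime {c c' : ι → ℂ} (h : Indep c c') :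
    IsRelPrime (linForm c) (linForm c') := by
  rw [(prime_linForm h.ne_zero_left).irreducible.isRelPrime_iff_not_dvd,
    linForm_dvd_iff h.ne_zero_left]
  intro h1
  obtain ⟨i, j, hij⟩ := h
  apply hij
  -- This vector lies in the kernel of `c`, and its value under `c'` is the minor witnessing
  -- independence, up to sign.
  have := h1 (c i • Pi.single j 1 - c j • Pi.single i 1) (by simp [dotProduct_sub, mul_comm])
  simp only [eval_linForm, dotProduct_sub, dotProduct_smul, dotProduct_single, mul_one,
    smul_eq_mul, sub_eq_zero] at this
  exact this

end LinearForms

/-! ### The discriminant of the reflections and its divisibility property. -/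

section Discriminant

variable {ι : Type*} [Fintype ι] [DecidableEq ι] {G : Type*} [Group G] [Finite G]
  (ρ : G →* Matrix ι ι ℝ)

/-- An invariant quadratic form which is positive on real vectors. -/
def quadForm : MvPolynomial ι ℂ :=
  letI := Fintype.ofFinite G
  ∑ g, ∑ i, pullback (act ρ g) (X i) ^ 2

theorem eval_quadForm [Fintype G] (v : ι → ℂ) :
    eval v (quadForm ρ) = ∑ g, ∑ i, act ρ g v i ^ 2 := by
  simp only [quadForm, map_sum, map_pow, eval_pullback, eval_X]
  congr!

theorem isInv_quadForm : IsInv ρ (quadForm ρ) := by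
  let := Fintype.ofFinite G
  intro g v
  rw [eval_quadForm, eval_quadForm]
  simp only [← act_mul]
  exact Fintype.sum_equiv (Equiv.mulRight g) _ _ fun _ => rfl

/-- On real vectors the form is a sum of real squares, and the terms with `g = 1` already make it
positive. -/
theorem eval_quadForm_toC_ne_zero {e : ι → ℝ} (he : e ≠ 0) :
    eval (toC e) (quadForm ρ) ≠ 0 := by
  let := Fintype.ofFinite G
  have h1 : ∀ g i, act ρ g (toC e) i = ((ρ g *ᵥ e) i : ℂ) := by
    intro g i
    simp [act, mulVec, dotProduct, toC]
  rw [eval_quadForm]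
  simp only [h1]
  norm_cast
  obtain ⟨i, hi⟩ := Function.ne_iff.1 he
  refine (Finset.sum_pos' (fun g _ => Finset.sum_nonneg fun i _ => sq_nonneg _)
    ⟨1, Finset.mem_univ _, ?_⟩).ne'
  refine Finset.sum_pos' (fun i _ => sq_nonneg _) ⟨i, Finset.mem_univ _, ?_⟩
  rw [map_one, one_mulVec]
  exact sq_pos_of_ne_zero hi

/-- The value of the invariant quadratic form at `v - g v`. -/
def displacement (g : G) : MvPolynomial ι ℂ :=
  pullback (LinearMap.id - act ρ g) (quadForm ρ)

theorem eval_displacement (g : G) (v : ι → ℂ) :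
    eval v (displacement ρ g) = eval (v - act ρ g v) (quadForm ρ) := by
  rw [displacement, eval_pullback]; rfl

theorem eval_act_displacement (g h : G) (v : ι → ℂ) :
    eval (act ρ h v) (displacement ρ g) = eval v (displacement ρ (h⁻¹ * g * h)) := by
  have h1 : act ρ h v - act ρ g (act ρ h v) = act ρ h (v - act ρ (h⁻¹ * g * h) v) := by
    rw [map_sub, ← act_mul, ← act_mul]
    simp only [mul_assoc, mul_inv_cancel_left]
  rw [eval_displacement, eval_displacement, h1, isInv_quadForm]

/-- A reflection moves `v` by `(l ⬝ᵥ v) e`, so the quadratic form of the displacement is `(l ⬝ᵥ v)²`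
times its value at `e`, which is nonzero because `e` is real. This gives a choice of squared linear
forms compatible with conjugation. -/
theorem displacement_eq {ρ : G →* Matrix ι ι ℝ} {g : G} {l e : ι → ℝ} (h : IsRefl (ρ g) l e) :
    ∃ c : ℂ, c ≠ 0 ∧ displacement ρ g = C c * linForm (toC l) ^ 2 := by
  let := Fintype.ofFinite G
  refine ⟨_, eval_quadForm_toC_ne_zero ρ h.ne_zero_right, MvPolynomial.funext fun v => ?_⟩
  rw [eval_displacement, act_eq_sub_smul h, sub_sub_cancel, eval_quadForm, map_mul, eval_C,
    eval_quadForm, map_pow, eval_linForm, Finset.sum_mul]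
  refine Finset.sum_congr rfl fun g _ => ?_
  rw [Finset.sum_mul]
  refine Finset.sum_congr rfl fun i _ => ?_
  rw [map_smul, Pi.smul_apply, smul_eq_mul]
  ring

open Classical in
/-- The set of reflections of the group. -/
def reflections : Finset G :=
  letI := Fintype.ofFinite G
  Finset.univ.filter fun g => ∃ l e, IsRefl (ρ g) l e

@[simp]
theorem mem_reflections {g : G} : g ∈ reflections ρ ↔ ∃ l e, IsRefl (ρ g) l e := by
  simp [reflections]

theorem IsRefl.conj {A B M : Matrix ι ι ℝ} {l e : ι → ℝ} (h : IsRefl M l e) (hAB : A * B = 1) :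
    IsRefl (A * M * B) (l ᵥ* B) (A *ᵥ e) := by
  constructor
  · rw [h.1, mul_sub, sub_mul, mul_one, hAB, mul_vecMulVec, vecMulVec_mul]
  · rw [dotProduct_mulVec, vecMul_vecMul, mul_eq_one_comm.1 hAB, vecMul_one, h.2]

theorem conj_mem_reflections {g : G} (hg : g ∈ reflections ρ) (h : G) :
    h * g * h⁻¹ ∈ reflections ρ := by
  rw [mem_reflections] at hg ⊢
  obtain ⟨l, e, hle⟩ := hg
  rw [map_mul, map_mul]
  exact ⟨_, _, hle.conj (by rw [← map_mul, mul_inv_cancel, map_one])⟩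

theorem conj_mem_reflections_iff {g h : G} :
    h⁻¹ * g * h ∈ reflections ρ ↔ g ∈ reflections ρ := by
  constructor
  · intro h1
    have := conj_mem_reflections ρ h1 h
    simpa [mul_assoc] using this
  · intro h1
    have := conj_mem_reflections ρ h1 h⁻¹
    simpa using this

/-- The discriminant: an invariant vanishing to second order on the reflection hyperplanes. -/
def disc : MvPolynomial ι ℂ := ∏ g ∈ reflections ρ, displacement ρ g

theorem isInv_disc : IsInv ρ (disc ρ) := by
  intro h v
  rw [disc, map_prod, map_prod]
  refine Finset.prod_equiv (MulAut.conj h⁻¹).toEquiv (fun g => ?_) fun g _ => ?_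
  · simpa using (conj_mem_reflections_iff ρ (g := g) (h := h)).symm
  · rw [eval_act_displacement]
    simp

theorem eval_disc_eq_zero_iff {v : ι → ℂ} : eval v (disc ρ) = 0 ↔ OnHyperplane ρ v := by
  rw [disc, map_prod, Finset.prod_eq_zero_iff]
  constructor
  · rintro ⟨g, hg, h⟩
    obtain ⟨l, e, hle⟩ := (mem_reflections ρ).1 hg
    obtain ⟨c, hc, h1⟩ := displacement_eq hle
    refine ⟨g, l, e, hle, ?_⟩
    rw [h1] at h
    simpa [hc] using h
  · rintro ⟨g, l, e, hle, h⟩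
    obtain ⟨c, hc, h1⟩ := displacement_eq hle
    exact ⟨g, (mem_reflections ρ).2 ⟨l, e, hle⟩, by simp [h1, h]⟩

theorem disc_ne_zero : disc ρ ≠ 0 := by
  rw [disc, Finset.prod_ne_zero_iff]
  intro g hg
  obtain ⟨l, e, hle⟩ := (mem_reflections ρ).1 hg
  obtain ⟨c, hc, h1⟩ := displacement_eq hle
  rw [h1]
  exact mul_ne_zero (by simpa using hc) (pow_ne_zero _ (linForm_ne_zero (toC_ne_zero hle.ne_zero_left)))

variable {ρ}

theorem dotProduct_act_of_isRefl {g : G} {l e : ι → ℝ} (h : IsRefl (ρ g) l e) (v : ι → ℂ) :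
    toC l ⬝ᵥ act ρ g v = -(toC l ⬝ᵥ v) := by
  have h2 : toC l ⬝ᵥ toC e = 2 := by
    have := congrArg (algebraMap ℝ ℂ) h.2
    simpa [dotProduct, toC] using this
  rw [act_eq_sub_smul h, dotProduct_sub, dotProduct_smul, h2, smul_eq_mul]
  ring

/-- An invariant vanishing on a reflection hyperplane vanishes there to second order: after removing
one factor `l`, which `g` negates, the quotient is anti-invariant under `g` and so vanishes on the
hyperplane fixed by `g`. -/
theorem displacement_dvd {f : MvPolynomial ι ℂ} (hf : IsInv ρ f) {g : G} {l e : ι → ℝ}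
    (h : IsRefl (ρ g) l e) (h0 : ∀ v, toC l ⬝ᵥ v = 0 → eval v f = 0) :
    displacement ρ g ∣ f := by
  have hl := toC_ne_zero h.ne_zero_left
  obtain ⟨c, hc, h1⟩ := displacement_eq h
  obtain ⟨q, rfl⟩ := (linForm_dvd_iff hl).2 h0
  have hq : pullback (act ρ g) q = -q := by
    refine eq_of_eval_eq_of_ne_zero (linForm_ne_zero hl) fun v hv => ?_
    have h2 := hf g v
    rw [map_mul, map_mul, eval_linForm, eval_linForm, dotProduct_act_of_isRefl h] at h2
    rw [eval_linForm] at hv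
    rw [eval_pullback, map_neg]
    apply mul_left_cancel₀ hv
    linear_combination -h2
  have hdq : linForm (toC l) ∣ q := by
    refine (linForm_dvd_iff hl).2 fun v hv => ?_
    have h2 := congrArg (eval v) hq
    rw [eval_pullback, (act_eq_self_iff_of_isRefl h v).2 hv, map_neg] at h2
    exact self_eq_neg.1 h2
  obtain ⟨q', rfl⟩ := hdq
  refine ⟨C c⁻¹ * q', ?_⟩
  have : (C c * C c⁻¹ : MvPolynomial ι ℂ) = 1 := by rw [← C_mul, mul_inv_cancel₀ hc, C_1]
  rw [h1]
  linear_combination (-(linForm (toC l) ^ 2 * q')) * this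

theorem indep_of_ne (hρ : Function.Injective ρ) {g g' : G} (hne : g ≠ g') {l e l' e' : ι → ℝ}
    (h : IsRefl (ρ g) l e) (h' : IsRefl (ρ g') l' e') : Indep (toC l) (toC l') := by
  by_contra hi
  obtain ⟨k, hk, hpow⟩ := exists_pow_card_eq_one ρ
  exact hne (hρ (h.eq_of_not_indep h' hi hk (by rw [← map_mul]; exact hpow _)))

/-- Distinct reflections of a faithful finite group have non-proportional forms, so the factors of
the discriminant are coprime and can be divided out separately. -/
theorem disc_dvd (hρ : Function.Injective ρ) {f : MvPolynomial ι ℂ} (hf : IsInv ρ f)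
    (h0 : ∀ v, OnHyperplane ρ v → eval v f = 0) : disc ρ ∣ f := by
  refine Finset.prod_dvd_of_isRelPrime (fun g hg g' hg' hne => ?_) fun g hg => ?_
  · obtain ⟨l, e, h⟩ := (mem_reflections ρ).1 hg
    obtain ⟨l', e', h'⟩ := (mem_reflections ρ).1 hg'
    obtain ⟨c, hc, h1⟩ := displacement_eq h
    obtain ⟨c', hc', h1'⟩ := displacement_eq h'
    have hu : ∀ {c : ℂ}, c ≠ 0 → IsUnit (C c : MvPolynomial ι ℂ) := fun hc =>
      (isUnit_iff_ne_zero.2 hc).map C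
    change IsRelPrime (displacement ρ g) (displacement ρ g')
    rw [h1, h1']
    exact ((hu hc).isRelPrime_left).mul_left
      (((hu hc').isRelPrime_right).mul_right (indep_of_ne hρ hne h h').isRelPrime.pow)
  · obtain ⟨l, e, h⟩ := (mem_reflections ρ).1 hg
    exact displacement_dvd hf h fun v hv => h0 v ⟨g, l, e, h, hv⟩

end Discriminant

variable {ι κ : Type*} [Fintype ι] [DecidableEq ι] [Fintype κ] [DecidableEq κ]
  {G H : Type*} [Group G] [Group H] [Finite G] [Finite H]
  {ρ : G →* Matrix ι ι ℝ} {σ : H →* Matrix κ κ ℝ} {R : (ι → ℂ) → (κ → ℂ) → Prop}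

/-- The discriminants correspond to each other up to a nowhere vanishing factor. -/
theorem OrbitCorrespondence.exists_disc_eq (hR : OrbitCorrespondence ρ σ R) :
    ∃ k : MvPolynomial ι ℂ, (∀ v, eval v k ≠ 0) ∧
      ∀ v w, R v w → eval w (disc σ) = eval v k * eval v (disc ρ) := by
  obtain ⟨a, ha⟩ := hR.pull (isInv_disc σ)
  obtain ⟨b, hb⟩ := hR.push (isInv_disc ρ)
  have hda : disc ρ ∣ a := by
    refine disc_dvd hR.injective_left (hR.isInv_pull ha) fun v hv => ?_
    obtain ⟨w, hw⟩ := hR.exists_right v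
    rw [ha _ _ hw]
    exact (eval_disc_eq_zero_iff σ).2 ((hR.onHyperplane_iff hw).1 hv)
  have hib : IsInv σ b := hR.symm.isInv_pull fun w v => hb v w
  have hdb : disc σ ∣ b := by
    refine disc_dvd hR.injective_right hib fun w hw => ?_
    obtain ⟨v, hv⟩ := hR.exists_left w
    rw [hb _ _ hv]
    exact (eval_disc_eq_zero_iff ρ).2 ((hR.onHyperplane_iff hv).2 hw)
  obtain ⟨k, hk⟩ := hda
  obtain ⟨k', hk'⟩ := hdb
  have hik' : IsInv σ k' := IsInv.of_mul (hk' ▸ hib) (isInv_disc σ) (disc_ne_zero σ)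
  obtain ⟨k'', hk''⟩ := hR.pull hik'
  have h1 : ∀ v w, R v w → eval w (disc σ) = eval v k * eval v (disc ρ) := fun v w h => by
    rw [← ha _ _ h, hk, map_mul, mul_comm]
  -- Each discriminant transported to the other side is a multiple of the discriminant there;
  -- comparing the two cofactors where `disc ρ` does not vanish shows that they are inverse to each
  -- other.
  have h2 : k * k'' = 1 := by
    refine eq_of_eval_eq_of_ne_zero (disc_ne_zero ρ) fun v hv => ?_
    obtain ⟨w, hw⟩ := hR.exists_right v
    have h3 := hb _ _ hw
    rw [hk', map_mul, h1 _ _ hw, ← hk'' _ _ hw] at h3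
    rw [map_mul, map_one]
    apply mul_left_cancel₀ hv
    linear_combination h3
  refine ⟨k, fun v hv => ?_, h1⟩
  have := congrArg (eval v) h2
  rw [map_mul, hv, zero_mul, map_one] at this
  exact zero_ne_one this

end QuotientLift
end

/-! ### Local holomorphic lifts at points with trivial or reflection isotropy. -/

noncomputable section

namespace QuotientLift

open MvPolynomial Matrix Topology Filter

set_option linter.unusedSectionVars false

/-- Normalising by `U s₀` moves the base value to `1`, inside the domain where the principal branch
is holomorphic. The squaring identity needs no branch condition. -/
theorem exists_analytic_sqrt {U : ℂ → ℂ} {s₀ : ℂ} (hU : AnalyticAt ℂ U s₀) (h0 : U s₀ ≠ 0) :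
    ∃ θ : ℂ → ℂ, AnalyticAt ℂ θ s₀ ∧ ∀ s, θ s ^ 2 = U s := by
  refine ⟨fun s => (U s₀) ^ ((2 : ℕ) : ℂ)⁻¹ * (U s / U s₀) ^ ((2 : ℕ) : ℂ)⁻¹, ?_, fun s => ?_⟩
  · refine analyticAt_const.fun_mul
      ((hU.fun_div analyticAt_const h0).cpow analyticAt_const ?_)
    rw [div_self h0]
    exact Complex.one_mem_slitPlane
  · rw [mul_pow, Complex.cpow_nat_inv_pow _ two_ne_zero, Complex.cpow_nat_inv_pow _ two_ne_zero]
    field_simp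

variable {ι κ : Type*} [Fintype ι] [DecidableEq ι] [Fintype κ] [DecidableEq κ]
  {G H : Type*} [Group G] [Group H] [Finite G] [Finite H]
  {ρ : G →* Matrix ι ι ℝ} {σ : H →* Matrix κ κ ℝ} {R : (ι → ℂ) → (κ → ℂ) → Prop}

/-- `ω` is a holomorphic lift near `s₀` of the parametrized line `s ↦ a + s b`. -/
structure IsLocalLift (R : (ι → ℂ) → (κ → ℂ) → Prop) (a b : ι → ℂ) (ω : ℂ → κ → ℂ) (s₀ : ℂ) :
    Prop where
  analyticAt : ∀ i, AnalyticAt ℂ (fun s => ω s i) s₀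
  eventually : ∀ᶠ s in 𝓝 s₀, R (a + s • b) (ω s)

namespace OrbitCorrespondence

/-- With trivial isotropy the coordinate functions themselves may be continued analytically, and
their values form the lift. -/
theorem exists_localLift_of_stab_eq_bot (hR : OrbitCorrespondence ρ σ R) {a b : ι → ℂ} {s₀ : ℂ}
    {w₀ : κ → ℂ} (h₀ : R (a + s₀ • b) w₀) (hst : ∀ h, act σ h w₀ = w₀ → h = 1) :
    ∃ ω, IsLocalLift R a b ω s₀ ∧ ω s₀ = w₀ := by
  obtain ⟨E, hE, hev⟩ := hR.exists_local_values h₀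
  have hinv : ∀ f, IsInvOn σ (stab σ w₀) f := by
    intro f k hk w
    rw [hst k hk, act_one]
  refine ⟨fun s i => E (X i) s, ⟨fun i => (hE _ (hinv _)).1, ?_⟩, ?_⟩
  · filter_upwards [hev] with s hs
    obtain ⟨w, hw, h⟩ := hs
    convert hw with i
    simpa using h (X i) (hinv _)
  · ext i
    simpa using (hE (X i) (hinv _)).2

/-- The functions invariant under `r` determine a point up to the sign of `l`. Comparison of the
discriminants expresses `l²` as `(s - s₀)²` times a unit, because the line crosses just one
reflection hyperplane at `s₀`, and transversally. A holomorphic square root of the unit supplies the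
missing coordinate. -/
theorem exists_localLift_of_isRefl (hR : OrbitCorrespondence ρ σ R) {a b : ι → ℂ} {s₀ : ℂ}
    {w₀ : κ → ℂ} (h₀ : R (a + s₀ • b) w₀) {r : H} {l e : κ → ℝ} (hr : IsRefl (σ r) l e)
    (hrw : act σ r w₀ = w₀) (hst : ∀ h, act σ h w₀ = w₀ → h = 1 ∨ h = r)
    {g : G} {m d : ι → ℝ} (hg : IsRefl (ρ g) m d) (hma : toC m ⬝ᵥ (a + s₀ • b) = 0)
    (hmb : toC m ⬝ᵥ b ≠ 0)
    (honly : ∀ g' m' d', IsRefl (ρ g') m' d' → toC m' ⬝ᵥ (a + s₀ • b) = 0 → g' = g) :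
    ∃ ω, IsLocalLift R a b ω s₀ ∧ ω s₀ = w₀ := by
  classical
  obtain ⟨k, hk0, hk⟩ := hR.exists_disc_eq
  obtain ⟨E, hE, hev⟩ := hR.exists_local_values h₀
  have hlw : toC l ⬝ᵥ w₀ = 0 := (act_eq_self_iff_of_isRefl hr w₀).1 hrw
  have hinv : ∀ f, (∀ w, eval (act σ r w) f = eval w f) → IsInvOn σ (stab σ w₀) f := by
    intro f hf h hh w
    rcases hst h hh with rfl | rfl
    · rw [act_one]
    · exact hf w
  -- the discriminant downstairs
  obtain ⟨cg, hcg, hdg⟩ := displacement_eq hg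
  set N : MvPolynomial ι ℂ := ∏ g' ∈ (reflections ρ).erase g, displacement ρ g' with hN
  have hdiscρ : disc ρ = displacement ρ g * N :=
    (Finset.mul_prod_erase _ _ ((mem_reflections ρ).2 ⟨m, d, hg⟩)).symm
  have hN0 : eval (a + s₀ • b) N ≠ 0 := by
    rw [hN, map_prod, Finset.prod_ne_zero_iff]
    intro g' hg'
    obtain ⟨m', d', h'⟩ := (mem_reflections ρ).1 (Finset.mem_of_mem_erase hg')
    obtain ⟨c', hc', hd'⟩ := displacement_eq h'
    rw [hd', map_mul, eval_C, map_pow, eval_linForm]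
    exact mul_ne_zero hc' (pow_ne_zero _ fun h =>
      Finset.ne_of_mem_erase hg' (honly g' m' d' h' h))
  -- the discriminant upstairs
  obtain ⟨cr, hcr, hdr⟩ := displacement_eq hr
  set M : MvPolynomial κ ℂ := ∏ h ∈ (reflections σ).erase r, displacement σ h with hM
  have hdiscσ : disc σ = displacement σ r * M :=
    (Finset.mul_prod_erase _ _ ((mem_reflections σ).2 ⟨l, e, hr⟩)).symm
  have hM0 : eval w₀ M ≠ 0 := by
    rw [hM, map_prod, Finset.prod_ne_zero_iff]
    intro h hh
    obtain ⟨l', e', h'⟩ := (mem_reflections σ).1 (Finset.mem_of_mem_erase hh)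
    obtain ⟨c', hc', hd'⟩ := displacement_eq h'
    rw [hd', map_mul, eval_C, map_pow, eval_linForm]
    refine mul_ne_zero hc' (pow_ne_zero _ fun h1 => ?_)
    rcases hst h ((act_eq_self_iff_of_isRefl h' w₀).2 h1) with rfl | rfl
    · exact h'.ne_one (map_one σ)
    · exact Finset.ne_of_mem_erase hh rfl
  set L : MvPolynomial κ ℂ := linForm (toC l) with hL
  have hLinv : IsInvOn σ (stab σ w₀) (L ^ 2) := hinv _ fun w => by
    rw [map_pow, map_pow, hL, eval_linForm, eval_linForm, dotProduct_act_of_isRefl hr, neg_sq]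
  have hMinv : IsInvOn σ (stab σ w₀) M := hinv _ fun w => by
    have : pullback (act σ r) M = M := by
      refine eq_of_eval_eq_of_ne_zero (d := displacement σ r) ?_ fun w hw => ?_
      · rw [hdr]
        exact mul_ne_zero (by simpa using hcr)
          (pow_ne_zero _ (linForm_ne_zero (toC_ne_zero hr.ne_zero_left)))
      · have h1 := isInv_disc σ r w
        have h2 : eval (act σ r w) (displacement σ r) = eval w (displacement σ r) := by
          rw [eval_act_displacement, inv_mul_cancel, one_mul]
        rw [hdiscσ, map_mul, map_mul, h2] at h1
        rw [eval_pullback]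
        exact mul_left_cancel₀ hw h1
    rw [← eval_pullback, this]
  have hline : ∀ (s : ℂ) (i : ι), AnalyticAt ℂ (fun t : ℂ => (a + t • b) i) s := by
    intro s i
    simp only [Pi.add_apply, Pi.smul_apply, smul_eq_mul]
    fun_prop
  -- Solving the discriminant identity for `l²` and removing the factor `(s - s₀)²` leaves `U`, a
  -- quotient of functions that are nonzero at `s₀`.
  let U : ℂ → ℂ := fun s => eval (a + s • b) k * (cg * (toC m ⬝ᵥ b) ^ 2 * eval (a + s • b) N) /
    (cr * E M s)
  have hEM0 : cr * E M s₀ ≠ 0 := mul_ne_zero hcr (by rw [(hE M hMinv).2]; exact hM0)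
  have hEM : AnalyticAt ℂ (fun s => cr * E M s) s₀ := analyticAt_const.fun_mul (hE M hMinv).1
  have hU : AnalyticAt ℂ U s₀ :=
    ((analyticAt_eval_comp _ (hline s₀)).fun_mul (analyticAt_const.fun_mul
      (analyticAt_eval_comp _ (hline s₀)))).fun_div hEM hEM0
  have hU0 : U s₀ ≠ 0 := div_ne_zero (mul_ne_zero (hk0 _)
    (mul_ne_zero (mul_ne_zero hcg (pow_ne_zero _ hmb)) hN0)) hEM0
  obtain ⟨θ, hθ, hθ2⟩ := exists_analytic_sqrt hU hU0
  -- These are the coordinates of the midpoint of `w` and `r w`, hence invariant under `r`.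
  let Y : κ → MvPolynomial κ ℂ := fun i => X i - C (toC e i / 2) * L
  have hYinv : ∀ i, IsInvOn σ (stab σ w₀) (Y i) := fun i => hinv _ fun w => by
    simp only [Y, map_sub, map_mul, eval_X, eval_C, hL, eval_linForm, dotProduct_act_of_isRefl hr]
    rw [act_eq_sub_smul hr, Pi.sub_apply, Pi.smul_apply, smul_eq_mul]
    ring
  refine ⟨fun s i => E (Y i) s + (s - s₀) * θ s * (toC e i / 2), ⟨fun i => ?_, ?_⟩, ?_⟩
  · have := (hE _ (hYinv i)).1
    fun_prop
  · filter_upwards [hev, hEM.continuousAt.eventually_ne hEM0] with s hs hs0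
    obtain ⟨w, hw, hEw⟩ := hs
    have hy : ((s - s₀) * θ s) ^ 2 = (toC l ⬝ᵥ w) ^ 2 := by
      have h1 := hk _ _ hw
      have h2 : toC m ⬝ᵥ (a + s • b) = (s - s₀) * (toC m ⬝ᵥ b) := by
        rw [dotProduct_add, dotProduct_smul, smul_eq_mul] at hma ⊢
        linear_combination hma
      have h3 : eval w L = toC l ⬝ᵥ w := by rw [hL, eval_linForm]
      rw [hdiscσ, hdiscρ, hdr, hdg] at h1
      simp only [map_mul, map_pow, eval_C, eval_linForm, h2, h3, ← hEw M hMinv] at h1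
      rw [mul_pow, hθ2]
      simp only [U]
      rw [mul_div_assoc', div_eq_iff hs0]
      linear_combination -h1
    have hYw : ∀ i, E (Y i) s = w i - toC e i / 2 * (toC l ⬝ᵥ w) := fun i => by
      rw [hEw _ (hYinv i)]
      simp [Y, hL]
    -- The root agrees with `l` at `w` or at its mirror image `r w`, and both are related to the
    -- same point.
    rcases sq_eq_sq_iff_eq_or_eq_neg.1 hy with h | h
    · convert hw with i
      rw [hYw, h]; ring
    · convert hR.act_right hw r with i
      rw [hYw, h, act_eq_sub_smul hr, Pi.sub_apply, Pi.smul_apply, smul_eq_mul]; ring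
  · ext i
    change E (Y i) s₀ + (s₀ - s₀) * θ s₀ * (toC e i / 2) = w₀ i
    rw [(hE _ (hYinv i)).2]
    simp [Y, hL, hlw]

end OrbitCorrespondence

end QuotientLift
end

/-! ### Coprime polynomials and lines avoiding codimension two. -/

noncomputable section

namespace QuotientLift

open MvPolynomial Matrix Topology Filter

set_option linter.unusedSectionVars false

open scoped nonZeroDivisors in
/-- Gauss's lemma: relatively prime polynomials over a unique factorization domain satisfy a
Bézout identity up to a nonzero constant. -/
theorem exists_bezout_of_isRelPrime {A : Type*} [CommRing A] [IsDomain A]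
    [UniqueFactorizationMonoid A] {a b : Polynomial A} (ha : a ≠ 0) (h : IsRelPrime a b) :
    ∃ (c : A) (x y : Polynomial A), c ≠ 0 ∧ x * a + y * b = Polynomial.C c := by
  classical
  let : NormalizedGCDMonoid A := Nonempty.some inferInstance
  let K := FractionRing A
  have hinj : Function.Injective (Polynomial.map (algebraMap A K)) :=
    Polynomial.map_injective _ (IsFractionRing.injective A K)
  have hcop : IsCoprime (a.map (algebraMap A K)) (b.map (algebraMap A K)) := by
    refine isCoprime_of_dvd _ _ (fun h0 => ha (hinj (by simpa using h0.1))) ?_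
    intro D hD hD0 hDa hDb
    apply hD
    -- The primitive part of a common divisor over the fraction field divides both polynomials
    -- already over `A`.
    set P := (IsLocalization.integerNormalization A⁰ D).primPart with hP
    have hPprim : P.IsPrimitive := Polynomial.isPrimitive_primPart _
    have hPD : P.map (algebraMap A K) ∣ D := by
      obtain ⟨t, htm, ht⟩ := IsLocalization.integerNormalization_spec A⁰ D
      have h1 : P.map (algebraMap A K) ∣ t • D := by
        rw [← ht, Polynomial.eq_C_content_mul_primPart (IsLocalization.integerNormalization A⁰ D),
          Polynomial.map_mul]
        exact dvd_mul_left _ _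
      have ht0 : algebraMap A K t ≠ 0 := IsFractionRing.to_map_ne_zero_of_mem_nonZeroDivisors htm
      rw [← algebraMap_smul K t D, Polynomial.smul_eq_C_mul] at h1
      exact ((Polynomial.isUnit_C.2 (isUnit_iff_ne_zero.2 ht0)).dvd_mul_left).1 h1
    have hPu : IsUnit P := h
      (hPprim.dvd_of_fraction_map_dvd_fraction_map (K := K) (hPD.trans hDa))
      (hPprim.dvd_of_fraction_map_dvd_fraction_map (K := K) (hPD.trans hDb))
    exact Polynomial.isUnit_or_eq_zero_of_isUnit_integerNormalization_primPart hD0 hPu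
  obtain ⟨x, y, hxy⟩ := hcop
  obtain ⟨t, htm, ht⟩ := IsLocalization.integerNormalization_spec A⁰ x
  obtain ⟨u, hum, hu⟩ := IsLocalization.integerNormalization_spec A⁰ y
  refine ⟨t * u, Polynomial.C u * IsLocalization.integerNormalization A⁰ x,
    Polynomial.C t * IsLocalization.integerNormalization A⁰ y,
    mul_ne_zero (nonZeroDivisors.ne_zero htm) (nonZeroDivisors.ne_zero hum), hinj ?_⟩
  simp only [Polynomial.map_add, Polynomial.map_mul, ht, hu, Polynomial.map_C]
  rw [← algebraMap_smul K t x, ← algebraMap_smul K u y, Polynomial.smul_eq_C_mul,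
    Polynomial.smul_eq_C_mul, map_mul, map_mul]
  linear_combination
    (Polynomial.C (algebraMap A K t) * Polynomial.C (algebraMap A K u)) * hxy

section LineAvoidance

variable {ι : Type*} [Fintype ι] [DecidableEq ι]

/-- The polynomial `a (v + s u)` in the variable `s`, with coefficients polynomials in `v`. -/
def lineExpand (u : ι → ℂ) : MvPolynomial ι ℂ →ₐ[ℂ] Polynomial (MvPolynomial ι ℂ) :=
  aeval fun i => Polynomial.C (X i) + Polynomial.X * Polynomial.C (C (u i))

theorem eval_lineExpand (u v : ι → ℂ) (s : ℂ) (a : MvPolynomial ι ℂ) :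
    ((lineExpand u a).map (eval v)).eval s = eval (v + s • u) a := by
  induction a using MvPolynomial.induction_on with
  | C a =>
    rw [lineExpand, ← algebraMap_eq, AlgHom.commutes, IsScalarTower.algebraMap_apply ℂ
      (MvPolynomial ι ℂ) (Polynomial (MvPolynomial ι ℂ)), Polynomial.algebraMap_eq]
    simp
  | add p q hp hq => simp only [map_add, Polynomial.map_add, Polynomial.eval_add, hp, hq]
  | mul_X p k hp =>
    rw [map_mul, Polynomial.map_mul, Polynomial.eval_mul, hp, map_mul]
    congr 1
    simp [lineExpand, mul_comm (u k)]

/-- The substitution `v ↦ v + s u` as an endomorphism of the polynomial ring in `v` and `s`. -/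
def lineShift (u : ι → ℂ) : Polynomial (MvPolynomial ι ℂ) →+* Polynomial (MvPolynomial ι ℂ) :=
  Polynomial.eval₂RingHom (lineExpand u : MvPolynomial ι ℂ →+* _) Polynomial.X

theorem lineShift_C (u : ι → ℂ) (a : MvPolynomial ι ℂ) :
    lineShift u (Polynomial.C a) = lineExpand u a := by
  simp [lineShift]

theorem eval_lineShift (u v : ι → ℂ) (s : ℂ) (P : Polynomial (MvPolynomial ι ℂ)) :
    ((lineShift u P).map (eval v)).eval s = (P.map (eval (v + s • u))).eval s := by
  induction P using Polynomial.induction_on' with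
  | add p q hp hq => simp only [map_add, Polynomial.map_add, Polynomial.eval_add, hp, hq]
  | monomial n a =>
    rw [← Polynomial.C_mul_X_pow_eq_monomial, map_mul, Polynomial.map_mul, Polynomial.eval_mul,
      lineShift_C, eval_lineExpand]
    simp [lineShift]

theorem polynomial_ext_eval {P Q : Polynomial (MvPolynomial ι ℂ)}
    (h : ∀ (v : ι → ℂ) (s : ℂ), (P.map (eval v)).eval s = (Q.map (eval v)).eval s) : P = Q := by
  ext1 n
  refine MvPolynomial.funext fun v => ?_
  have : P.map (eval v) = Q.map (eval v) := Polynomial.funext (h v)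
  simpa [Polynomial.coeff_map] using congrArg (fun p => p.coeff n) this

theorem lineShift_neg_lineShift (u : ι → ℂ) (P : Polynomial (MvPolynomial ι ℂ)) :
    lineShift (-u) (lineShift u P) = P := by
  refine polynomial_ext_eval fun v s => ?_
  rw [eval_lineShift, eval_lineShift]
  simp

/-- A generic line in a given direction does not meet the common zeros of two relatively prime
polynomials. -/
theorem exists_line_avoid_isRelPrime {a b : MvPolynomial ι ℂ} (ha : a ≠ 0) (h : IsRelPrime a b)
    (u : ι → ℂ) : ∃ f : MvPolynomial ι ℂ, f ≠ 0 ∧ ∀ v, eval v f ≠ 0 →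
      ∀ s : ℂ, ¬ (eval (v + s • u) a = 0 ∧ eval (v + s • u) b = 0) := by
  have hinj : ∀ u : ι → ℂ, Function.Injective (lineShift u) := fun u x y hxy => by
    rw [← lineShift_neg_lineShift u x, hxy, lineShift_neg_lineShift]
  have ha' : lineExpand u a ≠ 0 := by
    rw [← lineShift_C]
    intro h0
    have := hinj u (h0.trans (map_zero _).symm)
    exact ha (Polynomial.C_eq_zero.1 this)
  -- Undoing the shift turns the two polynomials into constants in `s`, so a common divisor has
  -- degree zero and divides both `a` and `b`.
  have hrel : IsRelPrime (lineExpand u a) (lineExpand u b) := by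
    intro d hda hdb
    have h1 := map_dvd (lineShift (-u)) hda
    have h2 := map_dvd (lineShift (-u)) hdb
    rw [← lineShift_C, lineShift_neg_lineShift] at h1 h2
    have hdeg : (lineShift (-u) d).natDegree = 0 := by
      have := Polynomial.natDegree_le_of_dvd h1 (Polynomial.C_ne_zero.2 ha)
      simpa using this
    rw [Polynomial.eq_C_of_natDegree_eq_zero hdeg] at h1 h2
    have hu : IsUnit (lineShift (-u) d) := by
      rw [Polynomial.eq_C_of_natDegree_eq_zero hdeg]
      refine Polynomial.isUnit_C.2 (h ?_ ?_)
      · simpa using Polynomial.C_dvd_iff_dvd_coeff _ _ |>.1 h1 0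
      · simpa using Polynomial.C_dvd_iff_dvd_coeff _ _ |>.1 h2 0
    have := hu.map (lineShift u)
    rwa [← neg_neg u, neg_neg (-u), lineShift_neg_lineShift (-u)] at this
  obtain ⟨c, x, y, hc, hxy⟩ := exists_bezout_of_isRelPrime ha' hrel
  refine ⟨c, hc, fun v hv s ⟨h1, h2⟩ => hv ?_⟩
  have := congrArg (fun P => (P.map (eval v)).eval s) hxy
  simp only [Polynomial.map_add, Polynomial.map_mul, Polynomial.eval_add, Polynomial.eval_mul,
    eval_lineExpand, h1, h2, mul_zero, add_zero, Polynomial.map_C, Polynomial.eval_C] at this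
  exact this.symm

theorem eval_aeval_X_add_C (u : ι → ℂ) (f : MvPolynomial ι ℂ) (v : ι → ℂ) :
    eval v (aeval (fun i => X i + C (u i)) f : MvPolynomial ι ℂ) = eval (v + u) f := by
  induction f using MvPolynomial.induction_on with
  | C a => simp
  | add p q hp hq => simp only [map_add, hp, hq]
  | mul_X p k hp => rw [map_mul, map_mul, hp, map_mul]; simp

/-- A nonzero polynomial whose zeros lie in finitely many subspaces of codimension two is
constant. -/
theorem eval_eq_of_zeros_subset {τ : Type*} (S : Finset τ) {c c' : τ → ι → ℂ}
    (hc : ∀ i ∈ S, Indep (c i) (c' i)) {f : MvPolynomial ι ℂ}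
    (hf : ∀ v, eval v f = 0 → ∃ i ∈ S, c i ⬝ᵥ v = 0 ∧ c' i ⬝ᵥ v = 0) (x : ι → ℂ) :
    eval x f = eval 0 f := by
  by_contra hx
  have h1 : f - C (eval 0 f) ≠ 0 := by
    intro h0
    have := congrArg (eval x) h0
    simp [sub_eq_zero] at this
    exact hx (by simpa using this)
  have h2 : (f - C (eval 0 f)) * ∏ i ∈ S, linForm (c i) ≠ 0 :=
    mul_ne_zero h1 (Finset.prod_ne_zero_iff.2 fun i hi => linForm_ne_zero (hc i hi).ne_zero_left)
  -- The direction `u` lies off the hyperplanes `c i` and has `f(u) ≠ f(0)`. Then `f` is nonconstant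
  -- on a generic line in this direction and has a root there, although such a line misses all the
  -- subspaces.
  obtain ⟨u, hu⟩ := exists_eval_ne_zero h2
  rw [map_mul, mul_ne_zero_iff, prod_eval_ne_zero_iff] at hu
  have hg : ∀ i ∈ S, c i ⬝ᵥ u ≠ 0 := fun i hi => by simpa using hu.2 i hi
  have hex : ∀ i, ∃ g : MvPolynomial ι ℂ, i ∈ S → g ≠ 0 ∧ ∀ v, eval v g ≠ 0 →
      ∀ s : ℂ, ¬ (c i ⬝ᵥ (v + s • u) = 0 ∧ c' i ⬝ᵥ (v + s • u) = 0) := by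
    intro i
    by_cases hi : i ∈ S
    · obtain ⟨g, hg⟩ := exists_line_avoid_indep (hc i hi) (hg i hi)
      exact ⟨g, fun _ => hg⟩
    · exact ⟨0, fun h => absurd h hi⟩
  choose g hg using hex
  let f' : MvPolynomial ι ℂ := aeval (fun i => X i + C (u i)) f
  have hf' : ∀ v, eval v f' = eval (v + u) f := eval_aeval_X_add_C u f
  have h3 : (f' - f) * ∏ i ∈ S, g i ≠ 0 := by
    refine mul_ne_zero (fun h0 => ?_) (Finset.prod_ne_zero_iff.2 fun i hi => (hg i hi).1)
    have := congrArg (eval 0) h0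
    rw [map_sub, hf', zero_add] at this
    apply hu.1
    rw [map_sub, eval_C]
    simpa using this
  obtain ⟨v, hv⟩ := exists_eval_ne_zero h3
  rw [map_mul, mul_ne_zero_iff, prod_eval_ne_zero_iff] at hv
  have hdeg : 0 < (restrictLine f v u).degree := by
    rw [← not_le]
    intro hle
    apply hv.1
    rw [map_sub, hf', sub_eq_zero]
    have h4 := eval_restrictLine f v u 0
    have h5 := eval_restrictLine f v u 1
    rw [Polynomial.eq_C_of_degree_le_zero hle, Polynomial.eval_C] at h4 h5
    simpa using h5.symm.trans h4
  obtain ⟨s, hs⟩ := Complex.exists_root hdeg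
  rw [Polynomial.IsRoot, eval_restrictLine] at hs
  obtain ⟨i, hi, h6⟩ := hf _ hs
  exact (hg i hi).2 v (hv.2 i hi) s h6

end LineAvoidance

end QuotientLift
end

/-! ### Generic lines avoid all isotropy beyond a single reflection. -/

noncomputable section

namespace QuotientLift

open MvPolynomial Matrix Topology Filter

set_option linter.unusedSectionVars false

section Coact

variable {κ : Type*} [Fintype κ] [DecidableEq κ] {H : Type*} [Group H] (σ : H →* Matrix κ κ ℝ)

/-- The coefficient vector of the linear form `w ↦ ⟨c, h w⟩`. -/
def coact (h : H) (c : κ → ℂ) : κ → ℂ := c ᵥ* (σ h).map (algebraMap ℝ ℂ)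

theorem coact_dotProduct (h : H) (c w : κ → ℂ) : coact σ h c ⬝ᵥ w = c ⬝ᵥ act σ h w := by
  rw [coact, act, mulVecLin_apply, dotProduct_mulVec]

theorem coact_coact (h h' : H) (c : κ → ℂ) : coact σ h (coact σ h' c) = coact σ (h' * h) c := by
  simp only [coact, map_mul, Matrix.map_mul, vecMul_vecMul]

theorem coact_one (c : κ → ℂ) : coact σ 1 c = c := by
  simp [coact, Matrix.map_one]

theorem coact_smul (h : H) (t : ℂ) (c : κ → ℂ) : coact σ h (t • c) = t • coact σ h c := by
  simp only [coact, smul_vecMul]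

theorem Indep.coact {c c' : κ → ℂ} (hc : Indep c c') (h : H) :
    Indep (coact σ h c) (QuotientLift.coact σ h c') := by
  by_contra hn
  have hinv : ∀ x : κ → ℂ, QuotientLift.coact σ h⁻¹ (QuotientLift.coact σ h x) = x := fun x => by
    rw [coact_coact, mul_inv_cancel, coact_one]
  have h0 : QuotientLift.coact σ h c ≠ 0 := by
    intro h0
    apply hc.ne_zero_left
    rw [← hinv c, h0]
    simp [QuotientLift.coact]
  obtain ⟨t, ht⟩ := exists_smul_of_not_indep h0 hn
  have : c' = t • c := by rw [← hinv c', ht, coact_smul, hinv]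
  obtain ⟨i, j, hij⟩ := hc
  apply hij
  rw [this, Pi.smul_apply, Pi.smul_apply, smul_eq_mul, smul_eq_mul]
  ring

/-- Two members of the pencil `c' + t c` span the same plane as `c` and `c'`, so they cannot both be
multiples of `x`. -/
theorem subsingleton_not_indep_add_smul {c c' x : κ → ℂ} (h : Indep c c') (hx : x ≠ 0) :
    {t : ℂ | ¬ Indep x (c' + t • c)}.Subsingleton := by
  intro t ht t' ht'
  by_contra hne
  obtain ⟨a, ha⟩ := exists_smul_of_not_indep hx ht
  obtain ⟨a', ha'⟩ := exists_smul_of_not_indep hx ht'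
  obtain ⟨i, j, hij⟩ := h
  apply hij
  have h1 := congrFun ha i
  have h2 := congrFun ha j
  have h3 := congrFun ha' i
  have h4 := congrFun ha' j
  simp only [Pi.add_apply, Pi.smul_apply, smul_eq_mul] at h1 h2 h3 h4
  have h5 : t - t' ≠ 0 := sub_ne_zero.2 hne
  have h6 : (t - t') * c i = (a - a') * x i := by linear_combination h1 - h3
  have h7 : (t - t') * c j = (a - a') * x j := by linear_combination h2 - h4
  apply mul_left_cancel₀ h5
  apply mul_left_cancel₀ h5
  have h8 : (t - t') * c' i = (a * (t - t') - t * (a - a')) * x i := by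
    linear_combination (t - t') * h1 - t * h6
  have h9 : (t - t') * c' j = (a * (t - t') - t * (a - a')) * x j := by
    linear_combination (t - t') * h2 - t * h7
  linear_combination ((t - t') * c' j) * h6 + ((a - a') * x i) * h9 - ((t - t') * c' i) * h7
    - ((a - a') * x j) * h8

/-- Each translate of `c` rules out at most one `t`. Replacing `c'` by `c' + t c` keeps the common
zeros of the two forms while making the norms free of shared factors. -/
theorem exists_indep_coact [Finite H] {c c' : κ → ℂ} (h : Indep c c') :
    ∃ t : ℂ, ∀ g g' : H, Indep (coact σ g c) (coact σ g' (c' + t • c)) := by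
  have hfin : (⋃ g : H, {t : ℂ | ¬ Indep (coact σ g c) (c' + t • c)}).Finite :=
    Set.finite_iUnion fun g => (subsingleton_not_indep_add_smul h
      ((h.coact σ g).ne_zero_left)).finite
  obtain ⟨t, ht⟩ := hfin.infinite_compl.nonempty
  refine ⟨t, fun g g' => ?_⟩
  have h1 : Indep (coact σ (g * g'⁻¹) c) (c' + t • c) := by
    by_contra hn
    exact ht (Set.mem_iUnion.2 ⟨g * g'⁻¹, hn⟩)
  have := h1.coact σ g'
  rwa [coact_coact, inv_mul_cancel_right] at this

end Coact

variable {ι κ : Type*} [Fintype ι] [DecidableEq ι] [Fintype κ] [DecidableEq κ]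
  {G H : Type*} [Group G] [Group H] [Finite G] [Finite H]
  {ρ : G →* Matrix ι ι ℝ} {σ : H →* Matrix κ κ ℝ} {R : (ι → ℂ) → (κ → ℂ) → Prop}

namespace OrbitCorrespondence

/-- The norm of a common divisor, pushed to the other side, vanishes only where translates of both
forms vanish. These zeros lie in finitely many subspaces of codimension two, so the norm is a
nonzero constant and the divisor a unit. -/
theorem isRelPrime_of_indep (hR : OrbitCorrespondence ρ σ R) {c c' : κ → ℂ}
    (h : ∀ g g' : H, Indep (coact σ g c) (coact σ g' c')) {a a' : MvPolynomial ι ℂ}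
    (ha : ∀ v w, R v w → eval v a = eval w (norm σ (linForm c)))
    (ha' : ∀ v w, R v w → eval v a' = eval w (norm σ (linForm c'))) : IsRelPrime a a' := by
  classical
  let := Fintype.ofFinite H
  intro d hd hd'
  obtain ⟨b, hb⟩ := hR.push (isInv_norm ρ d)
  have hia : IsInv ρ a := hR.isInv_pull ha
  have hia' : IsInv ρ a' := hR.isInv_pull ha'
  have hzero : ∀ w, eval w b = 0 → ∃ i ∈ (Finset.univ : Finset (H × H)),
      coact σ i.1 c ⬝ᵥ w = 0 ∧ coact σ i.2 c' ⬝ᵥ w = 0 := by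
    intro w hw
    obtain ⟨v, hv⟩ := hR.exists_left w
    rw [hb _ _ hv, eval_norm_eq_zero_iff] at hw
    obtain ⟨g, hg⟩ := hw
    have h1 : eval v a = 0 := by
      rw [← hia g]
      obtain ⟨q, rfl⟩ := hd
      rw [map_mul, hg, zero_mul]
    have h2 : eval v a' = 0 := by
      rw [← hia' g]
      obtain ⟨q, rfl⟩ := hd'
      rw [map_mul, hg, zero_mul]
    rw [ha _ _ hv, eval_norm_eq_zero_iff] at h1
    rw [ha' _ _ hv, eval_norm_eq_zero_iff] at h2
    obtain ⟨g1, h1⟩ := h1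
    obtain ⟨g2, h2⟩ := h2
    refine ⟨(g1, g2), Finset.mem_univ _, ?_, ?_⟩
    · rw [coact_dotProduct, ← eval_linForm, h1]
    · rw [coact_dotProduct, ← eval_linForm, h2]
  have hconst := eval_eq_of_zeros_subset Finset.univ (fun i _ => h i.1 i.2) hzero
  have hN : norm ρ d = C (eval 0 b) := by
    refine MvPolynomial.funext fun v => ?_
    obtain ⟨w, hw⟩ := hR.exists_right v
    rw [← hb _ _ hw, hconst, eval_C]
  have hb0 : eval 0 b ≠ 0 := by
    intro h0
    rw [h0, C_0] at hN
    refine norm_ne_zero ρ (f := d) ?_ hN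
    rintro rfl
    have h1 : c ≠ 0 := by
      have := (h 1 1).ne_zero_left
      rwa [coact_one] at this
    exact hR.pull_ne_zero ha (norm_ne_zero σ (linForm_ne_zero h1)) (zero_dvd_iff.1 hd)
  have hu : IsUnit (norm ρ d) := by
    rw [hN]
    exact (isUnit_iff_ne_zero.2 hb0).map C
  exact isUnit_of_dvd_unit (dvd_norm ρ d) hu

/-- A generic line in a given direction corresponds to points avoiding a given subspace of
codimension two. -/
theorem exists_line_avoid (hR : OrbitCorrespondence ρ σ R) {c c' : κ → ℂ} (h : Indep c c')
    (u : ι → ℂ) : ∃ f : MvPolynomial ι ℂ, f ≠ 0 ∧ ∀ v, eval v f ≠ 0 →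
      ∀ (s : ℂ) w, R (v + s • u) w → ¬ (c ⬝ᵥ w = 0 ∧ c' ⬝ᵥ w = 0) := by
  obtain ⟨t, ht⟩ := exists_indep_coact σ h
  obtain ⟨a, ha⟩ := hR.pull (isInv_norm σ (linForm c))
  obtain ⟨a', ha'⟩ := hR.pull (isInv_norm σ (linForm (c' + t • c)))
  have ha0 : a ≠ 0 := hR.pull_ne_zero ha (norm_ne_zero σ (linForm_ne_zero h.ne_zero_left))
  obtain ⟨f, hf, hfv⟩ := exists_line_avoid_isRelPrime ha0 (hR.isRelPrime_of_indep ht ha ha') u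
  refine ⟨f, hf, fun v hv s w hw ⟨h1, h2⟩ => hfv v hv s ⟨?_, ?_⟩⟩
  · rw [ha _ _ hw, eval_norm_eq_zero_iff]
    exact ⟨1, by simpa using h1⟩
  · rw [ha' _ _ hw, eval_norm_eq_zero_iff]
    exact ⟨1, by simp [add_dotProduct, h1, h2]⟩

/-- By faithfulness `1 - σ h` has a nonzero row for `h ≠ 1`, a linear form vanishing on the fixed
points of `h`. The norm of the product of these forms can be pulled back. -/
theorem exists_generic_stab_eq_bot (hR : OrbitCorrespondence ρ σ R) :
    ∃ f : MvPolynomial ι ℂ, f ≠ 0 ∧ ∀ u, eval u f ≠ 0 → ∀ w, R u w →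
      ∀ h, act σ h w = w → h = 1 := by
  classical
  let := Fintype.ofFinite H
  have hex : ∀ h : H, ∃ c : κ → ℂ, h ≠ 1 → c ≠ 0 ∧ ∀ w, act σ h w = w → c ⬝ᵥ w = 0 := by
    intro h
    by_cases h1 : h = 1
    · exact ⟨0, fun h2 => absurd h1 h2⟩
    · have h2 : 1 - σ h ≠ 0 := fun h3 => h1 (hR.injective_right
        (by rw [map_one]; exact (sub_eq_zero.1 h3).symm))
      obtain ⟨i, hi⟩ := Function.ne_iff.1 h2
      exact ⟨toC ((1 - σ h) i), fun _ => ⟨toC_ne_zero hi,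
        fun w hw => row_dotProduct_of_act_eq σ hw i⟩⟩
  choose c hc using hex
  let b : MvPolynomial κ ℂ := norm σ (∏ h ∈ Finset.univ.erase 1, linForm (c h))
  obtain ⟨a, ha⟩ := hR.pull (isInv_norm σ (∏ h ∈ Finset.univ.erase 1, linForm (c h)))
  refine ⟨a, hR.pull_ne_zero ha (norm_ne_zero σ (Finset.prod_ne_zero_iff.2 fun h hh =>
    linForm_ne_zero (hc h (Finset.ne_of_mem_erase hh)).1)), fun u hu w hw h hh => ?_⟩
  by_contra h1
  apply hu
  rw [ha _ _ hw, eval_norm_eq_zero_iff]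
  refine ⟨1, ?_⟩
  rw [act_one, map_prod]
  exact Finset.prod_eq_zero (Finset.mem_erase.2 ⟨h1, Finset.mem_univ _⟩)
    (by rw [eval_linForm]; exact (hc h h1).2 w hh)

/-- A finite family of generic conditions can be imposed simultaneously. -/
theorem _root_.QuotientLift.exists_generic_forall {τ : Type*} [Finite τ]
    {P : τ → (ι → ℂ) → Prop}
    (h : ∀ i, ∃ f : MvPolynomial ι ℂ, f ≠ 0 ∧ ∀ v, eval v f ≠ 0 → P i v) :
    ∃ f : MvPolynomial ι ℂ, f ≠ 0 ∧ ∀ v, eval v f ≠ 0 → ∀ i, P i v := by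
  let := Fintype.ofFinite τ
  choose f hf hP using h
  refine ⟨∏ i, f i, Finset.prod_ne_zero_iff.2 fun i _ => hf i, fun v hv i => hP i v ?_⟩
  exact (prod_eval_ne_zero_iff _ _ _).1 hv i (Finset.mem_univ i)

theorem exists_generic_direction (ρ : G →* Matrix ι ι ℝ) :
    ∃ f : MvPolynomial ι ℂ, f ≠ 0 ∧ ∀ u, eval u f ≠ 0 → ∀ g m d, IsRefl (ρ g) m d →
      toC m ⬝ᵥ u ≠ 0 :=
  ⟨disc ρ, disc_ne_zero ρ, fun _ hu g m d h h0 =>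
    hu ((eval_disc_eq_zero_iff ρ).2 ⟨g, m, d, h, h0⟩)⟩

/-- Along generic lines local lifts exist everywhere. -/
theorem exists_generic_line (hR : OrbitCorrespondence ρ σ R) {u : ι → ℂ}
    (hu : ∀ g m d, IsRefl (ρ g) m d → toC m ⬝ᵥ u ≠ 0) :
    ∃ f : MvPolynomial ι ℂ, f ≠ 0 ∧ ∀ v, eval v f ≠ 0 → ∀ (s : ℂ) w, R (v + s • u) w →
      ∃ ω, IsLocalLift R v u ω s ∧ ω s = w := by
  classical
  obtain ⟨k, hk, hpow⟩ := exists_pow_card_eq_one σ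
  -- Elements whose fixed space has codimension at least two fix no point related to the line.
  have h1 : ∀ h : H, ∃ f : MvPolynomial ι ℂ, f ≠ 0 ∧ ∀ v, eval v f ≠ 0 →
      ∀ (s : ℂ) w, R (v + s • u) w → act σ h w = w → h = 1 ∨ ∃ l e, IsRefl (σ h) l e := by
    intro h
    rcases trichotomy_of_pow_eq_one hk (hpow h) with h1 | h1 | ⟨i, j, h1⟩
    · exact ⟨1, one_ne_zero, fun _ _ _ _ _ _ => Or.inl (hR.injective_right (by rw [h1, map_one]))⟩
    · exact ⟨1, one_ne_zero, fun _ _ _ _ _ _ => Or.inr h1⟩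
    · obtain ⟨f, hf, hfv⟩ := hR.exists_line_avoid h1 u
      exact ⟨f, hf, fun v hv s w hw hhw => absurd
        ⟨row_dotProduct_of_act_eq σ hhw i, row_dotProduct_of_act_eq σ hhw j⟩ (hfv v hv s w hw)⟩
  -- No related point lies on two distinct reflection hyperplanes of `H`; `h3` is the same condition
  -- for `G` and the line itself.
  have h2 : ∀ i : H × H, ∃ f : MvPolynomial ι ℂ, f ≠ 0 ∧ ∀ v, eval v f ≠ 0 →
      ∀ (s : ℂ) w, R (v + s • u) w → (∃ l e, IsRefl (σ i.1) l e) → (∃ l e, IsRefl (σ i.2) l e) →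
      act σ i.1 w = w → act σ i.2 w = w → i.1 = i.2 := by
    rintro ⟨h, h'⟩
    by_cases hh : h ≠ h' ∧ (∃ l e, IsRefl (σ h) l e) ∧ ∃ l e, IsRefl (σ h') l e
    · obtain ⟨hne, ⟨l, e, h3⟩, ⟨l', e', h4⟩⟩ := hh
      obtain ⟨f, hf, hfv⟩ := hR.exists_line_avoid (indep_of_ne hR.injective_right hne h3 h4) u
      exact ⟨f, hf, fun v hv s w hw _ _ h5 h6 => absurd
        ⟨(act_eq_self_iff_of_isRefl h3 w).1 h5, (act_eq_self_iff_of_isRefl h4 w).1 h6⟩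
        (hfv v hv s w hw)⟩
    · refine ⟨1, one_ne_zero, fun v _ s w _ h3 h4 _ _ => ?_⟩
      by_contra hne
      exact hh ⟨hne, h3, h4⟩
  have h3 : ∀ i : G × G, ∃ f : MvPolynomial ι ℂ, f ≠ 0 ∧ ∀ v, eval v f ≠ 0 →
      ∀ (s : ℂ), (∃ l e, IsRefl (ρ i.1) l e) → (∃ l e, IsRefl (ρ i.2) l e) →
      act ρ i.1 (v + s • u) = v + s • u → act ρ i.2 (v + s • u) = v + s • u → i.1 = i.2 := by
    rintro ⟨h, h'⟩
    by_cases hh : h ≠ h' ∧ (∃ l e, IsRefl (ρ h) l e) ∧ ∃ l e, IsRefl (ρ h') l e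
    · obtain ⟨hne, ⟨l, e, h3⟩, ⟨l', e', h4⟩⟩ := hh
      obtain ⟨f, hf, hfv⟩ := exists_line_avoid_indep (indep_of_ne hR.injective_left hne h3 h4)
        (hu _ _ _ h3)
      exact ⟨f, hf, fun v hv s _ _ h5 h6 => absurd
        ⟨(act_eq_self_iff_of_isRefl h3 _).1 h5, (act_eq_self_iff_of_isRefl h4 _).1 h6⟩
        (hfv v hv s)⟩
    · refine ⟨1, one_ne_zero, fun v _ s h3 h4 _ _ => ?_⟩
      by_contra hne
      exact hh ⟨hne, h3, h4⟩
  obtain ⟨f1, hf1, hP1⟩ := exists_generic_forall h1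
  obtain ⟨f2, hf2, hP2⟩ := exists_generic_forall h2
  obtain ⟨f3, hf3, hP3⟩ := exists_generic_forall h3
  refine ⟨f1 * f2 * f3, mul_ne_zero (mul_ne_zero hf1 hf2) hf3, fun v hv s w hw => ?_⟩
  rw [map_mul, map_mul, mul_ne_zero_iff, mul_ne_zero_iff] at hv
  obtain ⟨⟨hv1, hv2⟩, hv3⟩ := hv
  by_cases hst : ∀ h, act σ h w = w → h = 1
  · exact hR.exists_localLift_of_stab_eq_bot hw hst
  · push Not at hst
    obtain ⟨r, hrw, hr1⟩ := hst
    obtain ⟨l, e, hr⟩ := (hP1 v hv1 r s w hw hrw).resolve_left hr1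
    obtain ⟨g, m, d, hg, hma⟩ := (hR.onHyperplane_iff hw).2
      ⟨r, l, e, hr, (act_eq_self_iff_of_isRefl hr w).1 hrw⟩
    refine hR.exists_localLift_of_isRefl hw hr hrw (fun h hh => ?_) hg hma (hu g m d hg) ?_
    · exact (hP1 v hv1 h s w hw hh).imp_right fun h3 =>
        hP2 v hv2 (h, r) s w hw h3 ⟨l, e, hr⟩ hh hrw
    · intro g' m' d' hg' hm'
      exact hP3 v hv3 (g', g) s ⟨m', d', hg'⟩ ⟨m, d, hg⟩
        ((act_eq_self_iff_of_isRefl hg' _).2 hm') ((act_eq_self_iff_of_isRefl hg _).2 hma)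

end OrbitCorrespondence

end QuotientLift
end

/-! ### Velocities of lifts, Liouville's theorem and affine lifts. -/

noncomputable section

namespace QuotientLift

open MvPolynomial Matrix Topology Filter

set_option linter.unusedSectionVars false

variable {ι κ : Type*} [Fintype ι] [DecidableEq ι] [Fintype κ] [DecidableEq κ]
  {G H : Type*} [Group G] [Group H] [Finite G] [Finite H]
  {ρ : G →* Matrix ι ι ℝ} {σ : H →* Matrix κ κ ℝ} {R : (ι → ℂ) → (κ → ℂ) → Prop}

/-- Invariants separate orbits. -/
theorem exists_act_eq_of_eval_eq (σ : H →* Matrix κ κ ℝ) {x y : κ → ℂ}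
    (h : ∀ b, IsInv σ b → eval x b = eval y b) : ∃ g, x = act σ g y := by
  classical
  let := Fintype.ofFinite H
  by_contra! hne
  obtain ⟨c, hc⟩ := exists_dotProduct_ne_zero (Finset.univ.image fun g => act σ g y - x) (by
    intro z hz
    obtain ⟨g, -, rfl⟩ := Finset.mem_image.1 hz
    exact sub_ne_zero.2 (hne g).symm)
  -- This norm vanishes at `x`; vanishing at `y` would require some `g y` with the same value of `c`
  -- as `x`, which the choice of `c` excludes.
  have h1 := h _ (isInv_norm σ (linForm c - C (c ⬝ᵥ x)))
  have h2 : eval x (norm σ (linForm c - C (c ⬝ᵥ x))) = 0 :=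
    (eval_norm_eq_zero_iff _ _ _).2 ⟨1, by simp⟩
  rw [h2] at h1
  obtain ⟨g, hg⟩ := (eval_norm_eq_zero_iff _ _ _).1 h1.symm
  refine hc _ (Finset.mem_image.2 ⟨g, Finset.mem_univ _, rfl⟩) ?_
  rw [dotProduct_sub, ← hg]
  simp

theorem act_apply (g : H) (w : κ → ℂ) (i : κ) :
    act σ g w i = ∑ j, ((σ g i j : ℝ) : ℂ) * w j := by
  simp [act, mulVec, dotProduct]

/-- The velocity vector of a curve. -/
def velocity (ω : ℂ → κ → ℂ) (s : ℂ) : κ → ℂ := fun i => deriv (fun t => ω t i) s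

theorem velocity_act {ω : ℂ → κ → ℂ} {s : ℂ} (hω : ∀ i, AnalyticAt ℂ (fun t => ω t i) s) (g : H) :
    velocity (fun t => act σ g (ω t)) s = act σ g (velocity ω s) := by
  ext i
  simp only [velocity, act_apply]
  refine HasDerivAt.deriv ?_
  refine HasDerivAt.fun_sum fun j _ => ?_
  exact (hω j).differentiableAt.hasDerivAt.const_mul _

namespace IsLocalLift

variable {a b : ι → ℂ} {ω ω' : ℂ → κ → ℂ} {s : ℂ}

theorem eventually_isLocalLift (h : IsLocalLift R a b ω s) :
    ∀ᶠ t in 𝓝 s, IsLocalLift R a b ω t := by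
  have h1 : ∀ᶠ t in 𝓝 s, ∀ i, AnalyticAt ℂ (fun s => ω s i) t :=
    eventually_all.2 fun i => (h.analyticAt i).eventually_analyticAt
  filter_upwards [h1, h.eventually.eventually_nhds] with t ht ht'
  exact ⟨ht, ht'⟩

/-- The group element relating the two lifts may depend on `t`, but the group is finite, so one
element occurs for parameters accumulating at `s`. The identity theorem extends that relation to a
neighbourhood. -/
theorem exists_eventually_eq_act (hR : OrbitCorrespondence ρ σ R) (h : IsLocalLift R a b ω s)
    (h' : IsLocalLift R a b ω' s) : ∃ g, ∀ᶠ t in 𝓝 s, ω' t = act σ g (ω t) := by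
  have h1 : ∀ᶠ t in 𝓝[≠] s, ∃ g, ω' t = act σ g (ω t) := by
    refine Filter.Eventually.filter_mono nhdsWithin_le_nhds ?_
    filter_upwards [h.eventually, h'.eventually] with t ht ht'
    exact (hR.right_iff ht).1 ht'
  obtain ⟨g, hg⟩ : ∃ g, ∃ᶠ t in 𝓝[≠] s, ω' t = act σ g (ω t) := by
    by_contra! hn
    have h2 : ∀ᶠ t in 𝓝[≠] s, ∀ g, ¬ ω' t = act σ g (ω t) :=
      eventually_all.2 hn
    obtain ⟨t, ⟨g, ht⟩, ht'⟩ := (h1.and h2).exists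
    exact ht' g ht
  refine ⟨g, ?_⟩
  have h3 : ∀ i, ∀ᶠ t in 𝓝 s, ω' t i = act σ g (ω t) i := by
    intro i
    have ha : AnalyticAt ℂ (fun t => act σ g (ω t) i) s := by
      simp only [act_apply]
      exact Finset.analyticAt_fun_sum _ fun j _ => analyticAt_const.fun_mul (h.analyticAt j)
    exact ((h'.analyticAt i).frequently_eq_iff_eventually_eq ha).1
      (hg.mono fun t ht => congrFun ht i)
  filter_upwards [eventually_all.2 h3] with t ht
  exact _root_.funext ht

theorem eval_velocity_eq (hR : OrbitCorrespondence ρ σ R) (h : IsLocalLift R a b ω s)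
    (h' : IsLocalLift R a b ω' s) {f : MvPolynomial κ ℂ} (hf : IsInv σ f) :
    eval (velocity ω' s) f = eval (velocity ω s) f := by
  obtain ⟨g, hg⟩ := exists_eventually_eq_act hR h h'
  have : velocity ω' s = act σ g (velocity ω s) := by
    rw [← velocity_act h.analyticAt]
    ext i
    refine Filter.EventuallyEq.deriv_eq ?_
    filter_upwards [hg] with t ht
    rw [ht]
  rw [this, hf]

theorem analyticAt_eval_velocity (h : IsLocalLift R a b ω s) (f : MvPolynomial κ ℂ) :
    AnalyticAt ℂ (fun t => eval (velocity ω t) f) s :=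
  analyticAt_eval_comp f fun i => (h.analyticAt i).deriv

/-- Reparametrization of a lift near a point of a line as a lift near infinity of the line in the
opposite parametrization. -/
theorem inv_smul (hR : OrbitCorrespondence ρ σ R) {u v : ι → ℂ} (hs : s ≠ 0)
    (h : IsLocalLift R u v ω s⁻¹) : IsLocalLift R v u (fun t => t • ω t⁻¹) s := by
  constructor
  · intro i
    have h1 : AnalyticAt ℂ (fun t : ℂ => t⁻¹) s := analyticAt_inv hs
    have h2 : AnalyticAt ℂ (fun t : ℂ => ω t⁻¹ i) s :=
      AnalyticAt.fun_comp (g := fun t => ω t i) (h.analyticAt i) h1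
    exact analyticAt_id.fun_mul h2
  · have h1 : Tendsto (fun t : ℂ => t⁻¹) (𝓝 s) (𝓝 s⁻¹) := tendsto_inv₀ hs
    filter_upwards [h1.eventually h.eventually, eventually_ne_nhds hs] with t ht ht0
    have := hR.smul ht t
    rwa [smul_add, smul_smul, mul_inv_cancel₀ ht0, one_smul, add_comm] at this

theorem velocity_inv_smul {u v : ι → ℂ} (hs : s ≠ 0) (h : IsLocalLift R u v ω s⁻¹) :
    velocity (fun t => t • ω t⁻¹) s = ω s⁻¹ - s⁻¹ • velocity ω s⁻¹ := by
  ext i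
  have h1 : HasDerivAt (fun t : ℂ => t⁻¹) (-(s ^ 2)⁻¹) s := hasDerivAt_inv hs
  have h2 : HasDerivAt (fun t : ℂ => ω t i) (velocity ω s⁻¹ i) s⁻¹ :=
    (h.analyticAt i).differentiableAt.hasDerivAt
  have h3 := (hasDerivAt_id s).mul (h2.comp s h1)
  refine (h3.congr_deriv ?_).deriv
  simp only [Function.comp, id, Pi.sub_apply, Pi.smul_apply, smul_eq_mul]
  field_simp
  ring

end IsLocalLift

theorem eventually_eq_of_deriv_eq_zero {f : ℂ → ℂ} {z : ℂ} (hf : AnalyticAt ℂ f z)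
    (h : ∀ᶠ t in 𝓝 z, deriv f t = 0) : ∀ᶠ t in 𝓝 z, f t = f z := by
  obtain ⟨r, hr, hball⟩ := Metric.eventually_nhds_iff_ball.1 (h.and hf.eventually_analyticAt)
  filter_upwards [Metric.ball_mem_nhds z hr] with t ht
  exact Metric.isOpen_ball.is_const_of_deriv_eq_zero (convex_ball z r).isPreconnected
    (fun x hx => (hball x hx).2.differentiableAt.differentiableWithinAt)
    (fun x hx => (hball x hx).1) ht (Metric.mem_ball_self hr)

/-- A holomorphic solution of `f = c + t f'` near `0` is affine. -/
theorem eventually_affine_of_eq {f : ℂ → ℂ} {c : ℂ} (hf : AnalyticAt ℂ f 0)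
    (h : ∀ᶠ t in 𝓝 0, f t - t * deriv f t = c) : ∀ᶠ t in 𝓝 0, f t = c + t * deriv f 0 := by
  have h1 : ∀ᶠ t in 𝓝[≠] (0 : ℂ), deriv (deriv f) t = 0 := by
    have h2 : ∀ᶠ t in 𝓝[≠] (0 : ℂ), (∀ᶠ x in 𝓝 t, f x - x * deriv f x = c) ∧
        AnalyticAt ℂ f t := by
      refine Filter.Eventually.filter_mono nhdsWithin_le_nhds ?_
      exact h.eventually_nhds.and hf.eventually_analyticAt
    filter_upwards [h2, self_mem_nhdsWithin] with t ⟨ht, hft⟩ ht0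
    have h3 : HasDerivAt (fun x => f x - x * deriv f x)
        (deriv f t - (1 * deriv f t + t * deriv (deriv f) t)) t :=
      hft.differentiableAt.hasDerivAt.fun_sub
        ((hasDerivAt_id t).fun_mul hft.deriv.differentiableAt.hasDerivAt)
    have h4 : deriv (fun x => f x - x * deriv f x) t = 0 := by
      rw [Filter.EventuallyEq.deriv_eq (f := fun _ => c) ht, deriv_const]
    rw [h3.deriv] at h4
    have h5 : t * deriv (deriv f) t = 0 := by linear_combination -h4
    exact (mul_eq_zero.1 h5).resolve_left ht0
  have h2 : ∀ᶠ t in 𝓝 (0 : ℂ), deriv (deriv f) t = 0 :=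
    (hf.deriv.deriv.frequently_eq_iff_eventually_eq analyticAt_const).1 h1.frequently
  filter_upwards [h, eventually_eq_of_deriv_eq_zero hf.deriv h2] with t ht ht'
  rw [ht'] at ht
  linear_combination ht

namespace OrbitCorrespondence

/-- If local lifts exist everywhere along a line, the lift near infinity has constant velocity. -/
theorem eval_sub_smul_velocity_eq (hR : OrbitCorrespondence ρ σ R) {u v : ι → ℂ} {B : κ → ℂ}
    (hlift : ∀ (s : ℂ) w, R (v + s • u) w → ∃ ω, IsLocalLift R v u ω s ∧ ω s = w)
    {ω : ℂ → κ → ℂ} (hω : IsLocalLift R u v ω 0) (hω0 : ω 0 = B) {f : MvPolynomial κ ℂ}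
    (hf : IsInv σ f) {ε : ℂ} (hε0 : ε ≠ 0) (hε : IsLocalLift R u v ω ε) :
    eval (ω ε - ε • velocity ω ε) f = eval B f := by
  have hex : ∀ s : ℂ, ∃ ω, IsLocalLift R v u ω s := fun s => by
    obtain ⟨w, hw⟩ := hR.exists_right (v + s • u)
    obtain ⟨ω, h, -⟩ := hlift s w hw
    exact ⟨ω, h⟩
  choose η hη using hex
  -- The choice of lift at each `s` is arbitrary; invariance of `f` makes `T` independent of it, so
  -- one lift computes `T` on a whole neighbourhood.
  let T : ℂ → ℂ := fun s => eval (velocity (η s) s) f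
  have hT : ∀ {ω s}, IsLocalLift R v u ω s → T s = eval (velocity ω s) f := fun h =>
    IsLocalLift.eval_velocity_eq hR h (hη _) hf
  have hdiff : Differentiable ℂ T := by
    intro s
    have h1 := (hη s).analyticAt_eval_velocity f
    refine (h1.congr ?_).differentiableAt
    filter_upwards [(hη s).eventually_isLocalLift] with t ht
    exact (hT ht).symm
  let Θ : ℂ → ℂ := fun ε => eval (ω ε - ε • velocity ω ε) f
  have hΘ : ContinuousAt Θ 0 := by
    refine (analyticAt_eval_comp f fun i => ?_).continuousAt
    simp only [Pi.sub_apply, Pi.smul_apply, smul_eq_mul]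
    exact (hω.analyticAt i).fun_sub (analyticAt_id.fun_mul (hω.analyticAt i).deriv)
  have hΘ0 : Θ 0 = eval B f := by simp [Θ, hω0]
  have hTΘ : ∀ {ε : ℂ}, ε ≠ 0 → IsLocalLift R u v ω ε → T ε⁻¹ = Θ ε := by
    intro ε hε0 hε
    have h1 : IsLocalLift R u v ω (ε⁻¹)⁻¹ := by rwa [inv_inv]
    rw [hT (h1.inv_smul hR (inv_ne_zero hε0)), IsLocalLift.velocity_inv_smul (inv_ne_zero hε0) h1,
      inv_inv]
  -- Near infinity `T` is computed by the single lift obtained from `ω` by inversion of the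
  -- parameter.
  have hlim : Tendsto T (cocompact ℂ) (𝓝 (eval B f)) := by
    rw [← hΘ0]
    have h1 : Tendsto (fun s : ℂ => Θ s⁻¹) (cocompact ℂ) (𝓝 (Θ 0)) :=
      hΘ.tendsto.comp (tendsto_inv₀_cobounded.mono_left (Metric.cobounded_eq_cocompact (α := ℂ)).ge)
    refine h1.congr' ?_
    have h2 : Tendsto (fun s : ℂ => s⁻¹) (cocompact ℂ) (𝓝 0) :=
      tendsto_inv₀_cobounded.mono_left (Metric.cobounded_eq_cocompact (α := ℂ)).ge
    have h3 : ∀ᶠ s : ℂ in cocompact ℂ, s ≠ 0 := by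
      have := (isCompact_singleton (x := (0 : ℂ))).compl_mem_cocompact
      filter_upwards [this] with s hs using hs
    filter_upwards [h2.eventually hω.eventually_isLocalLift, h3] with s hs hs0
    rw [← hTΘ (inv_ne_zero hs0) hs, inv_inv]
  change Θ ε = _
  rw [← hTΘ hε0 hε]
  exact hdiff.apply_eq_of_tendsto_cocompact _ hlim

/-- Two lines which correspond to each other at infinitely many parameters do so everywhere. -/
theorem of_infinite (hR : OrbitCorrespondence ρ σ R) {u v : ι → ℂ} {B A : κ → ℂ}
    (h : {ε : ℂ | R (u + ε • v) (B + ε • A)}.Infinite) (ε : ℂ) :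
    R (u + ε • v) (B + ε • A) := by
  obtain ⟨w, hw⟩ := hR.exists_right (u + ε • v)
  refine (hR.right_iff hw).2 (exists_act_eq_of_eval_eq σ fun b hb => ?_)
  obtain ⟨a, ha⟩ := hR.pull hb
  have h1 : restrictLine a u v = restrictLine b B A :=
    Polynomial.eq_of_infinite_eval_eq _ _ (h.mono fun t ht => by
      simpa only [Set.mem_ofPred_eq, eval_restrictLine] using ha _ _ ht)
  rw [← ha _ _ hw, ← eval_restrictLine, ← eval_restrictLine, h1]

/-- If local lifts exist everywhere along a line, then the plane spanned by it lifts linearly. -/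
theorem exists_affine_lift (hR : OrbitCorrespondence ρ σ R) {u v : ι → ℂ} {B : κ → ℂ}
    (hB : R u B) (hst : ∀ h, act σ h B = B → h = 1)
    (hlift : ∀ (s : ℂ) w, R (v + s • u) w → ∃ ω, IsLocalLift R v u ω s ∧ ω s = w) :
    ∃ A, ∀ ε : ℂ, R (u + ε • v) (B + ε • A) := by
  obtain ⟨ω, hω, hω0⟩ := hR.exists_localLift_of_stab_eq_bot (a := u) (b := v) (s₀ := 0)
    (by simpa using hB) hst
  let θ : ℂ → κ → ℂ := fun ε => ω ε - ε • velocity ω ε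
  have hθ : ∀ᶠ ε in 𝓝[≠] (0 : ℂ), θ ε = B := by
    have h1 : ∀ᶠ ε in 𝓝[≠] (0 : ℂ), ∃ h, θ ε = act σ h B := by
      filter_upwards [hω.eventually_isLocalLift.filter_mono nhdsWithin_le_nhds,
        self_mem_nhdsWithin] with ε hε hε0
      exact exists_act_eq_of_eval_eq σ fun f hf =>
        hR.eval_sub_smul_velocity_eq hlift hω hω0 hf hε0 hε
    have h2 : ContinuousAt θ 0 := by
      refine continuousAt_pi.2 fun i => AnalyticAt.continuousAt (𝕜 := ℂ) ?_
      exact (hω.analyticAt i).fun_sub (analyticAt_id.fun_mul (hω.analyticAt i).deriv)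
    -- The orbit of `B` is finite and `θ` is continuous with value `B` at `0`, so near `0` it avoids
    -- the other orbit points.
    have h3 : ∀ᶠ ε in 𝓝 (0 : ℂ), ∀ h, act σ h B ≠ B → θ ε ≠ act σ h B := by
      refine eventually_all.2 fun h => ?_
      by_cases hh : act σ h B = B
      · exact Eventually.of_forall fun _ h => absurd hh h
      · refine (h2.eventually_ne ?_).mono fun _ h _ => h
        simpa [θ, hω0] using Ne.symm hh
    filter_upwards [h1, h3.filter_mono nhdsWithin_le_nhds] with ε hε hε'
    obtain ⟨h, hh⟩ := hε
    by_contra hne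
    exact hε' h (fun h0 => hne (hh.trans h0)) hh
  have hθ' : ∀ᶠ ε in 𝓝 (0 : ℂ), θ ε = B := by
    have h2 : θ 0 = B := by simp [θ, hω0]
    rw [eventually_nhdsWithin_iff] at hθ
    filter_upwards [hθ] with ε hε
    by_cases h0 : ε = 0
    · rw [h0, h2]
    · exact hε h0
  refine ⟨velocity ω 0, hR.of_infinite (infinite_of_mem_nhds (0 : ℂ) ?_)⟩
  have h3 : ∀ᶠ ε in 𝓝 (0 : ℂ), ∀ i, ω ε i = B i + ε * deriv (fun t => ω t i) 0 := by
    refine eventually_all.2 fun i => eventually_affine_of_eq (hω.analyticAt i) ?_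
    filter_upwards [hθ'] with ε hε
    exact congrFun hε i
  filter_upwards [hω.eventually, h3] with ε hε hε'
  have h4 : B + ε • velocity ω 0 = ω ε := _root_.funext fun i => (hε' i).symm
  rwa [h4]

end OrbitCorrespondence

end QuotientLift
end

/-! ### Assembling the affine lifts into a linear isomorphism. -/

noncomputable section

namespace QuotientLift

open MvPolynomial Matrix Topology Filter

set_option linter.unusedSectionVars false

variable {ι κ : Type*} [Fintype ι] [DecidableEq ι] [Fintype κ] [DecidableEq κ]
  {G H : Type*} [Group G] [Group H] [Finite G] [Finite H]
  {ρ : G →* Matrix ι ι ℝ} {σ : H →* Matrix κ κ ℝ} {R : (ι → ℂ) → (κ → ℂ) → Prop}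

theorem hasDerivAt_eval_line (f : MvPolynomial ι ℂ) (x ξ : ι → ℂ) :
    HasDerivAt (fun t : ℂ => eval (x + t • ξ) f) (dirDeriv f x ξ) 0 := by
  have h := hasDerivAt_eval_comp f (γ := fun t : ℂ => x + t • ξ) (γ' := ξ) (s := 0) fun i => by
    simpa using ((hasDerivAt_id (0 : ℂ)).mul_const (ξ i)).const_add (x i)
  simpa using h

theorem dirDeriv_eq {f : MvPolynomial ι ℂ} {x ξ : ι → ℂ} {c : ℂ}
    (h : HasDerivAt (fun t : ℂ => eval (x + t • ξ) f) c 0) : dirDeriv f x ξ = c :=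
  (hasDerivAt_eval_line f x ξ).unique h

theorem dirDeriv_mul (f g : MvPolynomial ι ℂ) (x ξ : ι → ℂ) :
    dirDeriv (f * g) x ξ = dirDeriv f x ξ * eval x g + eval x f * dirDeriv g x ξ := by
  refine dirDeriv_eq ?_
  have h := (hasDerivAt_eval_line f x ξ).fun_mul (hasDerivAt_eval_line g x ξ)
  simpa using h

/-- The differentials of the invariants at a point with trivial isotropy group are jointly
injective. -/
theorem eq_zero_of_dirDeriv_eq_zero {B ξ : κ → ℂ} (hst : ∀ h, act σ h B = B → h = 1)
    (h : ∀ b, IsInv σ b → dirDeriv b B ξ = 0) : ξ = 0 := by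
  classical
  let := Fintype.ofFinite H
  by_contra hξ
  obtain ⟨i, hi⟩ := Function.ne_iff.1 hξ
  obtain ⟨α, -, hα0, hα1⟩ := exists_isInvOn_stab_separating σ B
  let γ : MvPolynomial κ ℂ := ∏ g ∈ Finset.univ.erase (1 : H), (α - C (eval (act σ g B) α))
  -- The factor `γ` vanishes at every other orbit point of `B` but not at `B`. Its square makes the
  -- differential of `f` vanish at those points, so after averaging over the group only the term at
  -- `B` contributes, a nonzero multiple of `ξ i`.
  let f : MvPolynomial κ ℂ := (X i - C (B i)) * (γ * γ)
  have hγB : eval B γ ≠ 0 := by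
    rw [prod_eval_ne_zero_iff]
    intro g hg
    rw [map_sub, hα0, eval_C, zero_sub, neg_ne_zero]
    exact hα1 g fun h => Finset.ne_of_mem_erase hg (hst g h)
  have hγ : ∀ g, g ≠ 1 → eval (act σ g B) γ = 0 := fun g hg => by
    rw [map_prod]
    exact Finset.prod_eq_zero (Finset.mem_erase.2 ⟨hg, Finset.mem_univ _⟩) (by simp)
  have hinv : IsInv σ (∑ g, pullback (act σ g) f) := by
    intro g v
    simp only [map_sum, eval_pullback, ← act_mul]
    exact Fintype.sum_equiv (Equiv.mulRight g) _ _ fun _ => rfl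
  have hsum : dirDeriv (∑ g, pullback (act σ g) f) B ξ =
      ∑ g, dirDeriv f (act σ g B) (act σ g ξ) := by
    refine dirDeriv_eq ?_
    simp only [map_sum, eval_pullback, map_add, map_smul]
    exact HasDerivAt.fun_sum fun g _ => hasDerivAt_eval_line f _ _
  have h1 := h _ hinv
  rw [hsum, Finset.sum_eq_single 1] at h1
  · rw [act_one, act_one, dirDeriv_mul] at h1
    have h2 : dirDeriv (X i - C (B i)) B ξ = ξ i := by
      refine dirDeriv_eq ?_
      simpa using (hasDerivAt_id (0 : ℂ)).mul_const (ξ i)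
    rw [h2] at h1
    simp only [map_sub, eval_X, eval_C, sub_self, zero_mul, add_zero, map_mul] at h1
    exact mul_ne_zero hi (mul_ne_zero hγB hγB) h1
  · intro g _ hg
    rw [dirDeriv_mul, dirDeriv_mul, map_mul, hγ g hg]
    ring
  · simp

namespace OrbitCorrespondence

/-- Pairs of tangent vectors which are compatible with all invariants. -/
def tangentRel (σ : H →* Matrix κ κ ℝ) (R : (ι → ℂ) → (κ → ℂ) → Prop)
    (u : ι → ℂ) (B : κ → ℂ) :
    Submodule ℂ ((ι → ℂ) × (κ → ℂ)) where
  carrier := {x | ∀ a b, IsInv σ b → (∀ v w, R v w → eval v a = eval w b) →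
    dirDeriv a u x.1 = dirDeriv b B x.2}
  zero_mem' a b _ _ := by simp
  add_mem' hx hy a b hb h := by
    rw [Prod.fst_add, Prod.snd_add, map_add, map_add, hx a b hb h, hy a b hb h]
  smul_mem' c x hx a b hb h := by
    rw [Prod.smul_fst, Prod.smul_snd, map_smul, map_smul, hx a b hb h]

theorem mem_tangentRel {u v : ι → ℂ} {B A : κ → ℂ} (h : ∀ ε : ℂ, R (u + ε • v) (B + ε • A)) :
    (v, A) ∈ tangentRel σ R u B := by
  intro a b _ hab
  refine dirDeriv_eq ?_
  have h1 : (fun t : ℂ => eval (u + t • v) a) = fun t : ℂ => eval (B + t • A) b :=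
    _root_.funext fun t => hab _ _ (h t)
  rw [h1]
  exact hasDerivAt_eval_line b B A

/-- An orbit correspondence is induced by a linear map. -/
theorem exists_linearMap (hR : OrbitCorrespondence ρ σ R) :
    ∃ F : (ι → ℂ) →ₗ[ℂ] (κ → ℂ), ∀ v, R v (F v) := by
  obtain ⟨f1, hf1, hu1⟩ := hR.exists_generic_stab_eq_bot
  obtain ⟨f2, hf2, hu2⟩ := exists_generic_direction ρ
  obtain ⟨u, hu⟩ := exists_eval_ne_zero (mul_ne_zero hf1 hf2)
  rw [map_mul, mul_ne_zero_iff] at hu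
  obtain ⟨B, hB⟩ := hR.exists_right u
  have hst := hu1 u hu.1 B hB
  obtain ⟨f, hf, hline⟩ := hR.exists_generic_line (hu2 u hu.2)
  have hgood : ∀ v, eval v f ≠ 0 → ∃ A, ∀ ε : ℂ, R (u + ε • v) (B + ε • A) :=
    fun v hv => hR.exists_affine_lift hB hst (hline v hv)
  -- This subspace is the graph of `F`: its projection to the first factor is injective because
  -- differentials of invariants at `B` are jointly injective, and surjective because the good
  -- directions span.
  set T := tangentRel σ R u B
  have hinj : Function.Injective (LinearMap.fst ℂ (ι → ℂ) (κ → ℂ) ∘ₗ T.subtype) := by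
    rw [← LinearMap.ker_eq_bot, LinearMap.ker_eq_bot']
    rintro ⟨⟨x, ξ⟩, hx⟩ h0
    have hx0 : x = 0 := h0
    subst hx0
    have : ξ = 0 := eq_zero_of_dirDeriv_eq_zero hst fun b hb => by
      obtain ⟨a, ha⟩ := hR.pull hb
      have := hx a b hb ha
      rw [← this, map_zero]
    subst this
    rfl
  have hsurj : Function.Surjective (LinearMap.fst ℂ (ι → ℂ) (κ → ℂ) ∘ₗ T.subtype) := by
    rw [← LinearMap.range_eq_top, eq_top_iff, ← span_eval_ne_zero hf, Submodule.span_le]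
    intro v hv
    obtain ⟨A, hA⟩ := hgood v hv
    exact ⟨⟨(v, A), mem_tangentRel hA⟩, rfl⟩
  let e := LinearEquiv.ofBijective _ ⟨hinj, hsurj⟩
  let F : (ι → ℂ) →ₗ[ℂ] (κ → ℂ) := LinearMap.snd ℂ _ _ ∘ₗ T.subtype ∘ₗ e.symm.toLinearMap
  have hF : ∀ v, eval v f ≠ 0 → R (u + v) (B + F v) := by
    intro v hv
    obtain ⟨A, hA⟩ := hgood v hv
    have h1 : e ⟨(v, A), mem_tangentRel hA⟩ = v := rfl
    have h2 : F v = A := by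
      have : e.symm v = ⟨(v, A), mem_tangentRel hA⟩ := by rw [LinearEquiv.symm_apply_eq, h1]
      simp only [F, LinearMap.comp_apply, LinearEquiv.coe_coe, this]
      rfl
    rw [h2]
    simpa using hA 1
  have hF' : ∀ v, R (u + v) (B + F v) := by
    intro v
    obtain ⟨w, hw⟩ := hR.exists_right (u + v)
    refine (hR.right_iff hw).2 (exists_act_eq_of_eval_eq σ fun b hb => ?_)
    obtain ⟨a, ha⟩ := hR.pull hb
    have h1 : aeval (fun i => X i + C (u i)) a =
        pullback F (aeval (fun i => X i + C (B i)) b) := by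
      refine eq_of_eval_eq_of_ne_zero hf fun v hv => ?_
      rw [eval_aeval_X_add_C, eval_pullback, eval_aeval_X_add_C, add_comm, add_comm (F v)]
      exact ha _ _ (hF v hv)
    have h2 := congrArg (eval v) h1
    rw [eval_aeval_X_add_C, eval_pullback, eval_aeval_X_add_C, add_comm, add_comm (F v)] at h2
    rw [← h2, ha _ _ hw]
  refine ⟨F, fun v => ?_⟩
  -- For `ε ≠ 0` this is `hF'` at `ε⁻¹ v` scaled by `ε`; the value `ε = 0` follows by polynomial
  -- continuation.
  have h1 : ∀ ε : ℂ, R (v + ε • u) (F v + ε • B) := by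
    refine hR.of_infinite ((Set.finite_singleton (0 : ℂ)).infinite_compl.mono fun ε hε => ?_)
    have hε0 : ε ≠ 0 := hε
    have := hR.smul (hF' (ε⁻¹ • v)) ε
    rwa [map_smul, smul_add, smul_add, smul_smul, smul_smul, mul_inv_cancel₀ hε0, one_smul,
      one_smul, add_comm, add_comm (ε • B)] at this
  simpa using h1 0

theorem eq_zero_of_rel_zero (hR : OrbitCorrespondence ρ σ R) {v : ι → ℂ} (h : R v 0) : v = 0 := by
  have h0 : R 0 0 := by simpa using hR.smul h 0
  obtain ⟨g, hg⟩ := (hR.left_iff h0).1 h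
  rw [hg, map_zero]

theorem injective_of_rel (hR : OrbitCorrespondence ρ σ R) {F : (ι → ℂ) →ₗ[ℂ] (κ → ℂ)}
    (hF : ∀ v, R v (F v)) : Function.Injective F := by
  rw [← LinearMap.ker_eq_bot, LinearMap.ker_eq_bot']
  intro v hv
  have := hF v
  rw [hv] at this
  exact hR.eq_zero_of_rel_zero this

/-- An orbit correspondence is induced by a linear isomorphism. -/
theorem exists_linearEquiv (hR : OrbitCorrespondence ρ σ R) :
    ∃ F : (ι → ℂ) ≃ₗ[ℂ] (κ → ℂ), ∀ v, R v (F v) := by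
  obtain ⟨F, hF⟩ := hR.exists_linearMap
  obtain ⟨F', hF'⟩ := hR.symm.exists_linearMap
  have h1 := hR.injective_of_rel hF
  have h2 := hR.symm.injective_of_rel hF'
  have hdim := le_antisymm (LinearMap.finrank_le_finrank_of_injective h1)
    (LinearMap.finrank_le_finrank_of_injective h2)
  exact ⟨LinearEquiv.ofInjectiveOfFinrankEq F h1 hdim, hF⟩

end OrbitCorrespondence

end QuotientLift
end

noncomputable section

namespace QuotientLift

open MvPolynomial Matrix

set_option linter.unusedSectionVars false

/-! ### Krull dimension under integral maps. -/

section KrullDimension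

/-- Lying over and going up lift chains of primes from `A` to `B`; incomparability keeps chains
strict when contracted from `B` to `A`. -/
theorem ringKrullDim_eq_of_isIntegral_of_injective {A B : Type*} [CommRing A] [CommRing B]
    [Algebra A B] [Algebra.IsIntegral A B] (h : Function.Injective (algebraMap A B)) :
    ringKrullDim A = ringKrullDim B := by
  refine le_antisymm (iSup_le fun l => ?_) ?_
  · have : FaithfulSMul A B := (faithfulSMul_iff_algebraMap_injective A B).2 h
    obtain ⟨P, -, hP, hlo⟩ := Ideal.exists_ideal_over_prime_of_isIntegral l.head.asIdeal
      (⊥ : Ideal B) (by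
        rw [← RingHom.ker_eq_comap_bot, (RingHom.injective_iff_ker_eq_bot _).1 h]
        exact bot_le)
    have : P.LiesOver l.head.asIdeal := ⟨hlo.symm⟩
    obtain ⟨L, hL, -⟩ := Ideal.exists_ltSeries_of_hasGoingUp l P
    rw [← hL]
    exact Order.LTSeries.length_le_krullDim L
  · exact Order.krullDim_le_of_strictMono (PrimeSpectrum.comap (algebraMap A B)) fun I J hIJ =>
      Ideal.IsIntegral.comap_lt_comap hIJ

theorem ringKrullDim_quotient_ker {A B : Type*} [CommRing A] [CommRing B] {φ : A →+* B}
    (hφ : φ.IsIntegral) : ringKrullDim (A ⧸ RingHom.ker φ) = ringKrullDim B := by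
  algebraize [RingHom.kerLift φ]
  have : Algebra.IsIntegral (A ⧸ RingHom.ker φ) B := by
    refine ⟨?_⟩
    exact RingHom.IsIntegral.tower_top (Ideal.Quotient.mk _) (RingHom.kerLift φ) hφ
  exact ringKrullDim_eq_of_isIntegral_of_injective (RingHom.kerLift_injective φ)

theorem zariskiDim_eq_card {m : ℕ} {μ : Type*} [Finite μ] {S : Set (Fin m → ℂ)}
    {φ : MvPolynomial (Fin m) ℂ →+* MvPolynomial μ ℂ} (hφ : φ.IsIntegral)
    (h : ∀ Q, φ Q = 0 ↔ ∀ x ∈ S, eval x Q = 0) : zariskiDim S = Nat.card μ := by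
  have : vanishingIdeal ℂ S = RingHom.ker φ := by
    ext Q
    rw [RingHom.mem_ker, h]
    rfl
  rw [zariskiDim, this, ringKrullDim_quotient_ker hφ,
    MvPolynomial.ringKrullDim_of_isNoetherianRing, ringKrullDim_eq_zero_of_field, zero_add]

end KrullDimension

/-! ### Integrality over invariants and dimensions of images of linear spaces. -/

section Invariants

variable {ι : Type*} [Fintype ι] [DecidableEq ι] {G : Type*} [Group G] [Finite G]
  {ρ : G →* Matrix ι ι ℝ}

theorem isInv_iff_pullback {f : MvPolynomial ι ℂ} :
    IsInv ρ f ↔ ∀ g, pullback (act ρ g) f = f := by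
  refine forall_congr' fun g => ⟨fun h => MvPolynomial.funext fun v => ?_, fun h v => ?_⟩
  · rw [eval_pullback, h]
  · rw [← eval_pullback, h]

/-- Every polynomial is integral over a subalgebra containing all invariants of a finite group. -/
theorem isIntegral_aeval {m : ℕ} {c : Fin m → MvPolynomial ι ℂ}
    (hc : ∀ f, IsInv ρ f → ∃ S : MvPolynomial (Fin m) ℂ, aeval c S = f) :
    ((aeval c : MvPolynomial (Fin m) ℂ →ₐ[ℂ] MvPolynomial ι ℂ) :
      MvPolynomial (Fin m) ℂ →+* MvPolynomial ι ℂ).IsIntegral := by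
  classical
  let := Fintype.ofFinite G
  intro f
  -- This monic polynomial has `f` as a root, and its coefficients are invariant because the group
  -- permutes the factors.
  let P : Polynomial (MvPolynomial ι ℂ) :=
    ∏ g : G, (Polynomial.X - Polynomial.C (pullback (act ρ g) f))
  have hP : P.Monic := Polynomial.monic_prod_of_monic _ _ fun g _ => Polynomial.monic_X_sub_C _
  have hmul (h g : G) : pullback (act ρ h) (pullback (act ρ g) f) = pullback (act ρ (g * h)) f :=
    MvPolynomial.funext fun v => by simp only [eval_pullback, act_mul]
  have hinv : ∀ h, P.map (pullback (act ρ h) : MvPolynomial ι ℂ →+* MvPolynomial ι ℂ) = P := by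
    intro h
    simp only [P, Polynomial.map_prod, Polynomial.map_sub, Polynomial.map_X, Polynomial.map_C,
      RingHom.coe_coe, hmul]
    exact Equiv.prod_comp (Equiv.mulRight h)
      fun g => Polynomial.X - Polynomial.C (pullback (act ρ g) f)
  have hl : P ∈ Polynomial.lifts ((aeval c : MvPolynomial (Fin m) ℂ →ₐ[ℂ] MvPolynomial ι ℂ) :
      MvPolynomial (Fin m) ℂ →+* MvPolynomial ι ℂ) := by
    rw [Polynomial.lifts_iff_coeff_lifts]
    intro k
    obtain ⟨S, hS⟩ := hc (P.coeff k) (isInv_iff_pullback.2 fun h => by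
      have := congrArg (fun q => q.coeff k) (hinv h)
      simpa using this)
    exact ⟨S, hS⟩
  obtain ⟨q, hq, -, hqm⟩ := Polynomial.lifts_and_natDegree_eq_and_monic hl hP
  refine ⟨q, hqm, ?_⟩
  rw [← Polynomial.eval_map, hq, Polynomial.eval_prod]
  refine Finset.prod_eq_zero (Finset.mem_univ 1) ?_
  have h1 : pullback (act ρ 1) f = f := MvPolynomial.funext fun v => by simp
  simp [h1]

theorem pullback_surjective {μ : Type*} [Fintype μ] [DecidableEq μ]
    {L : (μ → ℂ) →ₗ[ℂ] (ι → ℂ)} (hL : Function.Injective L) :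
    Function.Surjective (pullback L) := by
  obtain ⟨L', hL'⟩ := L.exists_leftInverse_of_injective (LinearMap.ker_eq_bot.2 hL)
  refine fun f => ⟨pullback L' f, MvPolynomial.funext fun v => ?_⟩
  rw [eval_pullback, eval_pullback, ← LinearMap.comp_apply, hL', LinearMap.id_apply]

/-- The map with given polynomial components. -/
def evalMap {m : ℕ} (c : Fin m → MvPolynomial ι ℂ) (v : ι → ℂ) : Fin m → ℂ := fun i => eval v (c i)

theorem eval_evalMap {m : ℕ} (c : Fin m → MvPolynomial ι ℂ) (v : ι → ℂ)
    (Q : MvPolynomial (Fin m) ℂ) : eval (evalMap c v) Q = eval v (aeval c Q) := by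
  induction Q using MvPolynomial.induction_on with
  | C a => simp
  | add p q hp hq => simp only [map_add, hp, hq]
  | mul_X p k hp => simp only [map_mul, hp, eval_X, aeval_X, evalMap]

/-- The vanishing ideal is the kernel of the composite of evaluation at the generators, which is
integral, and restriction to the subspace, which is surjective. -/
theorem zariskiDim_of_linear {m : ℕ} {c : Fin m → MvPolynomial ι ℂ}
    (hc : ∀ f, IsInv ρ f → ∃ S : MvPolynomial (Fin m) ℂ, aeval c S = f) {μ : Type*} [Fintype μ] [DecidableEq μ]
    {L : (μ → ℂ) →ₗ[ℂ] (ι → ℂ)} (hL : Function.Injective L) {S : Set (Fin m → ℂ)}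
    (hS : ∀ Q : MvPolynomial (Fin m) ℂ,
      (∀ x ∈ S, eval x Q = 0) ↔ ∀ z, eval (evalMap c (L z)) Q = 0) :
    zariskiDim S = Fintype.card μ := by
  rw [← Nat.card_eq_fintype_card]
  refine zariskiDim_eq_card (φ := ((pullback L : MvPolynomial ι ℂ →ₐ[ℂ] MvPolynomial μ ℂ) :
    MvPolynomial ι ℂ →+* MvPolynomial μ ℂ).comp (aeval c :
      MvPolynomial (Fin m) ℂ →ₐ[ℂ] MvPolynomial ι ℂ)) ?_ fun Q => ?_
  · exact (isIntegral_aeval hc).trans _ _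
      (RingHom.isIntegral_of_surjective _ (pullback_surjective hL))
  · rw [hS]
    constructor
    · intro h z
      rw [eval_evalMap, ← eval_pullback]
      have : pullback L (aeval c Q) = 0 := h
      rw [this, map_zero]
    · intro h
      refine MvPolynomial.funext fun z => ?_
      have : eval z (pullback L (aeval c Q)) = 0 := by rw [eval_pullback, ← eval_evalMap, h]
      simpa using this

end Invariants

end QuotientLift

end

noncomputable section

namespace QuotientLift

open MvPolynomial Matrix

set_option linter.unusedSectionVars false

/-! ### Codimension one strata and reflection hyperplanes. -/

section Strata

variable {ι : Type*} [Fintype ι] [DecidableEq ι] {G : Type*} [Group G]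
  {ρ : G →* Matrix ι ι ℝ}

theorem exists_row_dotProduct_ne_zero {g : G} {v : ι → ℂ} (h : act ρ g v ≠ v) :
    ∃ i, toC ((1 - ρ g) i) ⬝ᵥ v ≠ 0 := by
  contrapose! h
  ext i
  have := h i
  simp only [dotProduct, toC, Matrix.sub_apply, Complex.ofReal_sub, sub_mul,
    Finset.sum_sub_distrib, sub_eq_zero] at this
  simp only [act, mulVecLin_apply, mulVec, dotProduct, Matrix.map_apply]
  refine Eq.trans this.symm ?_
  simp [Matrix.one_apply, apply_ite Complex.ofReal]

theorem exists_linearMap_range_eq (U : Submodule ℂ (ι → ℂ)) :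
    ∃ L : (Fin (Module.finrank ℂ U) → ℂ) →ₗ[ℂ] (ι → ℂ), Function.Injective L ∧
      ∀ w, w ∈ U ↔ ∃ z, L z = w := by
  let e := (Module.finBasis ℂ U).equivFun
  refine ⟨U.subtype ∘ₗ e.symm.toLinearMap, ?_, fun w => ⟨fun hw => ⟨e ⟨w, hw⟩, by simp⟩, ?_⟩⟩
  · exact Subtype.val_injective.comp e.symm.injective
  · rintro ⟨z, rfl⟩
    exact (e.symm z).2

/-- The points of a subspace whose isotropy group is as small as possible are dense in the
subspace. -/
theorem eval_eq_zero_of_generic [Finite G] (U : Submodule ℂ (ι → ℂ)) {f : MvPolynomial ι ℂ}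
    (hf : ∀ w ∈ U, (∀ k, act ρ k w = w → ∀ u ∈ U, act ρ k u = u) → eval w f = 0) :
    ∀ w ∈ U, eval w f = 0 := by
  classical
  let := Fintype.ofFinite G
  obtain ⟨L, -, hL⟩ := exists_linearMap_range_eq U
  -- An element not fixing `U` pointwise yields a linear form nonzero on `U` but zero at all its
  -- fixed points.
  have hd : ∀ k : G, ∃ d : MvPolynomial ι ℂ, pullback L d ≠ 0 ∧
      ∀ w, act ρ k w = w → eval w d ≠ 0 → ∀ u ∈ U, act ρ k u = u := by
    intro k
    by_cases hk : ∀ u ∈ U, act ρ k u = u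
    · exact ⟨1, by simp, fun w _ _ => hk⟩
    · push Not at hk
      obtain ⟨u, hu, hne⟩ := hk
      obtain ⟨i, hi⟩ := exists_row_dotProduct_ne_zero hne
      refine ⟨linForm (toC ((1 - ρ k) i)), fun h0 => hi ?_, fun w hw hw' => ?_⟩
      · obtain ⟨z, rfl⟩ := (hL u).1 hu
        rw [← eval_linForm, ← eval_pullback, h0, map_zero]
      · rw [eval_linForm] at hw'
        exact absurd (row_dotProduct_of_act_eq ρ hw i) hw'
  choose d hd0 hd using hd
  have h0 : pullback L f = 0 := by
    refine eq_of_eval_eq_of_ne_zero (d := ∏ k, pullback L (d k))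
      (Finset.prod_ne_zero_iff.2 fun k _ => hd0 k) fun z hz => ?_
    rw [map_zero, eval_pullback]
    rw [prod_eval_ne_zero_iff] at hz
    refine hf _ ((hL _).2 ⟨z, rfl⟩) fun k hk => hd k _ hk ?_
    rw [← eval_pullback]
    exact hz k (Finset.mem_univ k)
  intro w hw
  obtain ⟨z, rfl⟩ := (hL w).1 hw
  rw [← eval_pullback, h0, map_zero]

variable (ρ) in
/-- The subspace of points fixed by the isotropy group of a point. -/
def fixSpace (v : ι → ℂ) : Submodule ℂ (ι → ℂ) where
  carrier := {w | ∀ k ∈ stab ρ v, act ρ k w = w}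
  zero_mem' k _ := map_zero _
  add_mem' {x y} hx hy k hk := by rw [map_add, hx k hk, hy k hk]
  smul_mem' t x hx k hk := by rw [map_smul, hx k hk]

theorem self_mem_fixSpace (v : ι → ℂ) : v ∈ fixSpace ρ v := fun _ hk => hk

variable (ρ) in
/-- The isotropy groups of two points are conjugate. -/
def SameStab (v w : ι → ℂ) : Prop := ∃ g, ∀ k, k ∈ stab ρ w ↔ g⁻¹ * k * g ∈ stab ρ v

variable {m : ℕ} {c : Fin m → MvPolynomial ι ℂ}

theorem evalMap_act (hc : ∀ i, IsInv ρ (c i)) (g : G) (v : ι → ℂ) :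
    evalMap c (act ρ g v) = evalMap c v := _root_.funext fun i => hc i g v

/-- Generic points of the fixed space have the same isotropy group as `v`, so they map into the
stratum; conversely the group moves every point of that isotropy type into the fixed space. -/
theorem forall_stratum_iff [Finite G] (hc : ∀ i, IsInv ρ (c i)) (v : ι → ℂ)
    (Q : MvPolynomial (Fin m) ℂ) :
    (∀ x ∈ evalMap c '' {w | SameStab ρ v w}, eval x Q = 0) ↔
      ∀ w ∈ fixSpace ρ v, eval (evalMap c w) Q = 0 := by
  constructor
  · intro h
    simp only [eval_evalMap]
    refine eval_eq_zero_of_generic (ρ := ρ) _ fun w hw hgen => ?_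
    rw [← eval_evalMap]
    refine h _ ⟨w, ⟨1, fun k => ?_⟩, rfl⟩
    rw [inv_one, one_mul, mul_one]
    exact ⟨fun hk => hgen k hk v (self_mem_fixSpace v), fun hk => hw k hk⟩
  · rintro h _ ⟨w, ⟨g, hg⟩, rfl⟩
    rw [← evalMap_act hc g⁻¹ w]
    refine h _ fun k hk => ?_
    have h1 : g * k * g⁻¹ ∈ stab ρ w := (hg _).2 (by simpa [mul_assoc] using hk)
    rw [mem_stab, act_mul, act_mul] at h1
    nth_rw 2 [← h1]
    rw [act_inv_act]

theorem zariskiDim_stratum [Finite G] (hc : ∀ i, IsInv ρ (c i))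
    (hgen : ∀ f, IsInv ρ f → ∃ S : MvPolynomial (Fin m) ℂ, aeval c S = f) (v : ι → ℂ) :
    zariskiDim (evalMap c '' {w | SameStab ρ v w}) = Module.finrank ℂ (fixSpace ρ v) := by
  obtain ⟨L, hinj, hL⟩ := exists_linearMap_range_eq (fixSpace ρ v)
  have := zariskiDim_of_linear hgen hinj (S := evalMap c '' {w | SameStab ρ v w}) fun Q => by
    rw [forall_stratum_iff hc]
    refine ⟨fun h z => h _ ((hL _).2 ⟨z, rfl⟩), fun h w hw => ?_⟩
    obtain ⟨z, rfl⟩ := (hL w).1 hw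
    exact h z
  rwa [Fintype.card_fin] at this

theorem zariskiDim_range [Finite G]
    (hgen : ∀ f, IsInv ρ f → ∃ S : MvPolynomial (Fin m) ℂ, aeval c S = f) :
    zariskiDim (Set.range (evalMap c)) = Fintype.card ι :=
  zariskiDim_of_linear hgen (L := LinearMap.id) Function.injective_id fun Q => by simp

theorem finrank_add_two_le {a b : ι → ℂ} (h : Indep a b) {U : Submodule ℂ (ι → ℂ)}
    (ha : ∀ w ∈ U, a ⬝ᵥ w = 0) (hb : ∀ w ∈ U, b ⬝ᵥ w = 0) :
    Module.finrank ℂ U + 2 ≤ Fintype.card ι := by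
  have ha0 : dotProductBilin ℂ ℂ a ≠ 0 := fun h0 => h.ne_zero_left <| by
    ext i
    simpa using DFunLike.congr_fun h0 (Pi.single i 1)
  have h1 := Module.Dual.finrank_ker_add_one_of_ne_zero (f := dotProductBilin ℂ ℂ a) ha0
  rw [Module.finrank_fintype_fun_eq_card] at h1
  have hlt : U < LinearMap.ker (dotProductBilin ℂ ℂ a) := by
    refine lt_of_le_of_ne (fun w hw => ha w hw) fun heq => ?_
    obtain ⟨i, j, hij⟩ := h
    have hx : a i • Pi.single j 1 - a j • Pi.single i 1 ∈ U := by
      rw [heq, LinearMap.mem_ker]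
      simp [mul_comm]
    have := hb _ hx
    rw [dotProduct_sub, dotProduct_smul, dotProduct_smul, dotProduct_single_one,
      dotProduct_single_one, smul_eq_mul, smul_eq_mul, sub_eq_zero] at this
    exact hij this
  have h2 := Submodule.finrank_lt_finrank_of_lt hlt
  omega

theorem onHyperplane_of_act {g : G} {v : ι → ℂ} (h : OnHyperplane ρ (act ρ g v)) :
    OnHyperplane ρ v := by
  obtain ⟨k, l, e, hr, hl⟩ := h
  have hr' := hr.conj (A := ρ g⁻¹) (B := ρ g) (by rw [← map_mul, inv_mul_cancel, map_one])
  rw [← map_mul, ← map_mul] at hr'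
  refine ⟨_, _, _, hr', ?_⟩
  rw [← act_eq_self_iff_of_isRefl hr', act_mul, act_mul, (act_eq_self_iff_of_isRefl hr _).2 hl,
    act_inv_act]

/-- The images of the reflection hyperplanes are the closures of the strata of codimension one. -/
theorem exists_stratum_iff_onHyperplane [Finite G] (hc : ∀ i, IsInv ρ (c i))
    (hgen : ∀ f, IsInv ρ f → ∃ S : MvPolynomial (Fin m) ℂ, aeval c S = f) (v : ι → ℂ) :
    (∃ v₀, zariskiDim (evalMap c '' {w | SameStab ρ v₀ w}) + 1 =
        zariskiDim (Set.range (evalMap c)) ∧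
      evalMap c v ∈ zariskiClosure (evalMap c '' {w | SameStab ρ v₀ w})) ↔ OnHyperplane ρ v := by
  have hmem : ∀ v₀, evalMap c v ∈ zariskiClosure (evalMap c '' {w | SameStab ρ v₀ w}) ↔
      ∀ Q : MvPolynomial (Fin m) ℂ, (∀ w ∈ fixSpace ρ v₀, eval (evalMap c w) Q = 0) →
        eval (evalMap c v) Q = 0 := fun v₀ =>
    forall_congr' fun Q => imp_congr (forall_stratum_iff hc v₀ Q) Iff.rfl
  simp only [hmem, zariskiDim_stratum hc hgen, zariskiDim_range hgen]
  norm_cast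
  constructor
  · rintro ⟨v₀, hdim, hv⟩
    have hk : ∃ k ∈ stab ρ v₀, ρ k ≠ 1 := by
      by_contra! hk
      have : fixSpace ρ v₀ = ⊤ := eq_top_iff.2 fun w _ k hk' => by
        rw [act, hk k hk', Matrix.map_one _ (map_zero _) (map_one _), mulVecLin_one,
          LinearMap.id_apply]
      rw [this, finrank_top, Module.finrank_fintype_fun_eq_card] at hdim
      omega
    obtain ⟨k, hk, hk1⟩ := hk
    obtain ⟨a, ha, hpow⟩ := exists_pow_card_eq_one ρ
    obtain h1 | ⟨l, e, hr⟩ | ⟨i, j, hij⟩ := trichotomy_of_pow_eq_one ha (hpow k)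
    · exact absurd h1 hk1
    -- The norm of `l` is an invariant vanishing on the fixed space, so it vanishes at `v`, and some
    -- translate of `v` lies on the hyperplane.
    · obtain ⟨S, hS⟩ := hgen _ (isInv_norm (ρ := ρ) (linForm (toC l)))
      have h0 := hv S fun w hw => by
        rw [eval_evalMap, hS, eval_norm_eq_zero_iff]
        refine ⟨1, ?_⟩
        rw [act_one, eval_linForm, ← act_eq_self_iff_of_isRefl hr]
        exact hw k hk
      rw [eval_evalMap, hS, eval_norm_eq_zero_iff] at h0
      obtain ⟨g, hg⟩ := h0
      exact onHyperplane_of_act (g := g) ⟨k, l, e, hr, by rwa [eval_linForm] at hg⟩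
    · have := finrank_add_two_le hij (U := fixSpace ρ v₀)
        (fun w hw => row_dotProduct_of_act_eq ρ (hw k hk) i)
        fun w hw => row_dotProduct_of_act_eq ρ (hw k hk) j
      omega
  · rintro ⟨g, l, e, hr, hl⟩
    set A : Submodule ℂ (ι → ℂ) := LinearMap.ker (dotProductBilin ℂ ℂ (toC l)) with hA
    have hmemA : ∀ w, w ∈ A ↔ toC l ⬝ᵥ w = 0 := fun w => Iff.rfl
    -- A point of the hyperplane with smallest possible isotropy has the whole hyperplane as its
    -- fixed space; if there were none, the constant `1` would vanish on the hyperplane.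
    obtain ⟨v₁, hv₁, hv₁'⟩ : ∃ v₁ ∈ A, ∀ k, act ρ k v₁ = v₁ → ∀ u ∈ A, act ρ k u = u := by
      by_contra! h
      have := eval_eq_zero_of_generic (ρ := ρ) A (f := 1) (fun w hw hw' => by
        obtain ⟨k, hk, u, hu, hne⟩ := h w hw
        exact absurd (hw' k hk u hu) hne) 0 A.zero_mem
      simp at this
    have hfix : fixSpace ρ v₁ = A := by
      refine le_antisymm (fun w hw => ?_) fun w hw k hk => hv₁' k hk w hw
      rw [hmemA, ← act_eq_self_iff_of_isRefl hr]
      exact hw g ((act_eq_self_iff_of_isRefl hr _).2 hv₁)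
    have hl0 : dotProductBilin ℂ ℂ (toC l) ≠ 0 := fun h0 => toC_ne_zero hr.ne_zero_left <| by
      ext i
      simpa using DFunLike.congr_fun h0 (Pi.single i 1)
    have h1 := Module.Dual.finrank_ker_add_one_of_ne_zero (f := dotProductBilin ℂ ℂ (toC l)) hl0
    rw [Module.finrank_fintype_fun_eq_card] at h1
    refine ⟨v₁, by rw [hfix]; exact h1, fun Q hQ => hQ v ?_⟩
    rw [hfix]
    exact hl

end Strata

end QuotientLift

end

noncomputable section

namespace QuotientLift

open MvPolynomial Matrix

set_option linter.unusedSectionVars false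

/-! ### Real and complex invariants. -/

section RealForms

variable {ι : Type*}

theorem exists_eq_map_add_map (Q : MvPolynomial ι ℂ) : ∃ Q₁ Q₂ : MvPolynomial ι ℝ,
    Q = map Complex.ofRealHom Q₁ + C Complex.I * map Complex.ofRealHom Q₂ := by
  induction Q using MvPolynomial.induction_on with
  | C a =>
    refine ⟨C a.re, C a.im, ?_⟩
    rw [map_C, map_C, ← C_mul, ← C_add]
    congr 1
    apply Complex.ext <;> simp
  | add P Q hP hQ =>
    obtain ⟨P₁, P₂, hP⟩ := hP
    obtain ⟨Q₁, Q₂, hQ⟩ := hQ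
    refine ⟨P₁ + Q₁, P₂ + Q₂, ?_⟩
    rw [hP, hQ, map_add, map_add]
    ring
  | mul_X P k hP =>
    obtain ⟨P₁, P₂, hP⟩ := hP
    refine ⟨P₁ * X k, P₂ * X k, ?_⟩
    rw [hP, map_mul, map_mul, map_X]
    ring

theorem eval_toC_map (x : ι → ℝ) (P : MvPolynomial ι ℝ) :
    eval (toC x) (map Complex.ofRealHom P) = (eval x P : ℂ) := by
  rw [eval_map]
  exact (eval₂_comp_left Complex.ofRealHom (RingHom.id ℝ) x P).symm

theorem eq_of_eval_toC_eq {P Q : MvPolynomial ι ℂ} (h : ∀ x, eval (toC x) P = eval (toC x) Q) :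
    P = Q := by
  rw [← sub_eq_zero]
  obtain ⟨D₁, D₂, hD⟩ := exists_eq_map_add_map (P - Q)
  have h0 : ∀ x : ι → ℝ, (eval x D₁ : ℂ) + Complex.I * (eval x D₂ : ℂ) = 0 := fun x => by
    rw [← eval_toC_map, ← eval_toC_map, ← eval_C (f := toC x) Complex.I, ← map_mul, ← map_add,
      ← hD, map_sub, h, sub_self]
  have h1 : D₁ = 0 := MvPolynomial.funext fun x => by
    simpa using congrArg Complex.re (h0 x)
  have h2 : D₂ = 0 := MvPolynomial.funext fun x => by
    simpa using congrArg Complex.im (h0 x)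
  rw [hD, h1, h2]
  simp

theorem aeval_map_map {m : ℕ} (c : Fin m → MvPolynomial ι ℝ) (S : MvPolynomial (Fin m) ℝ) :
    aeval (fun i => map Complex.ofRealHom (c i)) (map Complex.ofRealHom S) =
      map Complex.ofRealHom (aeval c S) := by
  induction S using MvPolynomial.induction_on with
  | C a => simp [algebraMap_eq]
  | add p q hp hq => simp only [map_add, hp, hq]
  | mul_X p k hp => simp only [map_mul, hp, aeval_X, map_X]

variable [Fintype ι] [DecidableEq ι] {G : Type*} [Group G] [Finite G]
  {ρ : G →* Matrix ι ι ℝ}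

theorem act_toC (g : G) (x : ι → ℝ) : act ρ g (toC x) = toC (ρ g *ᵥ x) := by
  ext i
  simp [act, toC, mulVec, dotProduct]

theorem isInv_map_ofReal_iff {P : MvPolynomial ι ℝ} :
    IsInv ρ (map Complex.ofRealHom P) ↔ ∀ g x, eval (ρ g *ᵥ x) P = eval x P := by
  constructor
  · intro h g x
    have := h g (toC x)
    rw [act_toC, eval_toC_map, eval_toC_map] at this
    exact_mod_cast this
  · intro h
    rw [isInv_iff_pullback]
    refine fun g => eq_of_eval_toC_eq fun x => ?_
    rw [eval_pullback, act_toC, eval_toC_map, eval_toC_map, h]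

/-- Generators of the real invariants also generate the complex ones. -/
theorem exists_aeval_eq_of_isInv {m : ℕ} {c : Fin m → MvPolynomial ι ℝ}
    (hc : ∀ P, (∀ g x, eval (ρ g *ᵥ x) P = eval x P) → ∃ S : MvPolynomial (Fin m) ℝ, aeval c S = P)
    {Q : MvPolynomial ι ℂ} (hQ : IsInv ρ Q) :
    ∃ S : MvPolynomial (Fin m) ℂ, aeval (fun i => map Complex.ofRealHom (c i)) S = Q := by
  obtain ⟨Q₁, Q₂, rfl⟩ := exists_eq_map_add_map Q
  have h : ∀ g x, (eval (ρ g *ᵥ x) Q₁ : ℂ) + Complex.I * (eval (ρ g *ᵥ x) Q₂ : ℂ) =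
      (eval x Q₁ : ℂ) + Complex.I * (eval x Q₂ : ℂ) := fun g x => by
    have := hQ g (toC x)
    simpa only [act_toC, map_add, map_mul, eval_C, eval_toC_map] using this
  obtain ⟨S₁, hS₁⟩ := hc Q₁ fun g x => by simpa using congrArg Complex.re (h g x)
  obtain ⟨S₂, hS₂⟩ := hc Q₂ fun g x => by simpa using congrArg Complex.im (h g x)
  refine ⟨map Complex.ofRealHom S₁ + C Complex.I * map Complex.ofRealHom S₂, ?_⟩
  rw [map_add, map_mul, aeval_map_map, aeval_map_map, hS₁, hS₂, ← algebraMap_eq,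
    AlgHom.commutes, algebraMap_eq]

end RealForms

/-! ### Linear coordinates on complexifications. -/

section Coordinates

variable (V : Type*) [AddCommGroup V] [Module ℝ V] [FiniteDimensional ℝ V]

/-- Linear coordinates on the complexification. -/
def coord : Cplx V ≃ₗ[ℂ] (Fin (Module.finrank ℝ V) → ℂ) :=
  ((Module.finBasis ℝ V).baseChange ℂ).equivFun

variable {V} (G : Subgroup (V ≃ₗ[ℝ] V))

/-- The matrix representation given by a basis. -/
def matRep : G →* Matrix (Fin (Module.finrank ℝ V)) (Fin (Module.finrank ℝ V)) ℝ where
  toFun g := LinearMap.toMatrix (Module.finBasis ℝ V) (Module.finBasis ℝ V)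
    ((g : V ≃ₗ[ℝ] V) : V →ₗ[ℝ] V)
  map_one' := LinearMap.toMatrix_one _
  map_mul' _ _ := LinearMap.toMatrix_mul _ _ _

theorem matRep_injective : Function.Injective (matRep G) := fun _ _ hgh =>
  Subtype.ext <| LinearEquiv.toLinearMap_injective <|
    (LinearMap.toMatrix (Module.finBasis ℝ V) (Module.finBasis ℝ V)).injective hgh

variable {G}

theorem coord_baseChange (g : G) (v : Cplx V) :
    coord V (LinearMap.baseChange ℂ ((g : V ≃ₗ[ℝ] V) : V →ₗ[ℝ] V) v) =
      act (matRep G) g (coord V v) := by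
  have h := LinearMap.toMatrix_mulVec_repr ((Module.finBasis ℝ V).baseChange ℂ)
    ((Module.finBasis ℝ V).baseChange ℂ)
    (LinearMap.baseChange ℂ ((g : V ≃ₗ[ℝ] V) : V →ₗ[ℝ] V)) v
  have hm : LinearMap.toMatrix ((Module.finBasis ℝ V).baseChange ℂ)
      ((Module.finBasis ℝ V).baseChange ℂ)
      (LinearMap.baseChange ℂ ((g : V ≃ₗ[ℝ] V) : V →ₗ[ℝ] V)) =
      (matRep G g).map (algebraMap ℝ ℂ) := by
    ext i j
    have : matRep G g i j = LinearMap.toMatrix (Module.finBasis ℝ V) (Module.finBasis ℝ V)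
        ((g : V ≃ₗ[ℝ] V) : V →ₗ[ℝ] V) i j := rfl
    simp [LinearMap.toMatrix_apply, this]
  rw [hm] at h
  exact h.symm

theorem mem_invariants_iff {P : PolyRing V} : P ∈ invariants G ↔
    ∀ (g : G) (x : Fin (Module.finrank ℝ V) → ℝ), eval (matRep G g *ᵥ x) P = eval x P := by
  have h : ∀ (g : G) (v : V), (fun i => (Module.finBasis ℝ V).repr ((g : V ≃ₗ[ℝ] V) v) i) =
      matRep G g *ᵥ fun i => (Module.finBasis ℝ V).repr v i := fun g v =>
    (LinearMap.toMatrix_mulVec_repr _ _ ((g : V ≃ₗ[ℝ] V) : V →ₗ[ℝ] V) v).symm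
  constructor
  · intro hP g x
    obtain ⟨v, rfl⟩ := (Module.finBasis ℝ V).equivFun.surjective x
    have := hP g g.2 v
    rw [evalReal, h] at this
    exact this
  · intro hP g hg v
    rw [evalReal, h ⟨g, hg⟩, hP]
    rfl

end Coordinates

/-! ### Quotient maps and strata in coordinates. -/

namespace HomogeneousGenerators

variable {V : Type*} [AddCommGroup V] [Module ℝ V] [FiniteDimensional ℝ V]
  {G : Subgroup (V ≃ₗ[ℝ] V)} {m : ℕ} (p : HomogeneousGenerators G m)

/-- The generators as complex polynomials. -/
def cpoly (i : Fin m) : MvPolynomial (Fin (Module.finrank ℝ V)) ℂ :=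
  MvPolynomial.map Complex.ofRealHom (p.poly i)

theorem map_eq_evalMap (v : Cplx V) : p.map v = evalMap p.cpoly (coord V v) := by
  funext i
  rw [HomogeneousGenerators.map, evalCplx, evalMap, cpoly, eval_map]
  rfl

theorem isInv_cpoly [Finite G] (i : Fin m) : IsInv (matRep G) (p.cpoly i) := by
  refine isInv_map_ofReal_iff.2 (mem_invariants_iff.1 ?_)
  rw [← p.adjoin_eq]
  exact Algebra.subset_adjoin ⟨i, rfl⟩

theorem exists_aeval_cpoly_eq [Finite G] {Q : MvPolynomial (Fin (Module.finrank ℝ V)) ℂ}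
    (hQ : IsInv (matRep G) Q) : ∃ S : MvPolynomial (Fin m) ℂ, aeval p.cpoly S = Q := by
  refine exists_aeval_eq_of_isInv (fun P hP => ?_) hQ
  rw [← mem_invariants_iff, ← p.adjoin_eq, Algebra.adjoin_range_eq_range_aeval] at hP
  exact hP

theorem exists_act_eq_of_evalMap_eq [Finite G] {x y : Fin (Module.finrank ℝ V) → ℂ}
    (h : evalMap p.cpoly x = evalMap p.cpoly y) : ∃ g, x = QuotientLift.act (matRep G) g y :=
  exists_act_eq_of_eval_eq _ fun b hb => by
    obtain ⟨S, rfl⟩ := p.exists_aeval_cpoly_eq hb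
    rw [← eval_evalMap, h, eval_evalMap]

theorem sameIsotropyType_iff (v w : Cplx V) :
    SameIsotropyType G v w ↔ SameStab (matRep G) (coord V v) (coord V w) := by
  have hst : ∀ (k : G) (u : Cplx V), k ∈ stab (matRep G) (coord V u) ↔
      (k : V ≃ₗ[ℝ] V) ∈ isotropy G u := fun k u => by
    rw [mem_stab, ← coord_baseChange, (coord V).injective.eq_iff]
    exact (and_iff_right k.2).symm
  have hcj : ∀ (g k : V ≃ₗ[ℝ] V) (S : Set (V ≃ₗ[ℝ] V)),
      k ∈ (fun k => g * k * g⁻¹) '' S ↔ g⁻¹ * k * g ∈ S := fun g k S => by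
    constructor
    · rintro ⟨a, ha, rfl⟩
      simpa [mul_assoc] using ha
    · exact fun h => ⟨_, h, by simp [mul_assoc]⟩
  constructor
  · rintro ⟨g, hg, h⟩
    refine ⟨⟨g, hg⟩, fun k => ?_⟩
    rw [hst, h, hcj, hst]
    rfl
  · rintro ⟨g, h⟩
    refine ⟨g, g.2, Set.ext fun k => ?_⟩
    rw [hcj]
    by_cases hk : k ∈ G
    · have := h ⟨k, hk⟩
      rw [hst, hst] at this
      exact this
    · refine iff_of_false (fun h => hk h.1) fun h => hk ?_
      have := G.mul_mem (G.mul_mem g.2 h.1) (G.inv_mem g.2)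
      simpa [mul_assoc] using this

theorem image_eq_evalMap_image (v : Cplx V) : p.map '' {w | SameIsotropyType G v w} =
    evalMap p.cpoly '' {w | SameStab (matRep G) (coord V v) w} := by
  ext y
  constructor
  · rintro ⟨w, hw, rfl⟩
    exact ⟨coord V w, (sameIsotropyType_iff v w).1 hw, (p.map_eq_evalMap w).symm⟩
  · rintro ⟨w, hw, rfl⟩
    refine ⟨(coord V).symm w, (sameIsotropyType_iff v _).2 ?_, ?_⟩
    · rw [LinearEquiv.apply_symm_apply]
      exact hw
    · rw [map_eq_evalMap, LinearEquiv.apply_symm_apply]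

theorem map_mem_codimOneLocus_iff [Finite G] (v : Cplx V) :
    p.map v ∈ p.codimOneLocus ↔ OnHyperplane (matRep G) (coord V v) := by
  rw [← exists_stratum_iff_onHyperplane p.isInv_cpoly fun f hf => p.exists_aeval_cpoly_eq hf,
    ← map_eq_evalMap]
  have hr : p.quotientVariety = Set.range (evalMap p.cpoly) := by
    rw [quotientVariety, ← (coord V).surjective.range_comp]
    exact congrArg Set.range (_root_.funext p.map_eq_evalMap)
  constructor
  · rintro ⟨_, ⟨⟨v₀, rfl⟩, hd⟩, hv⟩
    rw [image_eq_evalMap_image] at hd hv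
    exact ⟨_, hr ▸ hd, hv⟩
  · rintro ⟨x, hd, hv⟩
    refine ⟨_, ⟨⟨(coord V).symm x, rfl⟩, ?_⟩, ?_⟩
    · rw [image_eq_evalMap_image, LinearEquiv.apply_symm_apply, hr]
      exact hd
    · rw [image_eq_evalMap_image, LinearEquiv.apply_symm_apply]
      exact hv

end HomogeneousGenerators

end QuotientLift

end

noncomputable section

namespace QuotientLift

open MvPolynomial Matrix

set_option linter.unusedSectionVars false

/-! ### The orbit correspondence of a quasilinear isomorphism. -/

section Correspondence

variable {V W : Type*} [AddCommGroup V] [Module ℝ V] [FiniteDimensional ℝ V]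
  [AddCommGroup W] [Module ℝ W] [FiniteDimensional ℝ W]
  {G : Subgroup (V ≃ₗ[ℝ] V)} {H : Subgroup (W ≃ₗ[ℝ] W)} [Finite G] [Finite H] {m n : ℕ}
  {p : HomogeneousGenerators G m} {q : HomogeneousGenerators H n}

variable (p) in
/-- The quotient map in linear coordinates. -/
def coordProj (x : Fin (Module.finrank ℝ V) → ℂ) : p.quotientVariety := p.proj ((coord V).symm x)

theorem coe_coordProj (x : Fin (Module.finrank ℝ V) → ℂ) :
    (coordProj p x : Fin m → ℂ) = evalMap p.cpoly x :=
  (p.map_eq_evalMap _).trans (by rw [LinearEquiv.apply_symm_apply])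

theorem coordProj_surjective (y : p.quotientVariety) : ∃ x, coordProj p x = y := by
  obtain ⟨_, v, rfl⟩ := y
  exact ⟨coord V v, by rw [coordProj, LinearEquiv.symm_apply_apply]; rfl⟩

theorem coordProj_eq_iff {x y : Fin (Module.finrank ℝ V) → ℂ} :
    coordProj p x = coordProj p y ↔ ∃ g, x = act (matRep G) g y := by
  rw [Subtype.ext_iff, coe_coordProj, coe_coordProj]
  refine ⟨p.exists_act_eq_of_evalMap_eq, ?_⟩
  rintro ⟨g, rfl⟩
  exact evalMap_act p.isInv_cpoly g y

theorem coordProj_smul (t : ℝ) (x : Fin (Module.finrank ℝ V) → ℂ) :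
    coordProj p ((t : ℂ) • x) = p.act t (coordProj p x) := by
  refine Subtype.ext ?_
  change p.map ((coord V).symm ((t : ℂ) • x)) = scale p.deg t (p.map ((coord V).symm x))
  rw [map_smul, p.map_scale]

theorem exists_eval_eq_of_isRegularMap {f : p.quotientVariety → q.quotientVariety}
    (hf : IsRegularMap f) {b : MvPolynomial (Fin (Module.finrank ℝ W)) ℂ}
    (hb : IsInv (matRep H) b) :
    ∃ a, ∀ x y, f (coordProj p x) = coordProj q y → eval x a = eval y b := by
  obtain ⟨P, hP⟩ := hf
  obtain ⟨S, rfl⟩ := q.exists_aeval_cpoly_eq hb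
  refine ⟨aeval p.cpoly (aeval P S), fun x y hxy => ?_⟩
  have h : evalMap P (evalMap p.cpoly x) = evalMap q.cpoly y := by
    rw [← coe_coordProj, ← coe_coordProj, ← hxy]
    exact _root_.funext fun j => (hP _ j).symm
  rw [← eval_evalMap, ← eval_evalMap, ← eval_evalMap, h]

theorem act_inv_cancel {t : ℝ} (ht : t ≠ 0) (y : p.quotientVariety) :
    p.act t (p.act t⁻¹ y) = y := by
  refine Subtype.ext (_root_.funext fun i => ?_)
  change (t : ℂ) ^ p.deg i * (((t⁻¹ : ℝ) : ℂ) ^ p.deg i * (y : Fin m → ℂ) i) = _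
  rw [← mul_assoc, ← mul_pow, ← Complex.ofReal_mul, mul_inv_cancel₀ ht, Complex.ofReal_one,
    one_pow, one_mul]

/-- A quasilinear regular map commutes with complex scaling. -/
theorem IsQuasilinear.smul {f : p.quotientVariety → q.quotientVariety} (hq : IsQuasilinear p q f)
    (hf : IsRegularMap f) {x : Fin (Module.finrank ℝ V) → ℂ} {y : Fin (Module.finrank ℝ W) → ℂ}
    (h : f (coordProj p x) = coordProj q y) (t : ℂ) :
    f (coordProj p (t • x)) = coordProj q (t • y) := by
  have hreal : ∀ s ∈ Set.Ioc (0 : ℝ) 1,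
      f (coordProj p ((s : ℂ) • x)) = coordProj q ((s : ℂ) • y) := fun s hs => by
    rw [coordProj_smul, coordProj_smul, ← h, ← hq s hs (coordProj p x), act_inv_cancel hs.1.ne']
  obtain ⟨P, hP⟩ := hf
  have key : ∀ (s : ℂ) (j : Fin n), (f (coordProj p (s • x)) : Fin n → ℂ) j =
      (restrictLine (aeval p.cpoly (P j)) 0 x).eval s := fun s j => by
    rw [hP, coe_coordProj, eval_evalMap, eval_restrictLine, zero_add]
  have key' : ∀ (s : ℂ) (j : Fin n), (coordProj q (s • y) : Fin n → ℂ) j =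
      (restrictLine (q.cpoly j) 0 y).eval s := fun s j => by
    rw [coe_coordProj, eval_restrictLine, zero_add, evalMap]
  refine Subtype.ext (_root_.funext fun j => ?_)
  rw [key, key']
  congr 1
  -- In each component both sides are polynomial in the scalar, and they agree on the infinite set
  -- `(0, 1]`.
  refine Polynomial.eq_of_infinite_eval_eq _ _ (Set.Infinite.mono ?_
    ((Set.Ioc_infinite (zero_lt_one (α := ℝ))).image Complex.ofReal_injective.injOn))
  rintro _ ⟨s, hs, rfl⟩
  change Polynomial.eval _ _ = Polynomial.eval _ _
  rw [← key, ← key', hreal s hs]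

theorem IsQuasilinear.orbitCorrespondence {f₀ : p.quotientVariety ≃ q.quotientVariety}
    (hquasilinear : IsQuasilinear p q f₀) (hf₀ : IsRegularMap f₀) (hf₀_symm : IsRegularMap f₀.symm)
    (hstrata : (fun y => (f₀ y : Fin n → ℂ)) '' {y | (y : Fin m → ℂ) ∈ p.codimOneLocus} =
      q.codimOneLocus) :
    OrbitCorrespondence (matRep G) (matRep H) fun x y => f₀ (coordProj p x) = coordProj q y where
  injective_left := matRep_injective G
  injective_right := matRep_injective H
  exists_right x := (coordProj_surjective (f₀ (coordProj p x))).imp fun _ h => h.symm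
  exists_left y := (coordProj_surjective (f₀.symm (coordProj q y))).imp fun _ h => by
    rw [h, Equiv.apply_symm_apply]
  right_iff h _ := by rw [h, eq_comm, coordProj_eq_iff]
  left_iff h _ := by rw [← h, f₀.injective.eq_iff, coordProj_eq_iff]
  pull := exists_eval_eq_of_isRegularMap hf₀
  push ha := (exists_eval_eq_of_isRegularMap hf₀_symm ha).imp fun _ h x y hxy =>
    h y x (by rw [← hxy, Equiv.symm_apply_apply])
  smul := hquasilinear.smul hf₀
  onHyperplane_iff {x y} h := by
    have hx := p.map_mem_codimOneLocus_iff ((coord V).symm x)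
    have hy := q.map_mem_codimOneLocus_iff ((coord W).symm y)
    rw [LinearEquiv.apply_symm_apply] at hx hy
    have h' : (f₀ (coordProj p x) : Fin n → ℂ) = q.map ((coord W).symm y) :=
      congrArg Subtype.val h
    rw [← hx, ← hy, ← hstrata, ← h']
    refine ⟨fun hv => ⟨coordProj p x, hv, rfl⟩, ?_⟩
    rintro ⟨z, hz, hzx⟩
    rw [f₀.injective (Subtype.ext hzx)] at hz
    exact hz

/-- The fibres of `R` on both sides are full orbits, so any bijection with graph inside `R` carries
orbits onto orbits. -/
theorem isQuasiIsomorphism_of_orbits {F : Cplx V ≃ₗ[ℂ] Cplx W} {R : Cplx V → Cplx W → Prop}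
    (hF : ∀ v, R v (F v)) (hr : ∀ {v w}, R v w → ∀ {w'}, R v w' ↔ w' ∈ orbit H w)
    (hl : ∀ {v w}, R v w → ∀ {v'}, R v' w ↔ v' ∈ orbit G v) : IsQuasiIsomorphism G H F := by
  have key : ∀ v, F '' orbit G v = orbit H (F v) := fun v => by
    ext w
    constructor
    · rintro ⟨v', hv', rfl⟩
      exact (hr ((hl (hF v)).2 hv')).1 (hF v')
    · intro hw
      have h := hF (F.symm w)
      rw [F.apply_symm_apply] at h
      exact ⟨F.symm w, (hl ((hr (hF v)).2 hw)).1 h, F.apply_symm_apply w⟩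
  refine ⟨key, fun w => ?_⟩
  rw [← F.apply_symm_apply w, ← key]
  simp [Set.image_image]

theorem mem_orbit_iff {v w : Cplx V} :
    w ∈ orbit G v ↔ ∃ g, coord V w = act (matRep G) g (coord V v) := by
  simp only [← coord_baseChange, (coord V).injective.eq_iff]
  exact ⟨fun ⟨g, hg, h⟩ => ⟨⟨g, hg⟩, h⟩, fun ⟨g, h⟩ => ⟨g, g.2, h⟩⟩

end Correspondence

end QuotientLift

end

theorem mainTheorem5 {V W : Type*}
    [AddCommGroup V] [Module ℝ V] [FiniteDimensional ℝ V]
    [AddCommGroup W] [Module ℝ W] [FiniteDimensional ℝ W]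
    (G : Subgroup (V ≃ₗ[ℝ] V)) (H : Subgroup (W ≃ₗ[ℝ] W)) [Finite G] [Finite H]
    {m n : ℕ} (p : QuotientLift.HomogeneousGenerators G m)
    (q : QuotientLift.HomogeneousGenerators H n)
    (f₀ : p.quotientVariety ≃ q.quotientVariety)
    (hf₀ : QuotientLift.IsRegularMap f₀) (hf₀_symm : QuotientLift.IsRegularMap f₀.symm)
    (hquasilinear : QuotientLift.IsQuasilinear p q f₀)
    (hstrata : (fun y => (f₀ y : Fin n → ℂ)) ''
      {y | (y : Fin m → ℂ) ∈ p.codimOneLocus} = q.codimOneLocus) :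
    ∃ F : QuotientLift.Cplx V ≃ₗ[ℂ] QuotientLift.Cplx W,
      QuotientLift.IsQuasiIsomorphism G H F ∧
      ∀ v : QuotientLift.Cplx V, q.proj (F v) = f₀ (p.proj v) := by
  have hR := hquasilinear.orbitCorrespondence hf₀ hf₀_symm hstrata
  obtain ⟨F, hF⟩ := hR.exists_linearEquiv
  have hproj : ∀ v, q.proj ((QuotientLift.coord W).symm (F (QuotientLift.coord V v))) =
      f₀ (p.proj v) := fun v => by
    have := hF (QuotientLift.coord V v)
    rw [QuotientLift.coordProj, LinearEquiv.symm_apply_apply] at this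
    exact this.symm
  refine ⟨(QuotientLift.coord V).trans (F.trans (QuotientLift.coord W).symm), ?_, hproj⟩
  refine QuotientLift.isQuasiIsomorphism_of_orbits
    (R := fun v w => f₀ (QuotientLift.coordProj p (QuotientLift.coord V v)) =
      QuotientLift.coordProj q (QuotientLift.coord W w)) (fun v => ?_) (fun h _ => ?_) fun h _ => ?_
  · simpa using hF (QuotientLift.coord V v)
  · rw [hR.right_iff h, QuotientLift.mem_orbit_iff]
  · rw [hR.left_iff h, QuotientLift.mem_orbit_iff]
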